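/- A \emph{$C^*$-quantum groupoid} is a finite-dimensional complex algebra $H$ with unit, with a coassociative comultiplication $\Delta(h)=h_{(1)}\otimes h_{(2)}$ and a counit $\varepsilon$ such that $\Delta$ is multiplicative (not necessarily unital), $(\Delta\otimes\mathrm{id})\Delta(1)=(\Delta(1)\otimes1)(1\otimes\Delta(1))=(1\otimes\Delta(1))(\Delta(1)\otimes1)$, $\varepsilon(fgh)=\varepsilon(fg_{(1)})\varepsilon(g_{(2)}h)=\varepsilon(fg_{(2)})\varepsilon(g_{(1)}h)$, with an algebra and coalgebra anti-homomorphism $S$ (the antipode) satisfying $h_{(1)}S(h_{(2)})=\varepsilon_t(h):=\varepsilon(1_{(1)}h)1_{(2)}$ and $S(h_{(1)})h_{(2)}=\varepsilon_s(h):=1_{(1)}\varepsilon(h1_{(2)})$, and with an antilinear involutive anti-automorphism $*$ such that $\Delta(h^*)=\Delta(h)^{*\otimes *}$ and $x^*x=0$ implies $x=0$. It is \emph{quasitriangular} with $R$-matrix $R=R^{(1)}\otimes R^{(2)}\in\Delta^{op}(1)(H\otimes H)\Delta(1)$ if $\Delta^{op}(h)R=R\Delta(h)$ for all $h$, $(\mathrm{id}\otimes\Delta)R=R_{13}R_{12}$,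 $(\Delta\otimes\mathrm{id})R=R_{13}R_{23}$, and there is $\bar R\in\Delta(1)(H\otimes H)\Delta^{op}(1)$ with $R\bar R=\Delta^{op}(1)$, $\bar RR=\Delta(1)$. Its Drinfeld element is $u=S(R^{(2)})R^{(1)}$. The \emph{canonical group-like element} $g$ of $H$ is the unique positive invertible $g\in H$ (positive: of the form $a^*a$) with $S^2(h)=ghg^{-1}$ for all $h$, $\mathrm{tr}\,\pi(g^{-1})=\mathrm{tr}\,\pi(g)\neq0$ for all irreducible representations $\pi$, $S(g)=g^{-1}$ and $\Delta(g)=(g\otimes g)\Delta(1)=\Delta(1)(g\otimes g)$. Objects of $\mathrm{URep}(H)$ are finite-dimensional (unital) left $H$-modules $V$ with a Hilbert space scalar product such that $(hv,w)=(v,h^*w)$ (scalar products are linear in the first variable); morphisms are all $H$-linear maps, and $\bar f:W\to V$ denotes the Hilbert space adjoint of $f:V\to W$. The structure of $\mathrm{URep}(H)$ is as follows. - $V\otimes W=\Delta(1)(V\otimes_{\mathbb C}W)$, a Hilbert subspace of $V\otimes_{\mathbb C}W$ on which $H$ acts through $\Delta$; the associativity isomorphisms are the standard ones. - The unit object is $H_t=\varepsilon_t(H)$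 with $h\cdot z=\varepsilon_t(hz)$ and $(z,t)=\varepsilon(t^*z)$; the unit isomorphisms are given by $l_V(1_{(1)}\cdot z\otimes1_{(2)}v)=zv$ and $r_V^{-1}(v)=1_{(1)}v\otimes1_{(2)}$. - $V^*=\mathrm{Hom}_{\mathbb C}(V,\mathbb C)$ with $(h\phi)(v)=\phi(S(h)v)$ and, for $\bar v=(\cdot,v)$, $(\bar v,\bar w)=(w,gv)$; $b_V:H_t\to V\otimes V^*$ is $z\mapsto z\cdot\sum_if_i\otimes\xi^i$ for dual bases $(f_i)$ of $V$ and $(\xi^i)$ of $V^*$, and $d_V:V^*\otimes V\to H_t$ is $\sum_j\phi^j\otimes v_j\mapsto\sum_j\phi^j(1_{(1)}v_j)1_{(2)}$. - The braiding is $c_{V,W}(x^{(1)}\otimes x^{(2)})=R^{(2)}x^{(2)}\otimes R^{(1)}x^{(1)}$ and the twist is $\theta_V(v)=u^{-1}gv$. \textbf{Lemma.} Let $H$ be a quasitriangular $C^*$-quantum groupoid. Then $g$ exists and is unique, $u$ is invertible, and the objects and morphisms just described are well defined; in particular $H_t$ and $V^*$ are unitary $H$-modules. With them, and with the conjugation $f\mapsto\bar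 f$, $\mathrm{URep}(H)$ is a unitary ribbon Ab-category. That is, $\mathrm{URep}(H)$ is a monoidal category with $\mathbb C$-bilinear $\circ$ and $\otimes$, $c$ is a braiding, and $\theta$ is a twist: it is natural, with $\theta_{V\otimes W}=c_{W,V}c_{V,W}(\theta_V\otimes\theta_W)$. Moreover $(b_V,d_V)$ is a duality compatible with the twist, meaning $(\theta_V\otimes\mathrm{id})b_V=(\mathrm{id}\otimes\theta_{V^*})b_V$. The conjugation is additive, antilinear and involutive, $\overline{f\otimes g}=\bar f\otimes\bar g$, $\overline{f\circ g}=\bar g\circ\bar f$, the associativity and unit isomorphisms are unitary, $\overline{c_{V,W}}=c_{V,W}^{-1}$, $\overline{\theta_V}=\theta_V^{-1}$, $\overline{b_V}=d_Vc_{V,V^*}(\theta_V\otimes\mathrm{id})$ and $\overline{d_V}=(\mathrm{id}\otimes\theta_V^{-1})c_{V^*,V}^{-1}b_V$. Finally, for every morphism $f$, the quantum trace satisfies $\mathrm{tr}_q(f\bar f)\ge0$, where $\mathrm{tr}_q(e)=d_Vc_{V,V^*}(\theta_Ve\otimes\mathrm{id})b_V\in\mathrm{End}(H_t)$ for $e\in\mathrm{End}(V)$.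 Here $\ge0$ means that $\mathrm{tr}_q(f\bar f)$ is a positive operator on the Hilbert space $H_t$, equivalently of the form $s\bar s$ with $s\in\mathrm{End}(H_t)$ in $\mathrm{URep}(H)$; if $\mathrm{End}(H_t)=\mathbb C$ it is a scalar $\ge0$. -/

import Mathlib

open CategoryTheory MonoidalCategory
open scoped TensorProduct InnerProductSpace

universe v u

noncomputable section

/-! ### Unitary ribbon Ab-categories -/

/-- The data of a ribbon category beyond its monoidal structure: braiding, twist, and a duality
`b_V : 𝟙 ⟶ V ⊗ V*`, `d_V : V* ⊗ V ⟶ 𝟙`. -/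
structure RibbonData (C : Type u) [Category.{v} C] [MonoidalCategoryStruct C] where
  braiding : ∀ V W : C, V ⊗ W ≅ W ⊗ V
  twist : ∀ V : C, V ≅ V
  dual : C → C
  coev : ∀ V : C, 𝟙_ C ⟶ V ⊗ dual V
  ev : ∀ V : C, dual V ⊗ V ⟶ 𝟙_ C

namespace RibbonData

/-- The quantum trace `tr_q f = d_V ∘ c_{V,V*} ∘ (θ_V f ⊗ id) ∘ b_V`. -/
def qtrace {C : Type u} [Category.{v} C] [MonoidalCategoryStruct C] (D : RibbonData C)
    {V : C} (f : V ⟶ V) : 𝟙_ C ⟶ 𝟙_ C :=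
  D.coev V ≫ ((f ≫ (D.twist V).hom) ▷ D.dual V) ≫ (D.braiding V (D.dual V)).hom ≫ D.ev V

/-- The axioms of a ribbon Ab-category over `k`: a monoidal category with `k`-bilinear composition
(this is the instance `Linear k C`) and `k`-bilinear tensor product, with a braiding, a twist and
a compatible duality. -/
structure IsRibbonAb (k : Type*) [Field k] {C : Type u} [Category.{v} C] [Preadditive C]
    [Linear k C] [S : MonoidalCategoryStruct C] (D : RibbonData C) : Prop where
  monoidal : ∃ M : MonoidalCategory C, M.toMonoidalCategoryStruct = S
  add_tensor : ∀ {V V' W W' : C} (f f' : V ⟶ V') (g : W ⟶ W'),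
    (f + f') ⊗ₘ g = (f ⊗ₘ g) + (f' ⊗ₘ g)
  tensor_add : ∀ {V V' W W' : C} (f : V ⟶ V') (g g' : W ⟶ W'),
    f ⊗ₘ (g + g') = (f ⊗ₘ g) + (f ⊗ₘ g')
  smul_tensor : ∀ {V V' W W' : C} (a : k) (f : V ⟶ V') (g : W ⟶ W'),
    (a • f) ⊗ₘ g = a • (f ⊗ₘ g)
  tensor_smul : ∀ {V V' W W' : C} (a : k) (f : V ⟶ V') (g : W ⟶ W'),
    f ⊗ₘ (a • g) = a • (f ⊗ₘ g)
  braiding_naturality : ∀ {V V' W W' : C} (f : V ⟶ V') (g : W ⟶ W'),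
    (f ⊗ₘ g) ≫ (D.braiding V' W').hom = (D.braiding V W).hom ≫ (g ⊗ₘ f)
  hexagon_forward : ∀ U V W : C,
    (α_ U V W).hom ≫ (D.braiding U (V ⊗ W)).hom ≫ (α_ V W U).hom =
      ((D.braiding U V).hom ▷ W) ≫ (α_ V U W).hom ≫ (V ◁ (D.braiding U W).hom)
  hexagon_reverse : ∀ U V W : C,
    (α_ U V W).inv ≫ (D.braiding (U ⊗ V) W).hom ≫ (α_ W U V).inv =
      (U ◁ (D.braiding V W).hom) ≫ (α_ U W V).inv ≫ ((D.braiding U W).hom ▷ V)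
  twist_naturality : ∀ {V W : C} (f : V ⟶ W),
    f ≫ (D.twist W).hom = (D.twist V).hom ≫ f
  twist_tensor : ∀ V W : C,
    (D.twist (V ⊗ W)).hom =
      ((D.twist V).hom ⊗ₘ (D.twist W).hom) ≫ (D.braiding V W).hom ≫ (D.braiding W V).hom
  coev_ev : ∀ V : C,
    (D.coev V ▷ V) ≫ (α_ V (D.dual V) V).hom ≫ (V ◁ D.ev V) = (λ_ V).hom ≫ (ρ_ V).inv
  ev_coev : ∀ V : C,
    (D.dual V ◁ D.coev V) ≫ (α_ (D.dual V) V (D.dual V)).inv ≫ (D.ev V ▷ D.dual V) =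
      (ρ_ (D.dual V)).hom ≫ (λ_ (D.dual V)).inv
  twist_dual : ∀ V : C,
    D.coev V ≫ ((D.twist V).hom ▷ D.dual V) = D.coev V ≫ (V ◁ (D.twist (D.dual V)).hom)

/-- The axioms of a unitary ribbon Ab-category, with respect to a conjugation `f ↦ f̄`. As the
monoidal category need not be strict, the associativity and unit isomorphisms are required to be
unitary. An endomorphism of the unit object is nonnegative if it is of the form `s ∘ s̄`; when all
endomorphisms of the unit object are scalars, these are the scalars `≥ 0`. -/
structure IsUnitaryRibbonAb {C : Type u} [Category.{v} C] [Preadditive C]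
    [Linear ℂ C] [MonoidalCategoryStruct C] (D : RibbonData C)
    (conj : ∀ {V W : C}, (V ⟶ W) → (W ⟶ V)) : Prop extends D.IsRibbonAb ℂ where
  conj_conj : ∀ {V W : C} (f : V ⟶ W), conj (conj f) = f
  conj_add : ∀ {V W : C} (f g : V ⟶ W), conj (f + g) = conj f + conj g
  conj_smul : ∀ {V W : C} (a : ℂ) (f : V ⟶ W), conj (a • f) = (starRingEnd ℂ a) • conj f
  conj_tensor : ∀ {V V' W W' : C} (f : V ⟶ V') (g : W ⟶ W'),
    conj (f ⊗ₘ g) = conj f ⊗ₘ conj g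
  conj_comp : ∀ {U V W : C} (f : U ⟶ V) (g : V ⟶ W), conj (f ≫ g) = conj g ≫ conj f
  conj_associator : ∀ U V W : C, conj (α_ U V W).hom = (α_ U V W).inv
  conj_leftUnitor : ∀ V : C, conj (λ_ V).hom = (λ_ V).inv
  conj_rightUnitor : ∀ V : C, conj (ρ_ V).hom = (ρ_ V).inv
  conj_braiding : ∀ V W : C, conj (D.braiding V W).hom = (D.braiding V W).inv
  conj_twist : ∀ V : C, conj (D.twist V).hom = (D.twist V).inv
  conj_coev : ∀ V : C, conj (D.coev V) =
    ((D.twist V).hom ▷ D.dual V) ≫ (D.braiding V (D.dual V)).hom ≫ D.ev V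
  conj_ev : ∀ V : C, conj (D.ev V) =
    D.coev V ≫ (D.braiding (D.dual V) V).inv ≫ (D.dual V ◁ (D.twist V).inv)
  qtrace_nonneg : ∀ {V W : C} (f : V ⟶ W),
    ∃ s : 𝟙_ C ⟶ 𝟙_ C, D.qtrace (conj f ≫ f) = conj s ≫ s

end RibbonData

/-! ### Quantum groupoids -/

namespace QGroupoid

open Coalgebra

section General

variable {k : Type*} [Field k] {H : Type u} [Ring H] [Algebra k H]

/-- `x ↦ x₁₂ = x ⊗ 1` in `H ⊗ H ⊗ H`. -/
def leg12 : H ⊗[k] H →ₐ[k] H ⊗[k] (H ⊗[k] H) :=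
  Algebra.TensorProduct.map (AlgHom.id k H) Algebra.TensorProduct.includeLeft

/-- `x ↦ x₁₃`. -/
def leg13 : H ⊗[k] H →ₐ[k] H ⊗[k] (H ⊗[k] H) :=
  Algebra.TensorProduct.map (AlgHom.id k H) Algebra.TensorProduct.includeRight

/-- `x ↦ x₂₃ = 1 ⊗ x`. -/
def leg23 : H ⊗[k] H →ₐ[k] H ⊗[k] (H ⊗[k] H) :=
  Algebra.TensorProduct.includeRight

variable [Coalgebra k H]

variable (k H) in
/-- `Δ(1)`. -/
def comulOne : H ⊗[k] H := comul (R := k) (1 : H)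

variable (k H) in
/-- The opposite comultiplication. -/
def comulOp : H →ₗ[k] H ⊗[k] H := (TensorProduct.comm k H H).toLinearMap ∘ₗ comul

variable (k H) in
/-- `Δ ⊗ id`, with values in `H ⊗ (H ⊗ H)`. -/
def comulId : H ⊗[k] H →ₗ[k] H ⊗[k] (H ⊗[k] H) :=
  (TensorProduct.assoc k H H H).toLinearMap ∘ₗ (comul (R := k) (A := H)).rTensor H

variable (k H) in
/-- `id ⊗ Δ`. -/
def idComul : H ⊗[k] H →ₗ[k] H ⊗[k] (H ⊗[k] H) := (comul (R := k) (A := H)).lTensor H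

variable (k) in
/-- The target counital map `ε_t(h) = (ε ⊗ id)(Δ(1)(h ⊗ 1))`. -/
def targetMap : H →ₗ[k] H :=
  (TensorProduct.lid k H).toLinearMap ∘ₗ (counit (R := k) (A := H)).rTensor H ∘ₗ
    LinearMap.mulLeft k (comulOne k H) ∘ₗ (TensorProduct.mk k H H).flip 1

variable (k) in
/-- The source counital map `ε_s(h) = (id ⊗ ε)((1 ⊗ h)Δ(1))`. -/
def sourceMap : H →ₗ[k] H :=
  (TensorProduct.rid k H).toLinearMap ∘ₗ (counit (R := k) (A := H)).lTensor H ∘ₗ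
    LinearMap.mulRight k (comulOne k H) ∘ₗ TensorProduct.mk k H H 1

/-- The functional `x ⊗ y ↦ ε(f x) ε(y h)` on `H ⊗ H`. -/
def counitPair (f h : H) : H ⊗[k] H →ₗ[k] k :=
  LinearMap.mul' k k ∘ₗ TensorProduct.map
    (counit (R := k) (A := H) ∘ₗ LinearMap.mulLeft k f)
    (counit (R := k) (A := H) ∘ₗ LinearMap.mulRight k h)

variable (k H) in
/-- A (finite) quantum groupoid, i.e. a weak Hopf algebra, over `k`. -/
class QuantumGroupoid : Type _ where
  finiteDimensional : FiniteDimensional k H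
  comul_mul : ∀ x y : H, comul (R := k) (x * y) = comul (R := k) x * comul (R := k) y
  comulId_one : comulId k H (comulOne k H) = leg12 (comulOne k H) * leg23 (comulOne k H)
  comulId_one' : comulId k H (comulOne k H) = leg23 (comulOne k H) * leg12 (comulOne k H)
  counit_mul : ∀ f g h : H, counit (R := k) (f * g * h) = counitPair f h (comul (R := k) g)
  counit_mul' : ∀ f g h : H, counit (R := k) (f * g * h) = counitPair f h (comulOp k H g)
  antipode : H →ₗ[k] H
  antipode_one : antipode 1 = 1
  antipode_mul : ∀ x y : H, antipode (x * y) = antipode y * antipode x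
  counit_antipode : ∀ x : H, counit (R := k) (antipode x) = counit (R := k) x
  comul_antipode : ∀ x : H,
    comul (R := k) (antipode x) = TensorProduct.map antipode antipode (comulOp k H x)
  mul_antipode : ∀ x : H,
    LinearMap.mul' k H (antipode.lTensor H (comul (R := k) x)) = targetMap k x
  antipode_mul' : ∀ x : H,
    LinearMap.mul' k H (antipode.rTensor H (comul (R := k) x)) = sourceMap k x

variable (k) in
/-- The antipode `S`. -/
abbrev S [QuantumGroupoid k H] : H →ₗ[k] H := QuantumGroupoid.antipode

/-- A quasitriangular structure (`R`-matrix) on a quantum groupoid. -/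
structure IsQuasitriangular (R : H ⊗[k] H) : Prop where
  mem : ∃ X : H ⊗[k] H, R = comulOp k H 1 * X * comulOne k H
  comulOp_mul : ∀ h : H, comulOp k H h * R = R * comul (R := k) h
  idComul : idComul k H R = leg13 R * leg12 R
  comulId : comulId k H R = leg13 R * leg23 R
  inv : ∃ Rbar : H ⊗[k] H,
    (∃ X : H ⊗[k] H, Rbar = comulOne k H * X * comulOp k H 1) ∧
      R * Rbar = comulOp k H 1 ∧ Rbar * R = comulOne k H

/-- The Drinfeld element `u = S(R⁽²⁾) R⁽¹⁾`. -/
def drinfeldElement [QuantumGroupoid k H] (R : H ⊗[k] H) : H :=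
  LinearMap.mul' k H (TensorProduct.map (S k) LinearMap.id
    (TensorProduct.comm k H H R))

end General

section CStar

variable (H : Type u) [Ring H] [Algebra ℂ H] [Coalgebra ℂ H] [StarRing H] [StarModule ℂ H]

/-- A `C*`-quantum groupoid. -/
class CStarQuantumGroupoid : Type _ extends QuantumGroupoid ℂ H where
  comul_star : ∀ x : H, comul (R := ℂ) (star x) = star (comul (R := ℂ) x)
  star_mul_self_eq_zero : ∀ x : H, star x * x = 0 → x = 0

variable {H} in
/-- The canonical group-like element of a `C*`-quantum groupoid: the positive invertible element
implementing `S²`, normalised by `tr π(g) = tr π(g⁻¹) ≠ 0` for all irreducible representations,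
with `S(g) = g⁻¹` and `Δ(g) = (g ⊗ g)Δ(1) = Δ(1)(g ⊗ g)`. -/
structure IsCanonicalGrouplike [QuantumGroupoid ℂ H] (g : H) : Prop where
  isUnit : IsUnit g
  positive : ∃ a : H, g = star a * a
  antipode_sq : ∀ h : H, S ℂ (S ℂ h) =
    g * h * Ring.inverse g
  trace_eq : ∀ (V : Type u) [AddCommGroup V] [Module ℂ V] [Module H V] [IsScalarTower ℂ H V]
    [FiniteDimensional ℂ V] [IsSimpleModule H V],
    LinearMap.trace ℂ V (Algebra.lsmul ℂ ℂ V (Ring.inverse g)) =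
        LinearMap.trace ℂ V (Algebra.lsmul ℂ ℂ V g) ∧
      LinearMap.trace ℂ V (Algebra.lsmul ℂ ℂ V g) ≠ 0
  antipode : S ℂ g = Ring.inverse g
  comul : Coalgebra.comul (R := ℂ) g = (g ⊗ₜ[ℂ] g) * comulOne ℂ H
  comul' : Coalgebra.comul (R := ℂ) g = comulOne ℂ H * (g ⊗ₜ[ℂ] g)

end CStar

/-! ### The category of unitary representations -/

section Category

variable (H : Type u) [Ring H] [Algebra ℂ H] [StarRing H]

/-- A unitary `H`-module: a finite-dimensional Hilbert space with an action of `H` by a (unital)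
algebra homomorphism such that `(h v, w) = (v, h* w)`. -/
structure URep where
  V : Type u
  [normed : NormedAddCommGroup V]
  [innerProd : InnerProductSpace ℂ V]
  [findim : FiniteDimensional ℂ V]
  ρ : H →ₐ[ℂ] Module.End ℂ V
  unitary : ∀ (h : H) (v w : V), ⟪ρ h v, w⟫_ℂ = ⟪v, ρ (star h) w⟫_ℂ

attribute [instance] URep.normed URep.innerProd URep.findim

namespace URep

variable {H}

/-- The space of `H`-linear maps. -/
def homs (V W : URep H) : Submodule ℂ (V.V →ₗ[ℂ] W.V) where
  carrier := {f | ∀ (h : H) (v : V.V), f (V.ρ h v) = W.ρ h (f v)}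
  add_mem' hf hg h v := by simp [hf h v, hg h v]
  zero_mem' h v := by simp
  smul_mem' a f hf h v := by simp [hf h v]

/-- Morphisms of `URep H` are all `H`-linear maps. -/
instance : Category (URep H) where
  Hom V W := homs V W
  id V := ⟨LinearMap.id, fun _ _ => rfl⟩
  comp f g := ⟨g.1 ∘ₗ f.1, fun h v => by simp [f.2 h v, g.2 h (f.1 v)]⟩

/-- The linear map underlying a morphism. -/
def lin {V W : URep H} (f : V ⟶ W) : V.V →ₗ[ℂ] W.V := Subtype.val (p := (· ∈ homs V W)) f

theorem lin_comm {V W : URep H} (f : V ⟶ W) (h : H) (v : V.V) :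
    lin f (V.ρ h v) = W.ρ h (lin f v) := Subtype.property (p := (· ∈ homs V W)) f h v

/-- The morphism given by an `H`-linear map. -/
def mkHom {V W : URep H} (f : V.V →ₗ[ℂ] W.V)
    (hf : ∀ (h : H) (v : V.V), f (V.ρ h v) = W.ρ h (f v)) : V ⟶ W := (⟨f, hf⟩ : homs V W)

@[ext]
theorem hom_ext {V W : URep H} {f g : V ⟶ W} (h : lin f = lin g) : f = g := Subtype.ext h

instance (V W : URep H) : AddCommGroup (V ⟶ W) := inferInstanceAs (AddCommGroup (homs V W))

instance (V W : URep H) : Module ℂ (V ⟶ W) := inferInstanceAs (Module ℂ (homs V W))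

theorem lin_add {V W : URep H} (f g : V ⟶ W) : lin (f + g) = lin f + lin g := rfl

theorem lin_smul {V W : URep H} (a : ℂ) (f : V ⟶ W) : lin (a • f) = a • lin f := rfl

theorem lin_comp {U V W : URep H} (f : U ⟶ V) (g : V ⟶ W) : lin (f ≫ g) = lin g ∘ₗ lin f := rfl

instance : Preadditive (URep H) where
  homGroup V W := inferInstance
  add_comp _ _ _ f f' g := hom_ext (by
    simp only [lin_comp, lin_add, LinearMap.comp_add])
  comp_add _ _ _ f g g' := hom_ext (by
    simp only [lin_comp, lin_add, LinearMap.add_comp])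

instance : Linear ℂ (URep H) where
  homModule V W := inferInstanceAs (Module ℂ (homs V W))
  smul_comp _ _ _ a f g := hom_ext (LinearMap.comp_smul (lin g) a (lin f))
  comp_smul _ _ _ f a g := hom_ext (LinearMap.smul_comp a (lin g) (lin f))

/-- The conjugate of a morphism: its Hilbert space adjoint. -/
def conj {V W : URep H} (f : V ⟶ W) : W ⟶ V :=
  mkHom (LinearMap.adjoint (lin f)) fun h w => by
    refine ext_inner_left ℂ fun v => ?_
    rw [LinearMap.adjoint_inner_right, ← star_star h, ← W.unitary, ← V.unitary,
      LinearMap.adjoint_inner_right, lin_comm]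

/-- The action of `H ⊗ H` on `V ⊗ W` (full tensor product of vector spaces). -/
def act (V W : URep H) : H ⊗[ℂ] H →ₐ[ℂ] Module.End ℂ (V.V ⊗[ℂ] W.V) :=
  (Module.endTensorEndAlgHom (R := ℂ) (S := ℂ) (A := ℂ)).comp (Algebra.TensorProduct.map V.ρ W.ρ)

theorem act_tmul (V W : URep H) (a b : H) (v : V.V) (w : W.V) :
    act V W (a ⊗ₜ b) (v ⊗ₜ w) = V.ρ a v ⊗ₜ W.ρ b w := rfl

theorem inner_act [StarModule ℂ H] (V W : URep H) (x : H ⊗[ℂ] H) (s t : V.V ⊗[ℂ] W.V) :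
    ⟪act V W x s, t⟫_ℂ = ⟪s, act V W (star x) t⟫_ℂ := by
  induction x with
  | zero => simp
  | add x y hx hy => simp [inner_add_left, inner_add_right, hx, hy]
  | tmul a b =>
    induction s with
    | zero => simp
    | add s s' hs hs' => simp only [map_add, inner_add_left, hs, hs']
    | tmul v w =>
      induction t with
      | zero => simp
      | add t t' ht ht' => simp only [map_add, inner_add_right, ht, ht']
      | tmul v' w' =>
        simp only [TensorProduct.star_tmul, act_tmul, TensorProduct.inner_tmul, V.unitary,
          W.unitary]

theorem map_act {V V' W W' : URep H} (f : V ⟶ V') (g : W ⟶ W') (x : H ⊗[ℂ] H)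
    (s : V.V ⊗[ℂ] W.V) :
    TensorProduct.map (lin f) (lin g) (act V W x s) =
      act V' W' x (TensorProduct.map (lin f) (lin g) s) := by
  induction x with
  | zero => simp
  | add x y hx hy => simp [hx, hy]
  | tmul a b =>
    induction s with
    | zero => simp
    | add s s' hs hs' => simp only [map_add, hs, hs']
    | tmul v w => simp only [act_tmul, TensorProduct.map_tmul, lin_comm]

end URep

end Category

/-! ### The monoidal structure, duality and braiding on `URep H` -/

section Structure

variable {H : Type u} [Ring H] [Algebra ℂ H] [Coalgebra ℂ H] [StarRing H] [StarModule ℂ H]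
  [CStarQuantumGroupoid H]

instance : FiniteDimensional ℂ H := QuantumGroupoid.finiteDimensional

theorem comul_mul (x y : H) :
    comul (R := ℂ) (x * y) = comul (R := ℂ) x * comul (R := ℂ) y := QuantumGroupoid.comul_mul x y

theorem counit_star (x : H) :
    counit (R := ℂ) (star x) = starRingEnd ℂ (counit (R := ℂ) x) := by
  let e' : H →ₗ[ℂ] ℂ :=
    { toFun := fun x => starRingEnd ℂ (counit (R := ℂ) (star x))
      map_add' := fun a b => by simp
      map_smul' := fun a b => by simp }
  have key : ∀ t : H ⊗[ℂ] H, e'.rTensor H t = TensorProduct.map (LinearMap.id) LinearMap.id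
      (star ((counit (R := ℂ) (A := H)).rTensor H (star t))) := by
    intro t
    induction t with
    | zero => simp
    | add a b ha hb => simp only [map_add, star_add, ha, hb]
    | tmul a b => simp [e']
  have h1 : ∀ y : H, e'.rTensor H (comul (R := ℂ) y) = 1 ⊗ₜ y := by
    intro y
    rw [key, ← CStarQuantumGroupoid.comul_star, rTensor_counit_comul]
    simp
  have h2 : ∀ t : H ⊗[ℂ] H, counit (R := ℂ) (TensorProduct.lid ℂ H (e'.rTensor H t)) =
      e' (TensorProduct.rid ℂ H ((counit (R := ℂ) (A := H)).lTensor H t)) := by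
    intro t
    induction t with
    | zero => simp
    | add a b ha hb => simp only [map_add, ha, hb]
    | tmul a b => simp [mul_comm]
  have h3 := h2 (comul (star x))
  rw [h1, lTensor_counit_comul] at h3
  simpa [e'] using h3

variable (H) in
/-- The target counital subalgebra `H_t = ε_t(H)`, as a subspace of `H`. -/
def targetSpace : Submodule ℂ H := LinearMap.range (targetMap ℂ (H := H))

theorem counit_mul_targetMap (x y : H) :
    counit (R := ℂ) (x * targetMap ℂ y) = counit (R := ℂ) (x * y) := by
  have h := QuantumGroupoid.counit_mul' (k := ℂ) x 1 y
  rw [mul_one] at h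
  rw [h]
  have : ∀ t : H ⊗[ℂ] H, counit (R := ℂ) (x * TensorProduct.lid ℂ H
      ((counit (R := ℂ) (A := H)).rTensor H (t * (y ⊗ₜ 1)))) =
      counitPair x y (TensorProduct.comm ℂ H H t) := by
    intro t
    induction t with
    | zero => simp
    | add a b ha hb => simp only [map_add, add_mul, mul_add, ha, hb]
    | tmul a b => simp [counitPair, mul_comm]
  exact this _

theorem targetMap_mul_targetMap (x y : H) :
    targetMap ℂ (x * targetMap ℂ y) = targetMap ℂ (x * y) := by
  have : ∀ t : H ⊗[ℂ] H,
      (counit (R := ℂ) (A := H)).rTensor H (t * ((x * targetMap ℂ y) ⊗ₜ 1)) =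
      (counit (R := ℂ) (A := H)).rTensor H (t * ((x * y) ⊗ₜ 1)) := by
    intro t
    induction t with
    | zero => simp
    | add a b ha hb => simp only [map_add, add_mul, ha, hb]
    | tmul a b => simp [← mul_assoc, counit_mul_targetMap]
  exact congrArg (TensorProduct.lid ℂ H) (this _)

theorem targetMap_targetMap (y : H) : targetMap ℂ (targetMap ℂ y) = targetMap ℂ y := by
  simpa using targetMap_mul_targetMap 1 y

theorem targetMap_of_mem {z : H} (hz : z ∈ targetSpace H) : targetMap ℂ z = z := by
  obtain ⟨y, rfl⟩ := hz
  exact targetMap_targetMap y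

namespace URep

/-- The subspace `{x ∈ V ⊗ W | x = Δ(1) x}`. -/
def tensorSpace (V W : URep H) : Submodule ℂ (V.V ⊗[ℂ] W.V) where
  carrier := {x | x = act V W (comulOne ℂ H) x}
  add_mem' hx hy := by
    change _ = act V W (comulOne ℂ H) (_ + _)
    rw [map_add]
    exact congrArg₂ (· + ·) hx hy
  zero_mem' := by simp
  smul_mem' a x hx := by
    change _ = act V W (comulOne ℂ H) (a • x)
    rw [map_smul]
    exact congrArg (a • ·) hx

theorem act_comul_mem (V W : URep H) (h : H) (x : V.V ⊗[ℂ] W.V) :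
    act V W (comul (R := ℂ) h) x ∈ tensorSpace V W := by
  change _ = act V W (comulOne ℂ H) (act V W (comul (R := ℂ) h) x)
  rw [comulOne, ← Module.End.mul_apply, ← map_mul (act V W), ← comul_mul, one_mul]

/-- The tensor product of unitary modules: the Hilbert subspace `tensorSpace V W` of the tensor
product of Hilbert spaces, with `H` acting via `Δ`. -/
def tensor (V W : URep H) : URep H where
  V := tensorSpace V W
  normed := Submodule.normedAddCommGroup _
  innerProd := Submodule.innerProductSpace _
  ρ := AlgHom.ofLinearMap
    { toFun := fun h => (act V W (comul (R := ℂ) h)).restrict fun x _ => act_comul_mem V W h x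
      map_add' := fun a b => by ext x; simp
      map_smul' := fun a b => by ext x; simp }
    (by ext x; exact x.2.symm)
    (fun a b => by ext x; simp [comul_mul])
  unitary h v w := by
    have := inner_act V W (comul (R := ℂ) h) v.1 w.1
    rw [← CStarQuantumGroupoid.comul_star] at this
    exact this

/-- The orthogonal projection `x ↦ Δ(1) x` of `V ⊗ W` onto its subspace `tensorSpace V W`. -/
def proj (V W : URep H) : V.V ⊗[ℂ] W.V →ₗ[ℂ] (tensor V W).V :=
  (act V W (comulOne ℂ H)).codRestrict (tensorSpace V W) fun x => act_comul_mem V W 1 x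

/-- The inclusion of `tensorSpace V W` into `V ⊗ W`. -/
def incl (V W : URep H) : (tensor V W).V →ₗ[ℂ] V.V ⊗[ℂ] W.V := (tensorSpace V W).subtype

/-- The tensor product of morphisms: the restriction of the usual one. -/
def tensorMap {V V' W W' : URep H} (f : V ⟶ V') (g : W ⟶ W') : tensor V W ⟶ tensor V' W' :=
  mkHom ((TensorProduct.map (lin f) (lin g)).restrict
      (p := tensorSpace V W) (q := tensorSpace V' W') fun x hx => by
        change _ = act V' W' (comulOne ℂ H) _
        rw [← map_act]
        exact congrArg (TensorProduct.map (lin f) (lin g)) hx)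
    fun h v => Subtype.ext (map_act f g _ _)

/-- The Hilbert space structure `(z, t) = ε(t* z)` on `H_t`. -/
abbrev unitCore (hpos : ∀ z ∈ targetSpace H, z ≠ 0 → 0 < (counit (R := ℂ) (star z * z)).re) :
    InnerProductSpace.Core ℂ (targetSpace H) where
  inner t z := counit (R := ℂ) (star t.1 * z.1)
  conj_inner_symm x y := by simp [← counit_star]
  re_inner_nonneg z := by
    by_cases h : z.1 = 0
    · simp [h]
    · exact (hpos z.1 z.2 h).le
  add_left x y z := by simp [add_mul]
  smul_left x y r := by simp
  definite z hz := by
    by_contra h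
    have := hpos z.1 z.2 (fun h' => h (Subtype.ext h'))
    rw [hz] at this
    simp at this

/-- The unit object: `H_t = ε_t(H)` with the action `h · z = ε_t(h z)` and the scalar product
`(z, t) = ε(t* z)` (linear in `z`). -/
def unitObj (hpos : ∀ z ∈ targetSpace H, z ≠ 0 → 0 < (counit (R := ℂ) (star z * z)).re) :
    URep H where
  V := targetSpace H
  normed := (unitCore hpos).toNormedAddCommGroup
  innerProd := InnerProductSpace.ofCore (unitCore hpos).toCore
  findim := inferInstanceAs (FiniteDimensional ℂ (targetSpace H))
  ρ := AlgHom.ofLinearMap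
    { toFun := fun h => ((targetMap ℂ).codRestrict (targetSpace H)
          (LinearMap.mem_range_self _)) ∘ₗ LinearMap.mulLeft ℂ h ∘ₗ (targetSpace H).subtype
      map_add' := fun a b => LinearMap.ext fun x => Subtype.ext (by simp [add_mul])
      map_smul' := fun a b => LinearMap.ext fun x => Subtype.ext (by simp) }
    (LinearMap.ext fun x => Subtype.ext (by
      change targetMap ℂ (1 * x.1) = x.1
      rw [one_mul, targetMap_of_mem x.2]))
    (fun a b => LinearMap.ext fun x => Subtype.ext (by
      change targetMap ℂ (a * b * x.1) = targetMap ℂ (a * targetMap ℂ (b * x.1))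
      rw [targetMap_mul_targetMap, mul_assoc]))
  unitary h v w := by
    change counit (R := ℂ) (star (targetMap ℂ (h * v.1)) * w.1) =
      counit (R := ℂ) (star v.1 * targetMap ℂ (star h * w.1))
    rw [counit_mul_targetMap, ← star_star (star (targetMap ℂ (h * v.1)) * w.1), counit_star,
      star_mul, star_star, counit_mul_targetMap, ← counit_star]
    simp [mul_assoc]

/-- The vector `v` representing a functional `φ = v̄ = (·, v)`. -/
def vec (V : URep H) (φ : Module.Dual ℂ V.V) : V.V :=
  (InnerProductSpace.toDual ℂ V.V).symm (LinearMap.toContinuousLinearMap φ)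

theorem inner_vec (V : URep H) (φ : Module.Dual ℂ V.V) (x : V.V) : ⟪vec V φ, x⟫_ℂ = φ x := by
  simp [vec]

/-- The Hilbert space structure `(v̄, w̄) = (w, g v)` on `V*`. -/
abbrev dualCore {g : H} (hg : IsCanonicalGrouplike g) (V : URep H) :
    InnerProductSpace.Core ℂ (Module.Dual ℂ V.V) where
  inner ψ φ := ⟪V.ρ g (vec V φ), vec V ψ⟫_ℂ
  conj_inner_symm x y := by
    obtain ⟨a, rfl⟩ := hg.positive
    rw [inner_conj_symm, V.unitary]
    simp
  re_inner_nonneg φ := by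
    obtain ⟨a, rfl⟩ := hg.positive
    rw [map_mul, Module.End.mul_apply, V.unitary, star_star]
    exact inner_self_nonneg
  add_left x y z := by simp [vec]
  smul_left x y r := by
    have : vec V (r • x) = starRingEnd ℂ r • vec V x := by
      simp only [vec, map_smul]
      exact map_smulₛₗ _ _ _
    rw [this, inner_smul_right]
  definite φ h := by
    have hg' := hg
    obtain ⟨a, rfl⟩ := hg.positive
    rw [map_mul, Module.End.mul_apply, V.unitary, star_star, inner_self_eq_zero] at h
    have h2 : V.ρ (Ring.inverse (star a * a)) (V.ρ (star a * a) (vec V φ)) = 0 := by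
      rw [map_mul V.ρ (star a) a, Module.End.mul_apply, h]
      simp
    rw [← Module.End.mul_apply, ← map_mul, Ring.inverse_mul_cancel _ hg'.isUnit, map_one,
      Module.End.one_apply] at h2
    refine LinearMap.ext fun x => ?_
    rw [← inner_vec, h2]
    simp

/-- The dual object: `V* = Hom(V, ℂ)` with `(h · φ)(v) = φ(S(h) v)` and, if `v̄ = (·, v)`, with
scalar product `(v̄, w̄) = (w, g v)`. -/
def dualObj {g : H} (hg : IsCanonicalGrouplike g)
    (hS : ∀ h : H, S ℂ (star (S ℂ (star h))) = h) (V : URep H) : URep H where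
  V := Module.Dual ℂ V.V
  normed := (dualCore hg V).toNormedAddCommGroup
  innerProd := InnerProductSpace.ofCore (dualCore hg V).toCore
  findim := inferInstanceAs (FiniteDimensional ℂ (Module.Dual ℂ V.V))
  ρ := AlgHom.ofLinearMap
    { toFun := fun h => Module.Dual.transpose (V.ρ (S ℂ h))
      map_add' := fun a b => LinearMap.ext fun x => by simp
      map_smul' := fun a b => LinearMap.ext fun x => by simp }
    (LinearMap.ext fun x => LinearMap.ext fun y => by
      change x (V.ρ (S ℂ 1) y) = x y
      rw [S, QuantumGroupoid.antipode_one, map_one, Module.End.one_apply])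
    (fun a b => LinearMap.ext fun x => LinearMap.ext fun y => by
      change x (V.ρ (S ℂ (a * b)) y) = x (V.ρ (S ℂ b) (V.ρ (S ℂ a) y))
      rw [S, QuantumGroupoid.antipode_mul, map_mul, Module.End.mul_apply])
  unitary h ψ φ := by
    have hv : ∀ (k : H) (φ : Module.Dual ℂ V.V),
        vec V (φ ∘ₗ V.ρ (S ℂ k)) = V.ρ (star (S ℂ k)) (vec V φ) := by
      intro k φ
      refine ext_inner_right ℂ fun x => ?_
      rw [inner_vec, V.unitary, star_star, inner_vec]
      rfl
    change ⟪V.ρ g (vec V φ), vec V (ψ ∘ₗ V.ρ (S ℂ h))⟫_ℂ =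
      ⟪V.ρ g (vec V (φ ∘ₗ V.ρ (S ℂ (star h)))), vec V ψ⟫_ℂ
    have hg' : S ℂ h * g = g * star (S ℂ (star h)) := by
      have h1 := hg.antipode_sq (star (S ℂ (star h)))
      rw [hS] at h1
      rw [h1, mul_assoc, Ring.inverse_mul_cancel _ hg.isUnit, mul_one]
    rw [hv, hv, ← V.unitary, ← Module.End.mul_apply, ← Module.End.mul_apply, ← map_mul,
      ← map_mul, hg']

/-- The inclusion of the unit object `H_t` into `H`. -/
def unitIncl (hpos : ∀ z ∈ targetSpace H, z ≠ 0 → 0 < (counit (R := ℂ) (star z * z)).re) :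
    (unitObj hpos).V →ₗ[ℂ] H := (targetSpace H).subtype

/-- The map `v ↦ 1₍₁₎ v ⊗ 1₍₂₎`, from `V` to `V ⊗ H`. -/
def rightUnitInv (V : URep H) (v : V.V) : V.V ⊗[ℂ] H :=
  (V.ρ.toLinearMap.flip v).rTensor H (comulOne ℂ H)

/-- The map `φ ⊗ v ↦ φ(1₍₁₎ v) 1₍₂₎`, from `V* ⊗ V` to `H`. -/
def evMap (V : URep H) : Module.Dual ℂ V.V ⊗[ℂ] V.V →ₗ[ℂ] H :=
  TensorProduct.lift (LinearMap.mk₂ ℂ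
    (fun φ v => TensorProduct.lid ℂ H ((φ ∘ₗ V.ρ.toLinearMap.flip v).rTensor H (comulOne ℂ H)))
    (fun φ ψ v => by simp [LinearMap.add_comp, LinearMap.rTensor_add])
    (fun a φ v => by simp [LinearMap.smul_comp, LinearMap.rTensor_smul])
    (fun φ v w => by simp [LinearMap.comp_add, LinearMap.rTensor_add])
    (fun a φ v => by simp [LinearMap.comp_smul, LinearMap.rTensor_smul]))

/-- The standard structure morphisms of `URep H`, for an `R`-matrix `R` and the canonical
group-like element `g`. Each of them is determined by the formula that follows it. -/
structure StandardMorphisms (R : H ⊗[ℂ] H) {g : H} (hg : IsCanonicalGrouplike g)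
    (hpos : ∀ z ∈ targetSpace H, z ≠ 0 → 0 < (counit (R := ℂ) (star z * z)).re)
    (hS : ∀ h : H, S ℂ (star (S ℂ (star h))) = h) where
  /-- the restriction of the standard associativity isomorphism of vector spaces -/
  assoc : ∀ U V W : URep H, tensor (tensor U V) W ≅ tensor U (tensor V W)
  assoc_apply : ∀ (U V W : URep H) (x : (tensor (tensor U V) W).V),
    (incl V W).lTensor U.V (incl U (tensor V W) (lin (assoc U V W).hom x)) =
      TensorProduct.assoc ℂ U.V V.V W.V ((incl U V).rTensor W.V (incl (tensor U V) W x))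
  /-- `l_V(1₍₁₎ z ⊗ 1₍₂₎ v) = z v` -/
  leftUnitor : ∀ V : URep H, tensor (unitObj hpos) V ≅ V
  leftUnitor_apply : ∀ (V : URep H) (z : (unitObj hpos).V) (v : V.V),
    lin (leftUnitor V).hom (proj (unitObj hpos) V (z ⊗ₜ v)) = V.ρ (unitIncl hpos z) v
  /-- `r_V⁻¹(v) = 1₍₁₎ v ⊗ 1₍₂₎` -/
  rightUnitor : ∀ V : URep H, tensor V (unitObj hpos) ≅ V
  rightUnitor_inv_apply : ∀ (V : URep H) (v : V.V),
    (unitIncl hpos).lTensor V.V (incl V (unitObj hpos) (lin (rightUnitor V).inv v)) =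
      rightUnitInv V v
  /-- `c_{V,W}(x) = R⁽²⁾ x⁽²⁾ ⊗ R⁽¹⁾ x⁽¹⁾` -/
  braiding : ∀ V W : URep H, tensor V W ≅ tensor W V
  braiding_apply : ∀ (V W : URep H) (x : (tensor V W).V),
    incl W V (lin (braiding V W).hom x) = TensorProduct.comm ℂ V.V W.V (act V W R (incl V W x))
  /-- `θ_V(v) = ν v`, where `ν = u⁻¹ g` for the Drinfeld element `u` -/
  twist : ∀ V : URep H, V ≅ V
  twist_apply : ∀ (V : URep H) (v : V.V),
    lin (twist V).hom v = V.ρ (Ring.inverse (drinfeldElement R) * g) v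
  /-- `b_V(z) = z · ∑ i, f_i ⊗ ξ^i` -/
  coev : ∀ V : URep H, unitObj hpos ⟶ tensor V (dualObj hg hS V)
  coev_apply : ∀ (V : URep H) (z : (unitObj hpos).V),
    incl V (dualObj hg hS V) (lin (coev V) z) =
      act V (dualObj hg hS V) (comul (R := ℂ) (unitIncl hpos z)) (coevaluation ℂ V.V 1)
  /-- `d_V(∑ j, φ^j ⊗ v_j) = ∑ j, φ^j(1₍₁₎ v_j) 1₍₂₎` -/
  ev : ∀ V : URep H, tensor (dualObj hg hS V) V ⟶ unitObj hpos
  ev_apply : ∀ (V : URep H) (x : (tensor (dualObj hg hS V) V).V),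
    unitIncl hpos (lin (ev V) x) = evMap V (incl (dualObj hg hS V) V x)

namespace StandardMorphisms

variable {R : H ⊗[ℂ] H} {g : H} {hg : IsCanonicalGrouplike g}
  {hpos : ∀ z ∈ targetSpace H, z ≠ 0 → 0 < (counit (R := ℂ) (star z * z)).re}
  {hS : ∀ h : H, S ℂ (star (S ℂ (star h))) = h}

/-- The tensor product, unit object, associativity and unit isomorphisms of `URep H`. -/
abbrev monoidalStruct (D : StandardMorphisms R hg hpos hS) : MonoidalCategoryStruct (URep H) where
  tensorObj := tensor
  whiskerLeft X _ _ f := tensorMap (𝟙 X) f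
  whiskerRight f Y := tensorMap f (𝟙 Y)
  tensorHom f g := tensorMap f g
  tensorUnit := unitObj hpos
  associator := D.assoc
  leftUnitor := D.leftUnitor
  rightUnitor := D.rightUnitor

/-- The braiding, twist and duality of `URep H`. -/
def ribbonData (D : StandardMorphisms R hg hpos hS) :
    @RibbonData (URep H) _ D.monoidalStruct :=
  letI := D.monoidalStruct
  { braiding := D.braiding
    twist := D.twist
    dual := dualObj hg hS
    coev := D.coev
    ev := D.ev }

end StandardMorphisms

end URep

end Structure

end QGroupoid

end

open QGroupoid Coalgebra

open CategoryTheory MonoidalCategory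
open scoped TensorProduct InnerProductSpace
open QGroupoid Coalgebra

set_option linter.unusedSectionVars false

noncomputable section

namespace QGroupoid

local notation "Δ" => Coalgebra.comul (R := ℂ)
local notation "ε" => Coalgebra.counit (R := ℂ)

/-! ### Counital maps of a weak Hopf algebra and their Sweedler identities. -/

section WeakHopf

variable {H : Type u} [Ring H] [Algebra ℂ H] [Coalgebra ℂ H] [QuantumGroupoid ℂ H]

local notation "Δ₁" => comulOne ℂ H

/-! The categorical axioms reduce to identities in tensor powers of `H`. The hexagons are the two
coproduct formulas for `R`; the zigzags are `1₍₁₎ S(1₍₂₎) = 1` and `S⁻¹(1₍₂₎) 1₍₁₎ = 1`; the twist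
axioms say that `ν = u⁻¹ g` is central and fixed by `S`, with `Δ(ν) = (ν ⊗ ν) R₂₁ R`. Unitarity
needs in addition `R* = R̄` and `ν* = ν⁻¹`. None of these facts about `*` and `S` is assumed, nor is
the bijectivity of `S`, so the substance of the proof is algebraic.

Positivity: since `x* x = 0` forces `x = 0`, adding up functionals attached to minimal left ideals
yields a faithful positive functional (`exists_isFaithful`), and this makes the trace `τ` of the
regular representation faithful (`isFaithful_regularTrace`). Roots of positive elements are real
polynomials in them (`IsFaithful.exists_root`). For a `τ`-orthonormal basis `(e_i)` the averages `Σ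
e_i x e_i*` are central (`exists_casimir`); they do the work of a decomposition of `H` into matrix
blocks.

The canonical element: `u` implements `S²` (`IsQuasitriangular.drinfeldElement_mul`), a central
correction makes it positive (`IsQuasitriangular.exists_pos_implementing`), and a positive central
factor makes it balanced, i.e. `g` and `g⁻¹` agree under all `τ(z ·)` with `z` central
(`exists_balanced`). This is equivalent to the equality of irreducible characters. A rigidity
argument (`IsBalanced.unique`) shows that two such elements differ by a positive central `w` with `w
= w⁻¹`, so `w = 1`. It gives uniqueness; applied to `S(g⁻¹)` it gives `S(g) = g⁻¹`; repeated in
`Δ(1)(H ⊗ H)Δ(1)` it gives that `g` is group-like (`IsCanonical.comul`).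

Unitarity of `R`: let `F = τ(g ·)`. Slices of `B* B` by convolution powers of `F` are powers of one
central element, while a bound `B* B ≤ C` survives every such slice with the same `C`. Comparing
growth yields `(τ ⊗ F)(B* B) ≤ (τ ⊗ F)(Δ(1))` for `B = R` and for `B = R̄*`
(`IsCanonical.le_of_idComul`). Then `R - R̄*` has nonpositive square norm for a faithful functional,
hence vanishes (`IsQuasitriangular.star_eq`).

The quantum trace: since `b̄_V = d_V c (θ_V ⊗ id)` (`conj_coevHom`), one has `tr_q(f f̄) = k̄ k`
with `k = (f̄ ⊗ id) b`. A positive endomorphism has a root that is polynomial in it, and this root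
is again a morphism. -/

theorem comulOne_mul_comul (h : H) : Δ₁ * Δ h = Δ h := by
  rw [comulOne, ← QuantumGroupoid.comul_mul, one_mul]

theorem comul_mul_comulOne (h : H) : Δ h * Δ₁ = Δ h := by
  rw [comulOne, ← QuantumGroupoid.comul_mul, mul_one]

theorem comulOne_mul_self : Δ₁ * Δ₁ = Δ₁ := comulOne_mul_comul 1

/-- The counital map `h ↦ 1₍₁₎ ε(1₍₂₎ h)`. -/
def sourceMap' : H →ₗ[ℂ] H :=
  (TensorProduct.rid ℂ H).toLinearMap ∘ₗ (counit (R := ℂ) (A := H)).lTensor H ∘ₗ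
    LinearMap.mulLeft ℂ Δ₁ ∘ₗ TensorProduct.mk ℂ H H 1

theorem rid_counit_comul (h : H) :
    TensorProduct.rid ℂ H ((counit (R := ℂ) (A := H)).lTensor H (Δ h)) = h := by
  rw [lTensor_counit_comul]; simp

theorem lid_counit_comul (h : H) :
    TensorProduct.lid ℂ H ((counit (R := ℂ) (A := H)).rTensor H (Δ h)) = h := by
  rw [rTensor_counit_comul]; simp

/-- Multiply the first two legs of `(Δ ⊗ id)Δ(1)` by `Δ(h)` on the right and contract the middle leg
with the counit. Multiplicativity of `Δ` gives one side. The factorization `(1 ⊗ Δ(1))(Δ(1) ⊗ 1)`,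
in which the second factor is absorbed by `Δ(h)`, gives the other. -/
theorem targetMap_lTensor_comul (h : H) :
    (targetMap ℂ).lTensor H (Δ h) = Δ₁ * (h ⊗ₜ 1) := by
  let g : H ⊗[ℂ] H →ₗ[ℂ] H := (TensorProduct.rid ℂ H).toLinearMap ∘ₗ
    (counit (R := ℂ) (A := H)).lTensor H ∘ₗ LinearMap.mulRight ℂ (Δ h)
  let G : H ⊗[ℂ] (H ⊗[ℂ] H) →ₗ[ℂ] H ⊗[ℂ] H :=
    g.rTensor H ∘ₗ (TensorProduct.assoc ℂ H H H).symm.toLinearMap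
  have h1 : G (comulId ℂ H Δ₁) = Δ₁ * (h ⊗ₜ 1) := by
    have : ∀ t : H ⊗[ℂ] H, G (comulId ℂ H t) = t * (h ⊗ₜ 1) := by
      intro t
      induction t with
      | zero => simp
      | add a b ha hb => simp only [map_add, ha, hb, add_mul]
      | tmul a b =>
        simp [G, comulId, g, ← QuantumGroupoid.comul_mul]
    exact this _
  have h2 : ∀ X Y : H ⊗[ℂ] H, G (leg23 X * leg12 Y) =
      (LinearMap.rTensor H ((TensorProduct.rid ℂ H).toLinearMap ∘ₗ
        (counit (R := ℂ) (A := H)).lTensor H ∘ₗ LinearMap.mulRight ℂ (Y * Δ h) ∘ₗ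
        TensorProduct.mk ℂ H H 1)) X := by
    intro X Y
    induction X with
    | zero => simp
    | add a b ha hb => simp only [map_add, ha, hb, add_mul]
    | tmul a b =>
      induction Y with
      | zero => simp
      | add c d hc hd =>
        simp only [map_add, mul_add, hc, hd, add_mul, LinearMap.rTensor_tmul,
          LinearMap.comp_apply, LinearMap.mulRight_apply, TensorProduct.add_tmul]
      | tmul c d =>
        simp [G, g, leg23, leg12]
  -- One contraction, of the first leg of `X` against the second leg of `Z`, read as a map applied
  -- to `X` and as a map applied to `Z`; only the second form displays the counital map.
  have h3 : ∀ X Z : H ⊗[ℂ] H, (LinearMap.rTensor H ((TensorProduct.rid ℂ H).toLinearMap ∘ₗ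
        (counit (R := ℂ) (A := H)).lTensor H ∘ₗ LinearMap.mulRight ℂ Z ∘ₗ
        TensorProduct.mk ℂ H H 1)) X = LinearMap.lTensor H ((TensorProduct.lid ℂ H).toLinearMap ∘ₗ
          (counit (R := ℂ) (A := H)).rTensor H ∘ₗ
    LinearMap.mulLeft ℂ X ∘ₗ (TensorProduct.mk ℂ H H).flip 1) Z := by
    intro X Z
    induction X with
    | zero =>
      simp only [map_zero]
      induction Z with
      | zero => simp
      | add c d hc hd => rw [map_add, ← hc, ← hd, add_zero]
      | tmul c d => simp
    | add a b ha hb =>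
      rw [map_add, ha, hb]
      clear ha hb
      induction Z with
      | zero => simp
      | add c d hc hd => simp only [map_add, ← hc, ← hd]; abel
      | tmul c d => simp [add_mul, TensorProduct.tmul_add]
    | tmul a b =>
      induction Z with
      | zero => simp
      | add c d hc hd =>
        rw [map_add, ← hc, ← hd]
        simp [mul_add, TensorProduct.add_tmul]
      | tmul c d => simp [TensorProduct.smul_tmul]
  rw [← h1, QuantumGroupoid.comulId_one', h2, comulOne_mul_comul, h3]
  rfl

theorem comulId_comulOne : comulId ℂ H Δ₁ = LinearMap.lTensor H (Coalgebra.comul (R := ℂ)) Δ₁ :=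
  coassoc_apply 1

/-- The mirror computation: the counit contracts the middle leg of `(id ⊗ Δ)Δ(1)`, and the other
ordering of the two copies of `Δ(1)` is used. -/
theorem sourceMap'_rTensor_comul (h : H) :
    (sourceMap' (H := H)).rTensor H (Δ h) = Δ₁ * (1 ⊗ₜ h) := by
  let g : H ⊗[ℂ] H →ₗ[ℂ] H := (TensorProduct.lid ℂ H).toLinearMap ∘ₗ
    (counit (R := ℂ) (A := H)).rTensor H ∘ₗ LinearMap.mulRight ℂ (Δ h)
  have h1 : g.lTensor H (comulId ℂ H Δ₁) = Δ₁ * (1 ⊗ₜ h) := by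
    rw [comulId_comulOne]
    generalize Δ₁ = t
    induction t with
    | zero => simp
    | add a b ha hb => simp only [map_add, ha, hb, add_mul]
    | tmul a b => simp [g, ← QuantumGroupoid.comul_mul]
  have h2 : ∀ X Y : H ⊗[ℂ] H, g.lTensor H (leg12 X * leg23 Y) =
      (LinearMap.lTensor H ((TensorProduct.lid ℂ H).toLinearMap ∘ₗ
        (counit (R := ℂ) (A := H)).rTensor H ∘ₗ LinearMap.mulRight ℂ (Y * Δ h) ∘ₗ
        (TensorProduct.mk ℂ H H).flip 1)) X := by
    intro X Y
    induction X with
    | zero => simp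
    | add a b ha hb => simp only [map_add, ha, hb, add_mul]
    | tmul a b =>
      induction Y with
      | zero => simp
      | add c d hc hd =>
        simp only [map_add, mul_add, hc, hd, add_mul, LinearMap.lTensor_tmul,
          LinearMap.comp_apply, LinearMap.mulRight_apply, TensorProduct.tmul_add]
      | tmul c d => simp [g, leg23, leg12]
  have h3 : ∀ X Z : H ⊗[ℂ] H, (LinearMap.lTensor H ((TensorProduct.lid ℂ H).toLinearMap ∘ₗ
        (counit (R := ℂ) (A := H)).rTensor H ∘ₗ LinearMap.mulRight ℂ Z ∘ₗ
        (TensorProduct.mk ℂ H H).flip 1)) X = LinearMap.rTensor H ((TensorProduct.rid ℂ H).toLinearMap ∘ₗ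
          (counit (R := ℂ) (A := H)).lTensor H ∘ₗ
    LinearMap.mulLeft ℂ X ∘ₗ TensorProduct.mk ℂ H H 1) Z := by
    intro X Z
    induction Z with
    | zero => simp
    | add c d hc hd =>
      rw [map_add, ← hc, ← hd]
      clear hc hd
      induction X with
      | zero => simp
      | add a b ha hb => simp only [map_add, ha, hb]; abel
      | tmul a b => simp [mul_add, TensorProduct.tmul_add]
    | tmul c d =>
      induction X with
      | zero => simp
      | add a b ha hb => rw [map_add, ha, hb]; simp [add_mul, TensorProduct.add_tmul]
      | tmul a b => simp [TensorProduct.smul_tmul]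
  rw [← h1, QuantumGroupoid.comulId_one, h2, comulOne_mul_comul, h3]
  rfl

theorem sourceMap_rTensor_comul (h : H) :
    (sourceMap ℂ (H := H)).rTensor H (Δ h) = (1 ⊗ₜ h) * Δ₁ := by
  let g : H ⊗[ℂ] H →ₗ[ℂ] H := (TensorProduct.lid ℂ H).toLinearMap ∘ₗ
    (counit (R := ℂ) (A := H)).rTensor H ∘ₗ LinearMap.mulLeft ℂ (Δ h)
  have h1 : g.lTensor H (comulId ℂ H Δ₁) = (1 ⊗ₜ h) * Δ₁ := by
    rw [comulId_comulOne]
    generalize Δ₁ = t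
    induction t with
    | zero => simp
    | add a b ha hb => simp only [map_add, ha, hb, mul_add]
    | tmul a b => simp [g, ← QuantumGroupoid.comul_mul]
  have h2 : ∀ X Y : H ⊗[ℂ] H, g.lTensor H (leg23 Y * leg12 X) =
      (LinearMap.lTensor H ((TensorProduct.lid ℂ H).toLinearMap ∘ₗ
        (counit (R := ℂ) (A := H)).rTensor H ∘ₗ LinearMap.mulLeft ℂ (Δ h * Y) ∘ₗ
        (TensorProduct.mk ℂ H H).flip 1)) X := by
    intro X Y
    induction X with
    | zero => simp
    | add a b ha hb => simp only [map_add, ha, hb, mul_add]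
    | tmul a b =>
      induction Y with
      | zero => simp
      | add c d hc hd =>
        simp only [map_add, mul_add, hc, hd, add_mul, LinearMap.lTensor_tmul,
          LinearMap.comp_apply, LinearMap.mulLeft_apply, TensorProduct.tmul_add]
      | tmul c d => simp [g, leg23, leg12]
  have h3 : ∀ X Z : H ⊗[ℂ] H, (LinearMap.lTensor H ((TensorProduct.lid ℂ H).toLinearMap ∘ₗ
        (counit (R := ℂ) (A := H)).rTensor H ∘ₗ LinearMap.mulLeft ℂ Z ∘ₗ
        (TensorProduct.mk ℂ H H).flip 1)) X = LinearMap.rTensor H ((TensorProduct.rid ℂ H).toLinearMap ∘ₗ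
          (counit (R := ℂ) (A := H)).lTensor H ∘ₗ
    LinearMap.mulRight ℂ X ∘ₗ TensorProduct.mk ℂ H H 1) Z := by
    intro X Z
    induction Z with
    | zero => simp
    | add c d hc hd =>
      rw [map_add, ← hc, ← hd]
      clear hc hd
      induction X with
      | zero => simp
      | add a b ha hb => simp only [map_add, ha, hb]; abel
      | tmul a b => simp [add_mul, TensorProduct.tmul_add]
    | tmul c d =>
      induction X with
      | zero => simp
      | add a b ha hb => rw [map_add, ha, hb]; simp [mul_add, TensorProduct.add_tmul]
      | tmul a b => simp [TensorProduct.smul_tmul]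
  rw [← h1, QuantumGroupoid.comulId_one', h2, comul_mul_comulOne, h3]
  rfl

/-! Sweedler sums -/

variable {ι : Type*}

/-- By coassociativity the sum is `h₍₁₎ ⊗ h₍₂₎ S(h₍₃₎) = h₍₁₎ ⊗ ε_t(h₍₂₎)`. In a Hopf algebra it
would be `h ⊗ 1`; here `Δ(1)` remains. -/
theorem sum_comul_mul_antipode {h : H} (r : Repr ℂ h ι) :
    ∑ i ∈ r.index, Δ (r.left i) * (1 ⊗ₜ S ℂ (r.right i)) = Δ₁ * (h ⊗ₜ 1) := by
  have h1 := congrArg (LinearMap.lTensor H (LinearMap.mul' ℂ H ∘ₗ (S ℂ (H := H)).lTensor H))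
    (coassoc_apply (R := ℂ) h)
  rw [← LinearMap.comp_apply (LinearMap.lTensor H _), ← LinearMap.lTensor_comp,
    show (LinearMap.mul' ℂ H ∘ₗ (S ℂ (H := H)).lTensor H) ∘ₗ Coalgebra.comul (R := ℂ) = targetMap ℂ
      from LinearMap.ext QuantumGroupoid.mul_antipode, targetMap_lTensor_comul, ← r.eq] at h1
  rw [← h1]
  simp only [map_sum, LinearMap.rTensor_tmul]
  refine Finset.sum_congr rfl fun i _ => ?_
  generalize Δ (r.left i) = t
  induction t with
  | zero => simp
  | add a b ha hb => simp only [TensorProduct.add_tmul, map_add, ← ha, ← hb, add_mul]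
  | tmul a b => simp

theorem sum_antipode_mul_comul {h : H} (r : Repr ℂ h ι) :
    ∑ i ∈ r.index, (S ℂ (r.left i) ⊗ₜ 1) * Δ (r.right i) = (1 ⊗ₜ h) * Δ₁ := by
  have h1 := congrArg (LinearMap.rTensor H (LinearMap.mul' ℂ H ∘ₗ (S ℂ (H := H)).rTensor H))
    (coassoc_symm_apply (R := ℂ) h)
  rw [← LinearMap.comp_apply (LinearMap.rTensor H _) (LinearMap.rTensor H comul),
    ← LinearMap.rTensor_comp,
    show (LinearMap.mul' ℂ H ∘ₗ (S ℂ (H := H)).rTensor H) ∘ₗ Coalgebra.comul (R := ℂ) = sourceMap ℂ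
      from LinearMap.ext QuantumGroupoid.antipode_mul', sourceMap_rTensor_comul, ← r.eq] at h1
  rw [← h1]
  simp only [map_sum, LinearMap.lTensor_tmul]
  refine Finset.sum_congr rfl fun i _ => ?_
  generalize Δ (r.right i) = t
  induction t with
  | zero => simp
  | add a b ha hb => simp only [TensorProduct.tmul_add, map_add, ← ha, ← hb, mul_add]
  | tmul a b => simp

theorem sum_left_mul_antipode {h : H} (r : Repr ℂ h ι) :
    ∑ i ∈ r.index, r.left i * S ℂ (r.right i) = targetMap ℂ h := by
  rw [← QuantumGroupoid.mul_antipode, ← r.eq]; simp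

theorem sum_antipode_mul_right {h : H} (r : Repr ℂ h ι) :
    ∑ i ∈ r.index, S ℂ (r.left i) * r.right i = sourceMap ℂ h := by
  rw [← QuantumGroupoid.antipode_mul', ← r.eq]; simp

theorem targetMap_eq_sum (r : Repr ℂ (1 : H) ι) (h : H) :
    targetMap ℂ h = ∑ i ∈ r.index, ε (r.left i * h) • r.right i := by
  simp [targetMap, comulOne, ← r.eq, Finset.sum_mul]

theorem sourceMap'_eq_sum (r : Repr ℂ (1 : H) ι) (h : H) :
    sourceMap' h = ∑ i ∈ r.index, ε (r.right i * h) • r.left i := by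
  simp [sourceMap', comulOne, ← r.eq, Finset.sum_mul]

theorem targetMap_one : targetMap ℂ (1 : H) = 1 := by
  change TensorProduct.lid ℂ H ((counit (R := ℂ) (A := H)).rTensor H (Δ₁ * (1 ⊗ₜ 1))) = 1
  rw [← Algebra.TensorProduct.one_def, mul_one]
  exact lid_counit_comul 1

theorem sourceMap_one : sourceMap ℂ (1 : H) = 1 := by
  change TensorProduct.rid ℂ H ((counit (R := ℂ) (A := H)).lTensor H ((1 ⊗ₜ 1) * Δ₁)) = 1
  rw [← Algebra.TensorProduct.one_def, one_mul]
  exact rid_counit_comul 1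

/-- Weak multiplicativity of `ε` with middle argument `1` splits `ε(1₍₁₎ h)` over a second copy of
`Δ(1)`, and this copy assembles into the inner map. -/
theorem targetMap_sourceMap' (h : H) : targetMap ℂ (sourceMap' h) = targetMap ℂ h := by
  let r := ℛ ℂ (1 : H)
  rw [targetMap_eq_sum r, targetMap_eq_sum r]
  refine Finset.sum_congr rfl fun i _ => congrArg (· • _) ?_
  have := QuantumGroupoid.counit_mul (k := ℂ) (r.left i) 1 h
  rw [mul_one] at this
  rw [this, sourceMap'_eq_sum r, ← r.eq]
  simp [counitPair, Finset.mul_sum, mul_comm]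

/-- Put `ε(· h)` on the first leg of the coassociativity of `Δ(1)`: one side is `Δ(ε_t(h))`, the
other is read off from a factorization of `(Δ ⊗ id)Δ(1)`. The two factorizations put `Δ(1)` on
either side. -/
theorem comul_targetMap (h : H) : Δ (targetMap ℂ h) = Δ₁ * (targetMap ℂ h ⊗ₜ 1) := by
  let L : H ⊗[ℂ] (H ⊗[ℂ] H) →ₗ[ℂ] H ⊗[ℂ] H := (TensorProduct.lid ℂ _).toLinearMap ∘ₗ
    (counit (R := ℂ) (A := H) ∘ₗ LinearMap.mulRight ℂ h).rTensor _
  have h1 := congrArg L (comulId_comulOne (H := H))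
  rw [QuantumGroupoid.comulId_one'] at h1
  have h2 : ∀ X : H ⊗[ℂ] H, L (LinearMap.lTensor H (Coalgebra.comul (R := ℂ)) X) =
      Δ (TensorProduct.lid ℂ H ((counit (R := ℂ) (A := H)).rTensor H (X * (h ⊗ₜ 1)))) := by
    intro X
    induction X with
    | zero => simp
    | add a b ha hb => simp only [map_add, ha, hb, add_mul]
    | tmul a b => simp [L]
  have h3 : ∀ X Y : H ⊗[ℂ] H, L (leg23 X * leg12 Y) =
      X * ((TensorProduct.lid ℂ H ((counit (R := ℂ) (A := H)).rTensor H (Y * (h ⊗ₜ 1)))) ⊗ₜ 1) := by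
    intro X Y
    induction Y with
    | zero => simp
    | add a b ha hb => simp only [map_add, ha, hb, add_mul, mul_add, TensorProduct.add_tmul]
    | tmul a b => simp [L, leg12, leg23, ← TensorProduct.smul_tmul']
  rw [h2, h3] at h1
  exact h1.symm

theorem comul_targetMap' (h : H) : Δ (targetMap ℂ h) = (targetMap ℂ h ⊗ₜ 1) * Δ₁ := by
  let L : H ⊗[ℂ] (H ⊗[ℂ] H) →ₗ[ℂ] H ⊗[ℂ] H := (TensorProduct.lid ℂ _).toLinearMap ∘ₗ
    (counit (R := ℂ) (A := H) ∘ₗ LinearMap.mulRight ℂ h).rTensor _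
  have h1 := congrArg L (comulId_comulOne (H := H))
  rw [QuantumGroupoid.comulId_one] at h1
  have h2 : ∀ X : H ⊗[ℂ] H, L (LinearMap.lTensor H (Coalgebra.comul (R := ℂ)) X) =
      Δ (TensorProduct.lid ℂ H ((counit (R := ℂ) (A := H)).rTensor H (X * (h ⊗ₜ 1)))) := by
    intro X
    induction X with
    | zero => simp
    | add a b ha hb => simp only [map_add, ha, hb, add_mul]
    | tmul a b => simp [L]
  have h3 : ∀ X Y : H ⊗[ℂ] H, L (leg12 Y * leg23 X) =
      ((TensorProduct.lid ℂ H ((counit (R := ℂ) (A := H)).rTensor H (Y * (h ⊗ₜ 1)))) ⊗ₜ 1) * X := by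
    intro X Y
    induction Y with
    | zero => simp
    | add a b ha hb => simp only [map_add, ha, hb, add_mul, TensorProduct.add_tmul]
    | tmul a b => simp [L, leg12, leg23, ← TensorProduct.smul_tmul']
  rw [h2, h3] at h1
  exact h1.symm

theorem comul_sourceMap (h : H) : Δ (sourceMap ℂ h) = (1 ⊗ₜ sourceMap ℂ h) * Δ₁ := by
  let L : H ⊗[ℂ] (H ⊗[ℂ] H) →ₗ[ℂ] H ⊗[ℂ] H := (TensorProduct.rid ℂ _).toLinearMap ∘ₗ
    (counit (R := ℂ) (A := H) ∘ₗ LinearMap.mulLeft ℂ h).lTensor _ ∘ₗ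
    (TensorProduct.assoc ℂ H H H).symm.toLinearMap
  have h1 := congrArg L (QuantumGroupoid.comulId_one' (k := ℂ) (H := H))
  have h2 : ∀ X : H ⊗[ℂ] H, L (comulId ℂ H X) =
      Δ (TensorProduct.rid ℂ H ((counit (R := ℂ) (A := H)).lTensor H ((1 ⊗ₜ h) * X))) := by
    intro X
    induction X with
    | zero => simp
    | add a b ha hb => simp only [map_add, ha, hb, mul_add]
    | tmul a b => simp [L, comulId]
  have h3 : ∀ X Y : H ⊗[ℂ] H, L (leg23 Y * leg12 X) =
      (1 ⊗ₜ (TensorProduct.rid ℂ H ((counit (R := ℂ) (A := H)).lTensor H ((1 ⊗ₜ h) * Y)))) * X := by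
    intro X Y
    induction Y with
    | zero => simp
    | add a b ha hb => simp only [map_add, ha, hb, add_mul, mul_add, TensorProduct.tmul_add]
    | tmul a b =>
      induction X with
      | zero => simp
      | add a b ha hb => simp only [map_add, ha, hb, mul_add]
      | tmul c d => simp [L, leg12, leg23]
  rw [h2, h3] at h1
  exact h1

theorem comul_sourceMap' (h : H) : Δ (sourceMap ℂ h) = Δ₁ * (1 ⊗ₜ sourceMap ℂ h) := by
  let L : H ⊗[ℂ] (H ⊗[ℂ] H) →ₗ[ℂ] H ⊗[ℂ] H := (TensorProduct.rid ℂ _).toLinearMap ∘ₗ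
    (counit (R := ℂ) (A := H) ∘ₗ LinearMap.mulLeft ℂ h).lTensor _ ∘ₗ
    (TensorProduct.assoc ℂ H H H).symm.toLinearMap
  have h1 := congrArg L (QuantumGroupoid.comulId_one (k := ℂ) (H := H))
  have h2 : ∀ X : H ⊗[ℂ] H, L (comulId ℂ H X) =
      Δ (TensorProduct.rid ℂ H ((counit (R := ℂ) (A := H)).lTensor H ((1 ⊗ₜ h) * X))) := by
    intro X
    induction X with
    | zero => simp
    | add a b ha hb => simp only [map_add, ha, hb, mul_add]
    | tmul a b => simp [L, comulId]
  have h3 : ∀ X Y : H ⊗[ℂ] H, L (leg12 X * leg23 Y) =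
      X * (1 ⊗ₜ (TensorProduct.rid ℂ H ((counit (R := ℂ) (A := H)).lTensor H ((1 ⊗ₜ h) * Y)))) := by
    intro X Y
    induction Y with
    | zero => simp
    | add a b ha hb => simp only [map_add, ha, hb, mul_add, TensorProduct.tmul_add]
    | tmul a b =>
      induction X with
      | zero => simp
      | add a b ha hb => simp only [map_add, ha, hb, add_mul]
      | tmul c d => simp [L, leg12, leg23]
  rw [h2, h3] at h1
  exact h1

end WeakHopf

/-! ### Counital subalgebras and the inverse of the antipode. -/

section Target

variable {H : Type u} [Ring H] [Algebra ℂ H] [Coalgebra ℂ H] [StarRing H] [StarModule ℂ H]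
  [CStarQuantumGroupoid H]

local notation "Δ₁" => comulOne ℂ H

variable (H) in
/-- The source counital subalgebra `H_s = ε_s(H)`, as a subspace of `H`. -/
def sourceSpace : Submodule ℂ H := LinearMap.range (sourceMap ℂ (H := H))

theorem comul_of_mem_target {z : H} (hz : z ∈ targetSpace H) : Δ z = Δ₁ * (z ⊗ₜ 1) := by
  obtain ⟨h, rfl⟩ := hz; exact comul_targetMap h

theorem comul_of_mem_target' {z : H} (hz : z ∈ targetSpace H) : Δ z = (z ⊗ₜ 1) * Δ₁ := by
  obtain ⟨h, rfl⟩ := hz; exact comul_targetMap' h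

theorem comul_of_mem_source {z : H} (hz : z ∈ sourceSpace H) : Δ z = (1 ⊗ₜ z) * Δ₁ := by
  obtain ⟨h, rfl⟩ := hz; exact comul_sourceMap h

theorem comul_of_mem_source' {z : H} (hz : z ∈ sourceSpace H) : Δ z = Δ₁ * (1 ⊗ₜ z) := by
  obtain ⟨h, rfl⟩ := hz; exact comul_sourceMap' h

/-- `ε ⊗ id` turns the hypothesis into `z = ε_t(z)`. Closure of `H_t` under `*` and products can
therefore be read off from coproducts. -/
theorem mem_target_of_comul {z : H} (hz : Δ z = Δ₁ * (z ⊗ₜ 1)) : z ∈ targetSpace H :=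
  ⟨z, by conv_rhs => rw [← lid_counit_comul z, hz]
         rfl⟩

theorem star_comulOne : star Δ₁ = Δ₁ := by
  rw [comulOne, ← CStarQuantumGroupoid.comul_star, star_one]

theorem star_mem_target {z : H} (hz : z ∈ targetSpace H) : star z ∈ targetSpace H :=
  mem_target_of_comul (by
    rw [CStarQuantumGroupoid.comul_star, comul_of_mem_target' hz, star_mul, star_comulOne,
      TensorProduct.star_tmul, star_one])

theorem one_mem_target : (1 : H) ∈ targetSpace H := ⟨1, targetMap_one⟩

theorem mul_mem_target {y z : H} (hy : y ∈ targetSpace H) (hz : z ∈ targetSpace H) :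
    y * z ∈ targetSpace H :=
  mem_target_of_comul (by
    rw [comul_mul, comul_of_mem_target hz, ← mul_assoc, comul_mul_comulOne, comul_of_mem_target hy,
      mul_assoc, Algebra.TensorProduct.tmul_mul_tmul, mul_one])

/-- The two expressions `Δ(1)(z ⊗ 1)` and `(z ⊗ 1)Δ(1)` for `Δ(z)` become `ε_s(k) z` and `z ε_s(k)`
under `X ↦ (id ⊗ ε)((1 ⊗ k)X)`. -/
theorem commute_source_target {y z : H} (hy : y ∈ sourceSpace H) (hz : z ∈ targetSpace H) :
    y * z = z * y := by
  obtain ⟨k, rfl⟩ := hy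
  have h1 := (comul_of_mem_target hz).symm.trans (comul_of_mem_target' hz)
  have h2 := congrArg (fun X => TensorProduct.rid ℂ H
    ((counit (R := ℂ) (A := H)).lTensor H ((1 ⊗ₜ k) * X))) h1
  have h3 : ∀ X : H ⊗[ℂ] H, TensorProduct.rid ℂ H
    ((counit (R := ℂ) (A := H)).lTensor H ((1 ⊗ₜ k) * (X * (z ⊗ₜ 1)))) = TensorProduct.rid ℂ H
    ((counit (R := ℂ) (A := H)).lTensor H ((1 ⊗ₜ k) * X)) * z := by
    intro X
    induction X with
    | zero => simp
    | add a b ha hb => simp only [map_add, ha, hb, mul_add, add_mul]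
    | tmul a b => simp
  have h4 : ∀ X : H ⊗[ℂ] H, TensorProduct.rid ℂ H
    ((counit (R := ℂ) (A := H)).lTensor H ((1 ⊗ₜ k) * ((z ⊗ₜ 1) * X))) = z * TensorProduct.rid ℂ H
    ((counit (R := ℂ) (A := H)).lTensor H ((1 ⊗ₜ k) * X)) := by
    intro X
    induction X with
    | zero => simp
    | add a b ha hb => simp only [map_add, ha, hb, mul_add]
    | tmul a b => simp
  rw [h3, h4] at h2
  exact h2

theorem sum_comulOne {ι : Type*} (r : Repr ℂ (1 : H) ι) :
    ∑ i ∈ r.index, r.left i ⊗ₜ[ℂ] r.right i = Δ₁ := r.eq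

/-- A decomposition of `Δ(1)` in `H_s ⊗ H_t`. -/
theorem exists_repr_one : ∃ r : Repr ℂ (1 : H) (H × H),
    (∀ i, r.left i ∈ sourceSpace H) ∧ ∀ i, r.right i ∈ targetSpace H := by
  let r := ℛ ℂ (1 : H)
  refine ⟨⟨r.index, fun i => sourceMap ℂ (r.left i), fun i => targetMap ℂ (r.right i), ?_⟩,
    fun i => LinearMap.mem_range_self _ _, fun i => LinearMap.mem_range_self _ _⟩
  -- At `h = 1` the contraction formulas say that `id ⊗ ε_t` and `ε_s ⊗ id` both fix `Δ(1)`.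
  have h1 := congrArg ((sourceMap ℂ (H := H)).rTensor H) (targetMap_lTensor_comul (1 : H))
  rw [← Algebra.TensorProduct.one_def, mul_one, comulOne, sourceMap_rTensor_comul,
    ← Algebra.TensorProduct.one_def, one_mul, ← r.eq, comulOne] at h1
  simpa using h1

/-- As `Δ(y) = (1 ⊗ y)Δ(1)`, the antipode axiom reads `ε_t(y) = 1₍₁₎ S(1₍₂₎) S(y)`, and `1₍₁₎
S(1₍₂₎) = 1`. -/
theorem targetMap_of_mem_source {y : H} (hy : y ∈ sourceSpace H) : targetMap ℂ y = S ℂ y := by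
  rw [← QuantumGroupoid.mul_antipode, comul_of_mem_source hy]
  have : ∀ X : H ⊗[ℂ] H, LinearMap.mul' ℂ H ((S ℂ (H := H)).lTensor H ((1 ⊗ₜ y) * X)) =
      LinearMap.mul' ℂ H ((S ℂ (H := H)).lTensor H X) * S ℂ y := by
    intro X
    induction X with
    | zero => simp
    | add a b ha hb => simp only [map_add, ha, hb, mul_add, add_mul]
    | tmul a b => simp [QuantumGroupoid.antipode_mul, mul_assoc]
  rw [this, comulOne, QuantumGroupoid.mul_antipode, targetMap_one, one_mul]

theorem sourceMap_of_mem_target {y : H} (hy : y ∈ targetSpace H) : sourceMap ℂ y = S ℂ y := by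
  rw [← QuantumGroupoid.antipode_mul', comul_of_mem_target hy]
  have : ∀ X : H ⊗[ℂ] H, LinearMap.mul' ℂ H ((S ℂ (H := H)).rTensor H (X * (y ⊗ₜ 1))) =
      S ℂ y * LinearMap.mul' ℂ H ((S ℂ (H := H)).rTensor H X) := by
    intro X
    induction X with
    | zero => simp
    | add a b ha hb => simp only [map_add, ha, hb, mul_add, add_mul]
    | tmul a b => simp [QuantumGroupoid.antipode_mul, mul_assoc]
  rw [this, comulOne, QuantumGroupoid.antipode_mul', sourceMap_one, mul_one]

/-- `ε_t` factors through `h ↦ 1₍₁₎ ε(1₍₂₎ h)`, which produces `Δ(1)(1 ⊗ h)`; the first legs of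
`Δ(1)` lie in `H_s`, where `ε_t` is `S`. -/
theorem targetMap_rTensor_comul (h : H) :
    (targetMap ℂ (H := H)).rTensor H (Δ h) = (S ℂ (H := H)).rTensor H Δ₁ * (1 ⊗ₜ h) := by
  have h1 : targetMap ℂ (H := H) = targetMap ℂ ∘ₗ sourceMap' :=
    LinearMap.ext fun h => (targetMap_sourceMap' h).symm
  rw [h1, LinearMap.rTensor_comp, LinearMap.comp_apply, sourceMap'_rTensor_comul]
  obtain ⟨r, hr, -⟩ := exists_repr_one (H := H)
  rw [← sum_comulOne r]
  simp [Finset.sum_mul, targetMap_of_mem_source (hr _)]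

/-- The inverse of the antipode. -/
def antipodeInv : H →ₗ[ℂ] H where
  toFun h := star (S ℂ (star h))
  map_add' a b := by simp
  map_smul' a b := by simp

local notation "T" => antipodeInv (H := H)

theorem antipode_mul (x y : H) : S ℂ (x * y) = S ℂ y * S ℂ x := QuantumGroupoid.antipode_mul x y

theorem antipode_one : S ℂ (1 : H) = 1 := QuantumGroupoid.antipode_one

theorem antipodeInv_mul (x y : H) : T (x * y) = T y * T x := by
  simp [antipodeInv, antipode_mul]

theorem antipodeInv_one : T 1 = 1 := by
  simp [antipodeInv, antipode_one]

theorem star_antipode (x : H) : star (S ℂ x) = T (star x) := by simp [antipodeInv]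

/-- The image of a representation of `Δ(h)` under the involution. -/
def reprStar {ι : Type*} {h : H} (r : Repr ℂ h ι) : Repr ℂ (star h) ι where
  index := r.index
  left i := star (r.left i)
  right i := star (r.right i)
  eq := by
    rw [CStarQuantumGroupoid.comul_star, ← r.eq, star_sum]
    simp

/-- Applying `*` to a Sweedler identity at `h*` reverses products and turns `S` into `* S *`. It is
not yet known that this map inverts `S`. -/
theorem sum_antipodeInv_mul_comul {ι : Type*} {h : H} (r : Repr ℂ h ι) :
    ∑ i ∈ r.index, (1 ⊗ₜ T (r.right i)) * Δ (r.left i) = (h ⊗ₜ 1) * Δ₁ := by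
  have h1 := congrArg star (sum_comul_mul_antipode (reprStar r))
  simpa [star_comulOne, reprStar, ← CStarQuantumGroupoid.comul_star, star_antipode] using h1

theorem sum_comul_mul_antipodeInv {ι : Type*} {h : H} (r : Repr ℂ h ι) :
    ∑ i ∈ r.index, Δ (r.right i) * (T (r.left i) ⊗ₜ 1) = Δ₁ * (1 ⊗ₜ h) := by
  have h1 := congrArg star (sum_antipode_mul_comul (reprStar r))
  simpa [star_comulOne, reprStar, ← CStarQuantumGroupoid.comul_star, star_antipode] using h1

theorem sum_one_antipodeInv_mul {ι : Type*} (r : Repr ℂ (1 : H) ι) :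
    ∑ i ∈ r.index, T (r.right i) * r.left i = 1 := by
  have h1 := congrArg star (sum_left_mul_antipode (reprStar r))
  simpa [reprStar, star_antipode, targetMap_one] using h1

/-- Evaluate `ε_t(h₍₁₎) S(T(h₍₂₎))` twice, where `T = * S *`. Applying `a ⊗ b ↦ a S(b)` to the
starred Sweedler identity gives `h`. Inserting `ε_t(h₍₁₎) ⊗ h₍₂₎ = S(1₍₁₎) ⊗ 1₍₂₎ h` gives `S(T(h)
T(1₍₂₎) 1₍₁₎) = S(T(h))`. -/
theorem antipode_antipodeInv (h : H) : S ℂ (T h) = h := by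
  let r := ℛ ℂ h
  let L : H ⊗[ℂ] H →ₗ[ℂ] H := LinearMap.mul' ℂ H ∘ₗ (S ℂ (H := H)).lTensor H
  have h1 := congrArg L (sum_antipodeInv_mul_comul r)
  have h2 : ∀ X : H ⊗[ℂ] H, L ((h ⊗ₜ 1) * X) = h * L X := by
    intro X
    induction X with
    | zero => simp
    | add a b ha hb => simp only [map_add, ha, hb, mul_add]
    | tmul a b => simp [L, mul_assoc]
  have h3 : ∀ (y : H) (X : H ⊗[ℂ] H), L ((1 ⊗ₜ y) * X) = L X * S ℂ y := by
    intro y X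
    induction X with
    | zero => simp
    | add a b ha hb => simp only [map_add, ha, hb, mul_add, add_mul]
    | tmul a b => simp [L, mul_assoc, antipode_mul]
  have h4 : ∀ x : H, L (Δ x) = targetMap ℂ x := QuantumGroupoid.mul_antipode
  have h5 : L Δ₁ = 1 := (h4 1).trans targetMap_one
  rw [h2, h5, mul_one, map_sum] at h1
  simp only [h3, h4] at h1
  have h6 := congrArg (LinearMap.mul' ℂ H ∘ₗ (S ℂ (H := H) ∘ₗ T).lTensor H)
    (targetMap_rTensor_comul h)
  rw [← r.eq] at h6
  rw [← sum_comulOne (ℛ ℂ (1 : H))] at h6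
  simp only [map_sum, LinearMap.rTensor_tmul, LinearMap.comp_apply, LinearMap.lTensor_tmul,
    LinearMap.mul'_apply, Finset.sum_mul, Algebra.TensorProduct.tmul_mul_tmul, mul_one,
    antipodeInv_mul, ← antipode_mul, mul_assoc] at h6
  rw [← map_sum, ← Finset.mul_sum, sum_one_antipodeInv_mul, mul_one] at h6
  exact h6.symm.trans h1

theorem antipodeInv_antipode (h : H) : T (S ℂ h) = h := by
  have := congrArg star (antipode_antipodeInv (star h))
  simpa [antipodeInv] using this

theorem antipode_star_antipode_star (h : H) : S ℂ (star (S ℂ (star h))) = h :=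
  antipode_antipodeInv h

end Target

/-! ### Moving elements of `H_t` across `Δ(1)`. -/

section Target

variable {H : Type u} [Ring H] [Algebra ℂ H] [Coalgebra ℂ H] [StarRing H] [StarModule ℂ H]
  [CStarQuantumGroupoid H]

local notation "Δ₁" => comulOne ℂ H
local notation "T" => antipodeInv (H := H)

theorem mem_source_of_comul {z : H} (hz : Δ z = (1 ⊗ₜ z) * Δ₁) : z ∈ sourceSpace H :=
  ⟨z, by conv_rhs => rw [← rid_counit_comul z, hz]
         rfl⟩

theorem star_mem_source {z : H} (hz : z ∈ sourceSpace H) : star z ∈ sourceSpace H :=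
  mem_source_of_comul (by
    rw [CStarQuantumGroupoid.comul_star, comul_of_mem_source' hz, star_mul, star_comulOne,
      TensorProduct.star_tmul, star_one])

theorem antipode_mem_source {z : H} (hz : z ∈ targetSpace H) : S ℂ z ∈ sourceSpace H :=
  ⟨z, sourceMap_of_mem_target hz⟩

theorem antipodeInv_mem_source {z : H} (hz : z ∈ targetSpace H) : T z ∈ sourceSpace H :=
  star_mem_source (antipode_mem_source (star_mem_target hz))

/-- Write `Δ(z) = z 1₍₁₎ ⊗ 1₍₂₎`. Then the identity `Σ Δ(h₍₂₎)(T(h₍₁₎) ⊗ 1) = Δ(1)(1 ⊗ h)` at `h =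
z` differs from the one at `h = 1` by the right factor `T(z) ⊗ 1`. This is what makes `V ⊗ W`
balanced over `H_t`. -/
theorem comulOne_mul_target {z : H} (hz : z ∈ targetSpace H) :
    Δ₁ * (1 ⊗ₜ z) = Δ₁ * (T z ⊗ₜ 1) := by
  let r := ℛ ℂ (1 : H)
  let r' : Repr ℂ z (H × H) := ⟨r.index, fun i => z * r.left i, r.right, by
    rw [comul_of_mem_target' hz, ← sum_comulOne r, Finset.mul_sum]
    simp⟩
  have h1 := sum_comul_mul_antipodeInv r
  have h2 := sum_comul_mul_antipodeInv r'
  rw [← Algebra.TensorProduct.one_def, mul_one] at h1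
  rw [← h2]
  conv_rhs => rw [← h1]
  rw [Finset.sum_mul]
  simp [r', antipodeInv_mul, mul_assoc]

theorem target_mul_comulOne {z : H} (hz : z ∈ targetSpace H) :
    (1 ⊗ₜ z) * Δ₁ = (S ℂ z ⊗ₜ 1) * Δ₁ := by
  let r := ℛ ℂ (1 : H)
  let r' : Repr ℂ z (H × H) := ⟨r.index, fun i => r.left i * z, r.right, by
    rw [comul_of_mem_target hz, ← sum_comulOne r, Finset.sum_mul]
    simp⟩
  have h1 := sum_antipode_mul_comul r
  have h2 := sum_antipode_mul_comul r'
  rw [← Algebra.TensorProduct.one_def, one_mul] at h1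
  rw [← h2]
  conv_rhs => rw [← h1]
  rw [Finset.mul_sum]
  simp [r', antipode_mul, ← mul_assoc]

end Target

open ComplexOrder Polynomial

/-! ### Polynomial roots of positive operators. -/

section Sqrt

/-- A positive operator on a finite-dimensional Hilbert space has a fourth root which is a
polynomial in it with real coefficients. -/
theorem exists_polynomial_root {E : Type*} [NormedAddCommGroup E] [InnerProductSpace ℂ E]
    [FiniteDimensional ℂ E] {P : E →ₗ[ℂ] E} (hP : P.IsPositive) :
    ∃ p : ℝ[X], aeval P (p.map (algebraMap ℝ ℂ)) ^ 4 = P := by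
  have hs := hP.isSymmetric
  let b := hs.eigenvectorBasis (n := Module.finrank ℂ E) rfl
  let l := hs.eigenvalues (n := Module.finrank ℂ E) rfl
  let s : Finset ℝ := Finset.univ.image l
  -- Interpolation of the fourth root on the finite spectrum. The fourth root is wanted so that its
  -- square is a square root which is itself the square of a self-adjoint element.
  let p : ℝ[X] := Lagrange.interpolate s id fun x => Real.sqrt (Real.sqrt x)
  have hp : ∀ i, p.eval (l i) = Real.sqrt (Real.sqrt (l i)) := fun i =>
    Lagrange.eval_interpolate_at_node (v := id) (fun x => Real.sqrt (Real.sqrt x)) (fun _ _ _ _ h => h)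
      (Finset.mem_image_of_mem l (Finset.mem_univ i))
  have hb : ∀ i, P (b i) = (l i : ℂ) • b i := fun i => hs.apply_eigenvectorBasis rfl i
  have hq : ∀ (q : ℂ[X]) i, aeval P q (b i) = (q.eval (l i : ℂ)) • b i := fun q i =>
    Module.End.aeval_apply_of_hasEigenvector
      ⟨Module.End.mem_eigenspace_iff.2 (hb i), b.orthonormal.ne_zero i⟩
  refine ⟨p, b.toBasis.ext fun i => ?_⟩
  have hl : 0 ≤ l i := hP.nonneg_eigenvalues rfl i
  have : (p.map (algebraMap ℝ ℂ)).eval (l i : ℂ) = (Real.sqrt (Real.sqrt (l i)) : ℂ) := by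
    rw [← hp i]
    rw [Polynomial.eval_map_algebraMap]
    exact Polynomial.aeval_algebraMap_apply ℂ (l i) p
  rw [OrthonormalBasis.coe_toBasis, ← map_pow, hq, hb, Polynomial.eval_pow, this,
    ← Complex.ofReal_pow, show 4 = 2 * 2 from rfl, pow_mul, Real.sq_sqrt (Real.sqrt_nonneg _),
    Real.sq_sqrt hl]

end Sqrt

/-! ### Faithful positive functionals on a finite-dimensional `*`-algebra. -/

section StarAlgebra

variable {A : Type*} [Ring A] [Algebra ℂ A] [StarRing A] [StarModule ℂ A]

/-- Positive functionals. -/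
def IsPositiveFunctional (f : A →ₗ[ℂ] ℂ) : Prop := ∀ a : A, 0 ≤ f (star a * a)

/-- Faithful positive functionals. -/
def IsFaithful (f : A →ₗ[ℂ] ℂ) : Prop := ∀ a : A, a ≠ 0 → 0 < f (star a * a)

theorem IsFaithful.isPositive {f : A →ₗ[ℂ] ℂ} (hf : IsFaithful f) : IsPositiveFunctional f := by
  intro a
  by_cases h : a = 0
  · simp [h]
  · exact (hf a h).le

theorem IsFaithful.eq_zero {f : A →ₗ[ℂ] ℂ} (hf : IsFaithful f) {a : A} (h : f (star a * a) = 0) :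
    a = 0 := by
  by_contra h'
  exact (hf a h').ne' h

/-- Polarisation: the values at `(1 + a)*(1 + a)` and `(1 + ia)*(1 + ia)` are real, which determines
the imaginary and the real part of `f(a*)`. -/
theorem IsPositiveFunctional.map_star {f : A →ₗ[ℂ] ℂ} (hf : IsPositiveFunctional f) (a : A) :
    f (star a) = starRingEnd ℂ (f a) := by
  have h0 : ∀ a, (f (star a * a)).im = 0 := fun a => (Complex.nonneg_iff.1 (hf a)).2.symm
  have h1 := h0 (1 + a)
  have h2 := h0 (1 + Complex.I • a)
  have h3 := h0 1
  have h4 := h0 a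
  simp only [star_add, star_one, add_mul, mul_add, one_mul, mul_one, map_add, Complex.add_im,
    star_smul, smul_mul_assoc, mul_smul_comm, map_smul, smul_eq_mul, Complex.mul_im,
    Complex.star_def, Complex.conj_I, Complex.neg_re, Complex.neg_im, Complex.I_re, Complex.I_im,
    Complex.mul_re] at h1 h2 h3 h4
  apply Complex.ext <;> simp only [Complex.conj_re, Complex.conj_im] <;> linarith

/-- The semi-definite scalar product defined by a positive functional. -/
abbrev IsPositiveFunctional.core {f : A →ₗ[ℂ] ℂ} (hf : IsPositiveFunctional f) :
    PreInnerProductSpace.Core ℂ A where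
  inner a b := f (star a * b)
  conj_inner_symm a b := by rw [← hf.map_star]; simp
  re_inner_nonneg a := (Complex.nonneg_iff.1 (hf a)).1
  add_left a b c := by simp [add_mul]
  smul_left a b c := by simp

theorem IsPositiveFunctional.cauchy_schwarz {f : A →ₗ[ℂ] ℂ} (hf : IsPositiveFunctional f)
    (a b : A) : ‖f (star a * b)‖ ^ 2 ≤ (f (star a * a)).re * (f (star b * b)).re := by
  have h := @InnerProductSpace.Core.inner_mul_inner_self_le ℂ A _ _ _ hf.core a b
  change ‖f (star a * b)‖ * ‖f (star b * a)‖ ≤ _ at h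
  rwa [show star b * a = star (star a * b) by simp, hf.map_star, RCLike.norm_conj, ← sq] at h

theorem IsPositiveFunctional.eq_zero_of_self {f : A →ₗ[ℂ] ℂ} (hf : IsPositiveFunctional f)
    {x : A} (hx : f (star x * x) = 0) (y : A) : f (y * x) = 0 := by
  have h := hf.cauchy_schwarz (star y) x
  rw [hx, star_star] at h
  simp only [Complex.zero_re, mul_zero] at h
  exact norm_eq_zero.1 (pow_eq_zero_iff two_ne_zero |>.1 (le_antisymm h (sq_nonneg _)))

/-- The scalar product defined by a faithful positive functional. -/
abbrev IsFaithful.core {f : A →ₗ[ℂ] ℂ} (hf : IsFaithful f) : InnerProductSpace.Core ℂ A where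
  toCore := hf.isPositive.core
  definite _ h := hf.eq_zero h

variable [FiniteDimensional ℂ A]

/-- The scalar product `(a, b) ↦ f(a* b)` is used only here to get a basis; the conclusion is
phrased through `f`, so that no norm on `A` has to be carried along. -/
theorem IsFaithful.exists_orthonormal {f : A →ₗ[ℂ] ℂ} (hf : IsFaithful f) :
    ∃ (n : ℕ) (e : Fin n → A), (∀ i j, f (star (e i) * e j) = if i = j then 1 else 0) ∧
      (∀ a, ∑ i, f (star (e i) * a) • e i = a) ∧
      ∀ P : A →ₗ[ℂ] A, LinearMap.trace ℂ A P = ∑ i, f (star (e i) * P (e i)) := by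
  let _ : NormedAddCommGroup A := hf.core.toNormedAddCommGroup
  let _ : InnerProductSpace ℂ A := InnerProductSpace.ofCore hf.core.toCore
  let b := stdOrthonormalBasis ℂ A
  exact ⟨_, b, fun i j => orthonormal_iff_ite.1 b.orthonormal i j, fun a => b.sum_repr' a,
    fun P => LinearMap.trace_eq_sum_inner P b⟩

theorem IsFaithful.eq_of_forall {f : A →ₗ[ℂ] ℂ} (hf : IsFaithful f) {x y : A}
    (h : ∀ a, f (a * x) = f (a * y)) : x = y := by
  refine sub_eq_zero.1 (hf.eq_zero ?_)
  rw [mul_sub, map_sub, h, sub_self]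

/-- Left multiplication by `x` is a positive operator for `(a, b) ↦ f(a* b)`. A polynomial in it is
left multiplication by the same polynomial in `x`, and real coefficients keep this self-adjoint. -/
theorem IsFaithful.exists_root {f : A →ₗ[ℂ] ℂ} (hf : IsFaithful f) {x : A}
    (hx : ∀ b, 0 ≤ f (star b * (x * b))) : ∃ p : ℝ[X],
      star (aeval x (p.map (algebraMap ℝ ℂ))) = aeval x (p.map (algebraMap ℝ ℂ)) ∧
      aeval x (p.map (algebraMap ℝ ℂ)) ^ 4 = x := by
  let _ : NormedAddCommGroup A := hf.core.toNormedAddCommGroup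
  let _ : InnerProductSpace ℂ A := InnerProductSpace.ofCore hf.core.toCore
  have hs : (LinearMap.mulLeft ℂ x).IsSymmetric := by
    rw [LinearMap.isSymmetric_iff_inner_map_self_real]
    intro v
    rw [inner_conj_symm]
    have h1 : (f (star v * (x * v))).im = 0 := (Complex.nonneg_iff.1 (hx v)).2.symm
    have h2 := hf.isPositive.map_star (star v * (x * v))
    rw [Complex.conj_eq_iff_im.2 h1] at h2
    change f (star v * (x * v)) = f (star (x * v) * v)
    rw [← h2]
    simp [mul_assoc]
  have hP : (LinearMap.mulLeft ℂ x).IsPositive := ⟨hs, fun v => by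
    rw [hs]
    exact (Complex.nonneg_iff.1 (hx v)).1⟩
  obtain ⟨p, hp⟩ := exists_polynomial_root hP
  have hx' : star x = x := by
    refine hf.eq_of_forall fun a => ?_
    have : f (star (x * star a) * 1) = f (star (star a) * (x * 1)) := hs (star a) 1
    simpa using this
  refine ⟨p, ?_, ?_⟩
  · clear hp
    induction p using Polynomial.induction_on' with
    | add p q hp hq => simp only [Polynomial.map_add, map_add, star_add, hp, hq]
    | monomial n a =>
      simp [hx', Algebra.algebraMap_eq_smul_one]
  · have h1 : ∀ q : ℂ[X], aeval (LinearMap.mulLeft ℂ x) q = LinearMap.mulLeft ℂ (aeval x q) :=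
      fun q => (aeval_algHom_apply (Algebra.lmul ℂ A) x q)
    rw [h1] at hp
    simpa using LinearMap.congr_fun hp 1

/-- The left ideal on which a functional vanishes. -/
def leftKernel (f : A →ₗ[ℂ] ℂ) : Submodule A A where
  carrier := {x | ∀ y, f (y * x) = 0}
  add_mem' ha hb y := by rw [mul_add, map_add, ha, hb, add_zero]
  zero_mem' y := by simp
  smul_mem' a x hx y := by rw [smul_eq_mul, ← mul_assoc]; exact hx _

/-- Schur's lemma: right multiplication by `y` is an endomorphism of the simple left module `J`, so
an eigenspace is a nonzero submodule. -/
theorem exists_smul_of_isAtom {J : Submodule A A} (hJ : IsAtom J) {y : A} (hy : y ∈ J) :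
    ∃ c : ℂ, ∀ z ∈ J, z * y = c • z := by
  let J' := J.restrictScalars ℂ
  have : Nontrivial J' := Submodule.nontrivial_iff_ne_bot.2 fun h => hJ.1 (by
    rwa [Submodule.restrictScalars_eq_bot_iff] at h)
  let P : Module.End ℂ J' := (LinearMap.mulRight ℂ y).restrict fun z _ => J.smul_mem z hy
  obtain ⟨c, hc⟩ := Module.End.exists_eigenvalue P
  obtain ⟨z, hz⟩ := hc.exists_hasEigenvector
  let K : Submodule A A :=
    { carrier := {z | z ∈ J ∧ z * y = c • z}
      add_mem' := fun {a b} ha hb => ⟨J.add_mem (And.left ha) (And.left hb), by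
        rw [add_mul, And.right ha, And.right hb, smul_add]⟩
      zero_mem' := ⟨J.zero_mem, by simp⟩
      smul_mem' := fun a z hz => ⟨J.smul_mem a (And.left hz), by
        rw [smul_eq_mul, mul_assoc, And.right hz, mul_smul_comm]⟩ }
  have hK : K = J := (hJ.le_iff.1 (show K ≤ J from fun z hz => And.left hz)).resolve_left fun h => hz.2 (by
    have : z.1 ∈ K := ⟨z.2, congrArg Subtype.val hz.apply_eq_smul⟩
    rw [h] at this
    exact Subtype.ext ((Submodule.mem_bot A).1 this))
  refine ⟨c, fun z hz => ?_⟩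
  rw [← hK] at hz
  exact And.right hz

/-- For `0 ≠ x ∈ J`, Schur's lemma gives `(x* x)² = c x* x`. Since `x* x` is self-adjoint and
nonzero its square is nonzero, so `c` is nonzero and real, and `c⁻¹ x* x` is the projection. -/
theorem exists_projection_of_isAtom (hA : ∀ x : A, star x * x = 0 → x = 0) {J : Submodule A A}
    (hJ : IsAtom J) : ∃ q ∈ J, q ≠ 0 ∧ star q = q ∧ q * q = q ∧ ∀ h, ∃ c : ℂ, q * h * q = c • q := by
  obtain ⟨x, hx, hx0⟩ := Submodule.exists_mem_ne_zero_of_ne_bot hJ.1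
  have ha : star x * x ∈ J := J.smul_mem (star x) hx
  obtain ⟨c, hc⟩ := exists_smul_of_isAtom hJ ha
  have ha0 : star x * x ≠ 0 := fun h => hx0 (hA x h)
  have haa := hc _ ha
  have hc0 : c ≠ 0 := fun h => by
    rw [h, zero_smul] at haa
    exact ha0 (hA _ (by simpa using haa))
  have hcr : starRingEnd ℂ c = c := by
    have h1 := congrArg star haa
    simp only [star_mul, star_star, star_smul] at h1
    rw [haa] at h1
    exact (smul_left_injective ℂ ha0 h1).symm
  have hq : c⁻¹ • (star x * x) ∈ J := (J.restrictScalars ℂ).smul_mem _ ha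
  refine ⟨c⁻¹ • (star x * x), hq, smul_ne_zero (inv_ne_zero hc0) ha0, ?_, ?_, fun h => ?_⟩
  · simp [hcr]
  · rw [smul_mul_smul_comm, haa, smul_smul, mul_assoc, inv_mul_cancel₀ hc0, mul_one]
  · obtain ⟨d, hd⟩ := exists_smul_of_isAtom hJ (J.smul_mem h hq)
    exact ⟨d, by rw [mul_assoc]; exact hd _ hq⟩

/-- Suppose `x* x = -t² q` with `t ≠ 0` real. For a suitable phase `w` the mixed terms of `(tq +
wx)*(tq + wx)` cancel, so this square is zero. Then `x` is a multiple of `q` and `x* x = t² q`, a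
contradiction. -/
theorem nonneg_of_star_mul_self_eq_smul (hA : ∀ x : A, star x * x = 0 → x = 0) {q : A}
    (hq0 : q ≠ 0) (hq : star q = q) (hqq : q * q = q) (hqh : ∀ h, ∃ c : ℂ, q * h * q = c • q)
    {x : A} (hx : x * q = x) {c : ℂ} (hc : star x * x = c • q) : 0 ≤ c := by
  have hcr : starRingEnd ℂ c = c := by
    have h1 := congrArg star hc
    simp only [star_mul, star_star, star_smul, hq] at h1
    rw [hc] at h1
    exact (smul_left_injective ℂ hq0 h1).symm
  obtain ⟨r, rfl⟩ := Complex.conj_eq_iff_real.1 hcr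
  by_contra hneg
  have hr : 0 < -r := by
    by_contra h
    exact hneg (Complex.zero_le_real.2 (by linarith))
  obtain ⟨t, ht0, ht⟩ : ∃ t : ℝ, t ≠ 0 ∧ t * t = -r :=
    ⟨Real.sqrt (-r), (Real.sqrt_pos.2 hr).ne', Real.mul_self_sqrt hr.le⟩
  obtain ⟨d, hd⟩ := hqh x
  rw [mul_assoc, hx] at hd
  have hd' : star x * q = starRingEnd ℂ d • q := by
    have := congrArg star hd
    simpa [hq] using this
  obtain ⟨w, hw, hwd⟩ : ∃ w : ℂ, starRingEnd ℂ w * w = 1 ∧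
      w * d + starRingEnd ℂ w * starRingEnd ℂ d = 0 := by
    by_cases h0 : d = 0
    · exact ⟨1, by simp, by simp [h0]⟩
    · have hn : (‖d‖ : ℂ) ≠ 0 := by simpa using h0
      have hdd : starRingEnd ℂ d * d = (‖d‖ : ℂ) ^ 2 := Complex.conj_mul' d
      refine ⟨Complex.I * starRingEnd ℂ d / ‖d‖, ?_, ?_⟩
      · simp only [map_div₀, map_mul, Complex.conj_I, Complex.conj_conj, Complex.conj_ofReal]
        field_simp
        linear_combination (-Complex.I ^ 2) * hdd - (‖d‖ : ℂ) ^ 2 * Complex.I_sq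
      · simp only [map_div₀, map_mul, Complex.conj_I, Complex.conj_conj, Complex.conj_ofReal]
        field_simp
        ring
  have hz : star ((t : ℂ) • q + w • x) * ((t : ℂ) • q + w • x) = 0 := by
    have h1 : star ((t : ℂ) • q + w • x) * ((t : ℂ) • q + w • x) =
        ((t : ℂ) * t) • (q * q) + ((t : ℂ) * w) • (q * x) + (starRingEnd ℂ w * t) • (star x * q) +
          (starRingEnd ℂ w * w) • (star x * x) := by
      simp only [star_add, star_smul, hq, Complex.star_def, Complex.conj_ofReal, add_mul, mul_add,
        smul_mul_smul_comm]
      abel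
    rw [h1, hqq, hd, hd', hc, hw, smul_smul, smul_smul, one_smul, ← add_smul, ← add_smul,
      ← add_smul]
    have : (t : ℂ) * t + t * w * d + starRingEnd ℂ w * t * starRingEnd ℂ d + (r : ℂ) = 0 := by
      have ht' : (t : ℂ) * t = -r := by exact_mod_cast ht
      linear_combination ht' + (t : ℂ) * hwd
    rw [this, zero_smul]
  have hz0 := hA _ hz
  have hx' : x = (-(starRingEnd ℂ w * t)) • q := by
    have := congrArg (starRingEnd ℂ w • ·) hz0
    simp only [smul_add, smul_smul, hw, one_smul, smul_zero] at this
    rw [neg_smul]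
    exact eq_neg_of_add_eq_zero_right this
  have h2 : star x * x = (-(r : ℂ)) • q := by
    have ht' : (t : ℂ) * t = -r := by exact_mod_cast ht
    rw [hx']
    simp only [star_smul, hq, smul_mul_smul_comm, hqq]
    congr 1
    simp only [Complex.star_def, map_neg, map_mul, Complex.conj_conj, Complex.conj_ofReal]
    linear_combination (starRingEnd ℂ w * w) * ht' - (r : ℂ) * hw
  rw [hc] at h2
  have h3 : (r : ℂ) = -r := smul_left_injective ℂ hq0 h2
  have h4 : r = -r := by exact_mod_cast h3
  linarith

/-- A positive functional is enlarged until its left kernel vanishes. A minimal left ideal in the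
kernel contains a projection `q` with `qAq = ℂq`. Adding the functional `x ↦ c`, where `qxq = cq`,
keeps positivity and removes `q` from the kernel; descent ends because `A` is Artinian. -/
theorem exists_isFaithful (hA : ∀ x : A, star x * x = 0 → x = 0) :
    ∃ f : A →ₗ[ℂ] ℂ, IsFaithful f := by
  have : IsArtinian A A := isArtinian_of_tower ℂ inferInstance
  suffices ∀ (N : Submodule A A) (f : A →ₗ[ℂ] ℂ), IsPositiveFunctional f → leftKernel f = N →
      ∃ f : A →ₗ[ℂ] ℂ, IsFaithful f from this _ 0 (fun a => by simp) rfl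
  intro N
  induction N using WellFoundedLT.induction with
  | ind N ih =>
  rintro f hf rfl
  by_cases hN : leftKernel f = ⊥
  · refine ⟨f, fun a ha => lt_of_le_of_ne (hf a) fun h => ha ?_⟩
    rw [← Submodule.mem_bot A, ← hN]
    exact hf.eq_zero_of_self h.symm
  · obtain ⟨J, hJ, hJN⟩ := (IsAtomic.eq_bot_or_exists_atom_le (leftKernel f)).resolve_left hN
    obtain ⟨q, hqJ, hq0, hq, hqq, hqh⟩ := exists_projection_of_isAtom hA hJ
    obtain ⟨l, hl⟩ : ∃ l : Module.Dual ℂ A, l q = 1 := by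
      obtain ⟨l, hl⟩ := not_forall.1 (mt (Module.forall_dual_apply_eq_zero_iff ℂ q).1 hq0)
      exact ⟨(l q)⁻¹ • l, by simp [hl]⟩
    let φ : A →ₗ[ℂ] ℂ := l ∘ₗ LinearMap.mulRight ℂ q ∘ₗ LinearMap.mulLeft ℂ q
    have hφ : IsPositiveFunctional φ := by
      intro x
      obtain ⟨c, hc⟩ := hqh (star x * x)
      have : φ (star x * x) = c := by
        change l (q * (star x * x) * q) = c
        rw [hc, map_smul, hl, smul_eq_mul, mul_one]
      rw [this]
      refine nonneg_of_star_mul_self_eq_smul hA hq0 hq hqq hqh (x := x * q) ?_ ?_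
      · rw [mul_assoc, hqq]
      · rw [← hc, star_mul, hq]
        simp only [mul_assoc]
    have hg : IsPositiveFunctional (f + φ) := fun a => add_nonneg (hf a) (hφ a)
    refine ih _ ?_ (f + φ) hg rfl
    refine lt_of_le_of_ne (fun x hx => ?_) fun h => ?_
    · refine hf.eq_zero_of_self ?_
      have h1 : f (star x * x) + φ (star x * x) = 0 := hx (star x)
      exact le_antisymm (h1 ▸ le_add_of_nonneg_right (hφ x)) (hf x)
    · have h1 : q ∈ leftKernel (f + φ) := by rw [h]; exact hJN hqJ
      have h2 : f (1 * q) + φ (1 * q) = 0 := h1 1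
      rw [hJN hqJ, zero_add, one_mul] at h2
      have h3 : φ q = 1 := by
        change l (q * q * q) = 1
        rw [hqq, hqq, hl]
      rw [h3] at h2
      exact one_ne_zero h2

variable (A) in
/-- The trace of the left regular representation. -/
def regularTrace : A →ₗ[ℂ] ℂ := LinearMap.trace ℂ A ∘ₗ (Algebra.lmul ℂ A).toLinearMap

theorem regularTrace_mul_comm (a b : A) : regularTrace A (a * b) = regularTrace A (b * a) := by
  simp only [regularTrace, LinearMap.comp_apply, AlgHom.toLinearMap_apply, map_mul]
  exact LinearMap.trace_mul_comm _ _ _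

/-- In a basis orthonormal for a faithful `f`, the trace of left multiplication by `a* a` is `Σ f((a
e_i)*(a e_i))`; if it vanishes, `a` annihilates a basis. -/
theorem isFaithful_regularTrace (hA : ∀ x : A, star x * x = 0 → x = 0) :
    IsFaithful (regularTrace A) := by
  obtain ⟨f, hf⟩ := exists_isFaithful hA
  obtain ⟨n, e, -, he, htr⟩ := hf.exists_orthonormal
  have h1 : ∀ a, regularTrace A (star a * a) = ∑ i, f (star (a * e i) * (a * e i)) := by
    intro a
    refine (htr _).trans (Finset.sum_congr rfl fun i _ => ?_)
    simp [mul_assoc]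
  intro a ha
  rw [h1]
  refine lt_of_le_of_ne (Finset.sum_nonneg fun i _ => hf.isPositive _) fun h => ha ?_
  have h2 := (Finset.sum_eq_zero_iff_of_nonneg fun i _ => hf.isPositive _).1 h.symm
  rw [← mul_one a, ← he 1, Finset.mul_sum]
  refine Finset.sum_eq_zero fun i hi => ?_
  rw [mul_smul_comm, hf.eq_zero (h2 i hi), smul_zero]

end StarAlgebra

open ComplexOrder Polynomial

/-! ### Tensor products of functionals and positive definite elements. -/

section Functionals

variable {A : Type*} [Ring A] [Algebra ℂ A] [StarRing A] [StarModule ℂ A] [FiniteDimensional ℂ A]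
  {B : Type*} [Ring B] [Algebra ℂ B] [StarRing B] [StarModule ℂ B]

/-- The functional `f ⊗ g`. -/
def tensorFunctional (f : A →ₗ[ℂ] ℂ) (g : B →ₗ[ℂ] ℂ) : A ⊗[ℂ] B →ₗ[ℂ] ℂ :=
  LinearMap.mul' ℂ ℂ ∘ₗ TensorProduct.map f g

omit [StarRing A] [StarModule ℂ A] [FiniteDimensional ℂ A] [StarRing B] [StarModule ℂ B] in
@[simp]
theorem tensorFunctional_tmul (f : A →ₗ[ℂ] ℂ) (g : B →ₗ[ℂ] ℂ) (a : A) (b : B) :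
    tensorFunctional f g (a ⊗ₜ b) = f a * g b := rfl

/-- Expanding the first factor in an `f`-orthonormal basis diagonalises the form, so positivity and
faithfulness of `f ⊗ g` reduce to those of `g`. -/
theorem IsFaithful.exists_tensor_eq_sum {f : A →ₗ[ℂ] ℂ} (hf : IsFaithful f) (x : A ⊗[ℂ] B) :
    ∃ (n : ℕ) (e : Fin n → A) (y : Fin n → B), x = ∑ i, e i ⊗ₜ y i ∧
      ∀ g : B →ₗ[ℂ] ℂ, tensorFunctional f g (star x * x) = ∑ i, g (star (y i) * y i) := by
  obtain ⟨n, e, he, hs, -⟩ := hf.exists_orthonormal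
  let y : A ⊗[ℂ] B → Fin n → B := fun x i =>
    TensorProduct.lid ℂ B ((f ∘ₗ LinearMap.mulLeft ℂ (star (e i))).rTensor B x)
  have hx : x = ∑ i, e i ⊗ₜ y x i := by
    induction x with
    | zero => simp [y]
    | add a b ha hb =>
      conv_lhs => rw [ha, hb]
      simp [y, ← Finset.sum_add_distrib, TensorProduct.tmul_add]
    | tmul a b =>
      conv_lhs => rw [← hs a]
      simp [y, TensorProduct.sum_tmul, TensorProduct.smul_tmul]
  refine ⟨n, e, y x, hx, fun g => ?_⟩
  generalize y x = y at hx
  rw [hx, star_sum, Finset.sum_mul_sum, map_sum]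
  refine Finset.sum_congr rfl fun i _ => ?_
  simp [he]

theorem IsFaithful.tensor_isPositive {f : A →ₗ[ℂ] ℂ} (hf : IsFaithful f) {g : B →ₗ[ℂ] ℂ}
    (hg : IsPositiveFunctional g) : IsPositiveFunctional (tensorFunctional f g) := by
  intro x
  obtain ⟨n, e, y, -, h⟩ := hf.exists_tensor_eq_sum x
  rw [h]
  exact Finset.sum_nonneg fun i _ => hg _

theorem IsFaithful.tensor_isFaithful {f : A →ₗ[ℂ] ℂ} (hf : IsFaithful f) {g : B →ₗ[ℂ] ℂ}
    (hg : IsFaithful g) : IsFaithful (tensorFunctional f g) := by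
  intro x hx
  obtain ⟨n, e, y, hxy, h⟩ := hf.exists_tensor_eq_sum x
  rw [h]
  refine lt_of_le_of_ne (Finset.sum_nonneg fun i _ => hg.isPositive _) fun h0 => hx ?_
  have h2 := (Finset.sum_eq_zero_iff_of_nonneg fun i _ => hg.isPositive _).1 h0.symm
  rw [hxy]
  exact Finset.sum_eq_zero fun i hi => by rw [hg.eq_zero (h2 i hi), TensorProduct.tmul_zero]

/-- Positive definite elements with respect to a functional. -/
def IsPosDef (f : A →ₗ[ℂ] ℂ) (x : A) : Prop := ∀ b, b ≠ 0 → 0 < f (star b * (x * b))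

omit [StarModule ℂ A] [FiniteDimensional ℂ A] in
theorem IsPosDef.nonneg {f : A →ₗ[ℂ] ℂ} {x : A} (hx : IsPosDef f x) (b : A) :
    0 ≤ f (star b * (x * b)) := by
  by_cases h : b = 0
  · simp [h]
  · exact (hx b h).le

omit [StarRing A] [StarModule ℂ A] in
theorem isUnit_of_injective {x : A} (hx : ∀ b, x * b = 0 → b = 0) : IsUnit x := by
  have h1 : Function.Injective (LinearMap.mulLeft ℂ x) :=
    (injective_iff_map_eq_zero _).2 hx
  obtain ⟨b, hb⟩ := (LinearMap.injective_iff_surjective.1 h1) 1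
  have hb' : x * b = 1 := hb
  have hb2 : b * x = 1 := sub_eq_zero.1 (hx _ (by rw [mul_sub, ← mul_assoc, hb']; simp))
  exact ⟨⟨x, b, hb', hb2⟩, rfl⟩

omit [StarModule ℂ A] in
theorem IsPosDef.isUnit {f : A →ₗ[ℂ] ℂ} {x : A} (hx : IsPosDef f x) : IsUnit x :=
  isUnit_of_injective fun b hb => by
    by_contra h
    have := hx b h
    rw [hb] at this
    simp at this

/-- Being a polynomial in `x`, the root commutes with whatever commutes with `x` and lies in every
subalgebra containing `x`. This keeps later roots in the centre or in `H_t`. -/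
theorem IsPosDef.exists_root {f : A →ₗ[ℂ] ℂ} (hf : IsFaithful f) {x : A} (hx : IsPosDef f x) :
    ∃ t : A, star t = t ∧ t ^ 4 = x ∧ IsUnit t ∧ (∀ b, b * x = x * b → b * t = t * b) ∧
      ∀ K : Subalgebra ℂ A, x ∈ K → t ∈ K := by
  obtain ⟨p, hp, hp'⟩ := hf.exists_root hx.nonneg
  refine ⟨_, hp, hp', ?_, fun b hb => ?_, fun K hK => ?_⟩
  · exact (isUnit_pow_iff (n := 4) (by norm_num)).1 (by rw [hp']; exact hx.isUnit)
  · have : Commute b x := hb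
    exact (Algebra.commute_of_mem_adjoin_singleton_of_commute
      (aeval_mem_adjoin_singleton ℂ x) this).eq
  · exact Algebra.adjoin_le (Set.singleton_subset_iff.2 hK) (aeval_mem_adjoin_singleton ℂ x)

omit [StarModule ℂ A] [FiniteDimensional ℂ A] in
theorem isPosDef_star_mul_self {f : A →ₗ[ℂ] ℂ} (hf : IsFaithful f) {a : A} (ha : IsUnit a) :
    IsPosDef f (star a * a) := by
  intro b hb
  rw [show star b * (star a * a * b) = star (a * b) * (a * b) by simp [mul_assoc]]
  exact hf _ fun h => hb (ha.mul_right_eq_zero.1 h)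

end Functionals

/-! ### Casimir elements. -/

section Casimir

variable {A : Type*} [Ring A] [Algebra ℂ A] [StarRing A] [StarModule ℂ A] [FiniteDimensional ℂ A]

/-- The elements `∑ eᵢ x eᵢ*`, for an orthonormal basis `(eᵢ)` with respect to a faithful positive
trace. -/
theorem exists_casimir {τ : A →ₗ[ℂ] ℂ} (hτ : IsFaithful τ) (hc : ∀ a b, τ (a * b) = τ (b * a)) :
    ∃ (n : ℕ) (e : Fin n → A), (∀ x h, h * ∑ i, e i * x * star (e i) =
        (∑ i, e i * x * star (e i)) * h) ∧
      (∀ h, h * ∑ i, star (e i) * e i = (∑ i, star (e i) * e i) * h) ∧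
      IsPosDef τ (∑ i, star (e i) * e i) ∧
      ∀ b, (∀ i, star (e i) * b = 0) → b = 0 := by
  obtain ⟨n, e, -, he, -⟩ := hτ.exists_orthonormal
  have he' : ∀ a, ∑ i, τ (a * e i) • star (e i) = a := by
    intro a
    have := congrArg star (he (star a))
    rw [star_sum, star_star] at this
    refine Eq.trans (Finset.sum_congr rfl fun i _ => ?_) this
    rw [star_smul, ← star_mul, hτ.isPositive.map_star]
    simp
  refine ⟨n, e, fun x h => ?_, fun h => ?_, fun b hb => ?_, fun b hb => ?_⟩
  · rw [Finset.mul_sum, Finset.sum_mul]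
    -- Expanding `h e_i` in the `e_j`, and `e_j* h` in the `e_i*`, produces the same coefficients
    -- `τ(e_j* h e_i)`.
    have h1 : ∀ i, h * (e i * x * star (e i)) =
        ∑ j, τ (star (e j) * h * e i) • (e j * x * star (e i)) := by
      intro i
      conv_lhs => rw [← mul_assoc, ← mul_assoc, ← he (h * e i)]
      simp [Finset.sum_mul, mul_assoc]
    have h2 : ∀ j, e j * x * star (e j) * h =
        ∑ i, τ (star (e j) * h * e i) • (e j * x * star (e i)) := by
      intro j
      conv_lhs => rw [mul_assoc, ← he' (star (e j) * h)]
      simp [Finset.mul_sum, mul_assoc]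
    simp only [h1, h2]
    exact Finset.sum_comm
  · rw [Finset.mul_sum, Finset.sum_mul]
    have h1 : ∀ j, h * (star (e j) * e j) = ∑ i, τ (h * star (e j) * e i) • (star (e i) * e j) := by
      intro j
      conv_lhs => rw [← mul_assoc, ← he' (h * star (e j))]
      simp [Finset.sum_mul]
    have h2 : ∀ i, star (e i) * e i * h =
        ∑ j, τ (h * star (e j) * e i) • (star (e i) * e j) := by
      intro i
      conv_lhs => rw [mul_assoc, ← he (e i * h)]
      rw [Finset.mul_sum]
      refine Finset.sum_congr rfl fun j _ => ?_
      rw [mul_smul_comm, ← mul_assoc, hc, mul_assoc]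
    simp only [h1, h2]
    exact Finset.sum_comm
  · have h1 : τ (star b * ((∑ i, star (e i) * e i) * b)) = ∑ i, τ (star (e i * b) * (e i * b)) := by
      simp [Finset.sum_mul, Finset.mul_sum, mul_assoc]
    rw [h1]
    refine lt_of_le_of_ne (Finset.sum_nonneg fun i _ => hτ.isPositive _) fun h => hb ?_
    have h2 := (Finset.sum_eq_zero_iff_of_nonneg fun i _ => hτ.isPositive _).1 h.symm
    rw [← one_mul b, ← he 1, Finset.sum_mul]
    refine Finset.sum_eq_zero fun i hi => ?_
    rw [smul_mul_assoc, hτ.eq_zero (h2 i hi), smul_zero]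
  · rw [← one_mul b, ← he' 1, Finset.sum_mul]
    refine Finset.sum_eq_zero fun i hi => ?_
    rw [smul_mul_assoc, hb, smul_zero]

end Casimir

/-! ### The inverse of the `R`-matrix and its invariance under `S ⊗ S`. -/

section RMatrix

variable {H : Type u} [Ring H] [Algebra ℂ H] [Coalgebra ℂ H] [StarRing H] [StarModule ℂ H]
  [CStarQuantumGroupoid H]

local notation "Δ₁" => comulOne ℂ H
local notation "T" => antipodeInv (H := H)

theorem comm_mul (x y : H ⊗[ℂ] H) : TensorProduct.comm ℂ H H (x * y) =
    TensorProduct.comm ℂ H H x * TensorProduct.comm ℂ H H y :=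
  map_mul (Algebra.TensorProduct.comm ℂ H H) x y

theorem comulOp_apply (h : H) : comulOp ℂ H h = TensorProduct.comm ℂ H H (Δ h) := rfl

theorem comulOp_map_mul (x y : H) : comulOp ℂ H (x * y) = comulOp ℂ H x * comulOp ℂ H y := by
  simp only [comulOp_apply, comul_mul, comm_mul]

theorem comulOp_one : comulOp ℂ H 1 = TensorProduct.comm ℂ H H Δ₁ := rfl

theorem sum_comulOp_one {ι : Type*} (r : Repr ℂ (1 : H) ι) :
    comulOp ℂ H 1 = ∑ i ∈ r.index, r.right i ⊗ₜ[ℂ] r.left i := by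
  rw [comulOp_one, ← sum_comulOne r, map_sum]; simp

/-- The image of a representation of `Δ(1)` under the involution. -/
def reprStarOne {ι : Type*} (r : Repr ℂ (1 : H) ι) : Repr ℂ (1 : H) ι where
  index := r.index
  left i := star (r.left i)
  right i := star (r.right i)
  eq := (reprStar r).eq.trans (by rw [star_one])

/-- `T(h₍₂₎) h₍₁₎ = ε(h 1₍₁₎) 1₍₂₎`. -/
theorem mul'_antipodeInv_comul {ι : Type*} (r : Repr ℂ (1 : H) ι) (h : H) :
    LinearMap.mul' ℂ H (TensorProduct.comm ℂ H H ((T).lTensor H (Δ h))) =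
      ∑ i ∈ r.index, ε (h * r.left i) • r.right i := by
  let s := ℛ ℂ h
  have h1 := congrArg star (sum_left_mul_antipode (reprStar s))
  rw [targetMap_eq_sum (reprStarOne r), star_sum, star_sum] at h1
  have h2 : ∀ i, ε ((reprStarOne r).left i * star h) = starRingEnd ℂ (ε (h * r.left i)) := by
    intro i
    rw [← counit_star, star_mul]
    rfl
  rw [← s.eq]
  simp only [h2, star_smul, star_mul] at h1
  simpa [reprStar, reprStarOne, star_antipode] using h1

variable {R : H ⊗[ℂ] H} (hR : IsQuasitriangular R)

include hR

theorem IsQuasitriangular.comulOp_one_mul : comulOp ℂ H 1 * R = R := by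
  obtain ⟨X, hX⟩ := hR.mem
  rw [hX, ← mul_assoc, ← mul_assoc, ← comulOp_map_mul, one_mul]

theorem IsQuasitriangular.mul_comulOne : R * Δ₁ = R := by
  obtain ⟨X, hX⟩ := hR.mem
  rw [hX, mul_assoc, comulOne_mul_self]

/-- In `Δ^op(z) R = R Δ(z)` write `Δ(z)` as `(1 ⊗ z)Δ(1)` on the left and as `Δ(1)(1 ⊗ z)` on the
right; `R` absorbs both copies of `Δ(1)`. -/
theorem IsQuasitriangular.source_mul {z : H} (hz : z ∈ sourceSpace H) :
    (z ⊗ₜ 1) * R = R * (1 ⊗ₜ z) := by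
  have h := hR.comulOp_mul z
  rwa [comulOp_apply, comul_of_mem_source hz, comm_mul, mul_assoc, ← comulOp_one,
    hR.comulOp_one_mul, ← comul_of_mem_source hz, comul_of_mem_source' hz, ← mul_assoc,
    hR.mul_comulOne, TensorProduct.comm_tmul] at h

theorem IsQuasitriangular.target_mul {z : H} (hz : z ∈ targetSpace H) :
    (1 ⊗ₜ z) * R = R * (z ⊗ₜ 1) := by
  have h := hR.comulOp_mul z
  rwa [comulOp_apply, comul_of_mem_target' hz, comm_mul, mul_assoc, ← comulOp_one,
    hR.comulOp_one_mul, ← comul_of_mem_target' hz, comul_of_mem_target hz, ← mul_assoc,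
    hR.mul_comulOne, TensorProduct.comm_tmul] at h

/-- The counit on the first leg of `(Δ ⊗ id)R = R₁₃R₂₃` gives `R = (1 ⊗ e)R` with `e = (ε ⊗ id)R`.
Multiplying by `R̄` leaves `Δ^op(1) = (1 ⊗ e)Δ^op(1)`, and the counit once more gives `e = 1`. -/
theorem IsQuasitriangular.lid_counit :
    TensorProduct.lid ℂ H ((counit (R := ℂ) (A := H)).rTensor H R) = 1 := by
  obtain ⟨Rb, -, hb, -⟩ := hR.inv
  let e : H ⊗[ℂ] H →ₗ[ℂ] H :=
    (TensorProduct.lid ℂ H).toLinearMap ∘ₗ (counit (R := ℂ) (A := H)).rTensor H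
  let E : H ⊗[ℂ] (H ⊗[ℂ] H) →ₗ[ℂ] H ⊗[ℂ] H :=
    (TensorProduct.lid ℂ _).toLinearMap ∘ₗ (counit (R := ℂ) (A := H)).rTensor _
  have h1 := congrArg E hR.comulId
  have h2 : ∀ t, E (QGroupoid.comulId ℂ H t) = t := by
    intro t
    induction t with
    | zero => simp
    | add a b ha hb => simp only [map_add, ha, hb]
    | tmul a b =>
      have : ∀ X : H ⊗[ℂ] H, E ((TensorProduct.assoc ℂ H H H) (X ⊗ₜ b)) = e X ⊗ₜ b := by
        intro X
        induction X with
        | zero => simp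
        | add c d hc hd => simp only [map_add, hc, hd, TensorProduct.add_tmul]
        | tmul c d => simp [E, e, TensorProduct.smul_tmul']
      exact (this _).trans (congrArg (· ⊗ₜ b) (lid_counit_comul a))
  have h3 : ∀ x y : H ⊗[ℂ] H, E (leg13 x * leg23 y) = (1 ⊗ₜ e x) * y := by
    intro x y
    induction x with
    | zero => simp
    | add a b ha hb => simp only [map_add, ha, hb, add_mul, TensorProduct.tmul_add]
    | tmul a b => simp [E, e, leg13, leg23]
  rw [h2, h3] at h1
  have h4 := congrArg (· * Rb) h1
  simp only [mul_assoc, hb] at h4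
  have h5 : ∀ X : H ⊗[ℂ] H, e ((1 ⊗ₜ e R) * X) = e R * e X := by
    intro X
    induction X with
    | zero => simp
    | add a b ha hb => simp only [map_add, ha, hb, mul_add]
    | tmul a b => simp [e]
  have h6 : e (comulOp ℂ H 1) = 1 := by
    have : ∀ X : H ⊗[ℂ] H, e (TensorProduct.comm ℂ H H X) =
        TensorProduct.rid ℂ H ((counit (R := ℂ) (A := H)).lTensor H X) := by
      intro X
      induction X with
      | zero => simp
      | add a b ha hb => simp only [map_add, ha, hb]
      | tmul a b => simp [e]
    exact (this _).trans (rid_counit_comul 1)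
  have h7 := congrArg e h4
  rw [h5, h6, mul_one] at h7
  exact h7.symm

theorem IsQuasitriangular.rid_counit :
    TensorProduct.rid ℂ H ((counit (R := ℂ) (A := H)).lTensor H R) = 1 := by
  obtain ⟨Rb, -, hb, -⟩ := hR.inv
  let e : H ⊗[ℂ] H →ₗ[ℂ] H :=
    (TensorProduct.rid ℂ H).toLinearMap ∘ₗ (counit (R := ℂ) (A := H)).lTensor H
  have h1 := congrArg (e.lTensor H) hR.idComul
  have h2 : ∀ t, e.lTensor H (QGroupoid.idComul ℂ H t) = t := by
    intro t
    induction t with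
    | zero => simp
    | add a b ha hb => simp only [map_add, ha, hb]
    | tmul a b => exact congrArg (a ⊗ₜ ·) (rid_counit_comul b)
  have h3 : ∀ x y : H ⊗[ℂ] H, e.lTensor H (leg13 x * leg12 y) = (e x ⊗ₜ 1) * y := by
    intro x y
    induction x with
    | zero => simp
    | add a b ha hb => simp only [map_add, ha, hb, add_mul, TensorProduct.add_tmul]
    | tmul a b =>
      induction y with
      | zero => simp
      | add a b ha hb => simp only [map_add, ha, hb, mul_add]
      | tmul c d => simp [e, leg13, leg12, TensorProduct.smul_tmul']
  rw [h2, h3] at h1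
  have h4 := congrArg (· * Rb) h1
  simp only [mul_assoc, hb] at h4
  have h5 : ∀ X : H ⊗[ℂ] H, e ((e R ⊗ₜ 1) * X) = e R * e X := by
    intro X
    induction X with
    | zero => simp
    | add a b ha hb => simp only [map_add, ha, hb, mul_add]
    | tmul a b => simp [e]
  have h6 : e (comulOp ℂ H 1) = 1 := by
    have : ∀ X : H ⊗[ℂ] H, e (TensorProduct.comm ℂ H H X) =
        TensorProduct.lid ℂ H ((counit (R := ℂ) (A := H)).rTensor H X) := by
      intro X
      induction X with
      | zero => simp
      | add a b ha hb => simp only [map_add, ha, hb]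
      | tmul a b => simp [e]
    exact (this _).trans (lid_counit_comul 1)
  have h7 := congrArg e h4
  rw [h5, h6, mul_one] at h7
  exact h7.symm

/-- Expand `ε_t` through a `Δ(1)` with first legs in `H_s`. These pass through `R` to its second
leg, after which the counit reduces `R` to `1`. -/
theorem IsQuasitriangular.rTensor_targetMap : (targetMap ℂ).rTensor H R = comulOp ℂ H 1 := by
  obtain ⟨r, hr, -⟩ := exists_repr_one (H := H)
  let e : H ⊗[ℂ] H →ₗ[ℂ] H :=
    (TensorProduct.lid ℂ H).toLinearMap ∘ₗ (counit (R := ℂ) (A := H)).rTensor H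
  have h1 : ∀ X : H ⊗[ℂ] H, (targetMap ℂ).rTensor H X =
      ∑ i ∈ r.index, r.right i ⊗ₜ e ((r.left i ⊗ₜ 1) * X) := by
    intro X
    induction X with
    | zero => simp
    | add a b ha hb =>
      simp only [map_add, ha, hb, mul_add, TensorProduct.tmul_add, Finset.sum_add_distrib]
    | tmul a b =>
      simp [e, targetMap_eq_sum r, TensorProduct.sum_tmul, TensorProduct.smul_tmul]
  have h2 : ∀ (y : H) (X : H ⊗[ℂ] H), e (X * (1 ⊗ₜ y)) = e X * y := by
    intro y X
    induction X with
    | zero => simp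
    | add a b ha hb => simp only [map_add, ha, hb, add_mul]
    | tmul a b => simp [e]
  rw [h1, sum_comulOp_one r]
  refine Finset.sum_congr rfl fun i _ => ?_
  rw [hR.source_mul (hr i), h2]
  exact congrArg _ ((congrArg (· * _) hR.lid_counit).trans (one_mul _))

/-- Apply `a ⊗ b ↦ a S(b)` to the first two legs of `(Δ ⊗ id)R = R₁₃R₂₃`; the left side becomes
`(ε_t ⊗ id)R`. -/
theorem IsQuasitriangular.mul_rTensor_antipode :
    R * (S ℂ (H := H)).rTensor H R = comulOp ℂ H 1 := by
  let M : H ⊗[ℂ] (H ⊗[ℂ] H) →ₗ[ℂ] H ⊗[ℂ] H :=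
    (LinearMap.mul' ℂ H ∘ₗ (S ℂ (H := H)).lTensor H).rTensor H ∘ₗ
      (TensorProduct.assoc ℂ H H H).symm.toLinearMap
  have h1 := congrArg M hR.comulId
  have h2 : ∀ t, M (QGroupoid.comulId ℂ H t) = (targetMap ℂ).rTensor H t := by
    intro t
    induction t with
    | zero => simp
    | add a b ha hb => simp only [map_add, ha, hb]
    | tmul a b => simp [M, QGroupoid.comulId, QuantumGroupoid.mul_antipode]
  have h3 : ∀ x y : H ⊗[ℂ] H, M (leg13 x * leg23 y) = x * (S ℂ (H := H)).rTensor H y := by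
    intro x y
    induction x with
    | zero => simp
    | add a b ha hb => simp only [map_add, ha, hb, add_mul]
    | tmul a b =>
      induction y with
      | zero => simp
      | add a b ha hb => simp only [map_add, ha, hb, mul_add]
      | tmul c d => simp [M, leg13, leg23]
  rw [h2, h3, hR.rTensor_targetMap] at h1
  exact h1.symm

/-- Apply `a ⊗ b ↦ S⁻¹(b) a` to the last two legs of `(id ⊗ Δ)R = R₁₃R₁₂`. The outcome is a left
inverse, where the preceding argument gave a right one. -/
theorem IsQuasitriangular.lTensor_antipodeInv_mul : (T).lTensor H R * R = Δ₁ := by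
  let m : H ⊗[ℂ] H →ₗ[ℂ] H :=
    LinearMap.mul' ℂ H ∘ₗ (TensorProduct.comm ℂ H H).toLinearMap ∘ₗ (T).lTensor H
  have h1 := congrArg (m.lTensor H) hR.idComul
  obtain ⟨r, hr, -⟩ := exists_repr_one (H := H)
  let e : H ⊗[ℂ] H →ₗ[ℂ] H :=
    (TensorProduct.rid ℂ H).toLinearMap ∘ₗ (counit (R := ℂ) (A := H)).lTensor H
  have h2 : ∀ X, m.lTensor H (QGroupoid.idComul ℂ H X) =
      ∑ i ∈ r.index, e (X * (1 ⊗ₜ r.left i)) ⊗ₜ r.right i := by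
    intro X
    induction X with
    | zero => simp
    | add a b ha hb =>
      simp only [map_add, ha, hb, add_mul, TensorProduct.add_tmul, Finset.sum_add_distrib]
    | tmul a b =>
      refine (congrArg (a ⊗ₜ ·) (mul'_antipodeInv_comul r b)).trans ?_
      simp [e, TensorProduct.tmul_sum, TensorProduct.smul_tmul]
  have h3 : ∀ x y : H ⊗[ℂ] H, m.lTensor H (leg13 x * leg12 y) = (T).lTensor H x * y := by
    intro x y
    induction x with
    | zero => simp
    | add a b ha hb => simp only [map_add, ha, hb, add_mul]
    | tmul a b =>
      induction y with
      | zero => simp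
      | add a b ha hb => simp only [map_add, ha, hb, mul_add]
      | tmul c d => simp [m, leg13, leg12]
  have h4 : ∀ (y : H) (X : H ⊗[ℂ] H), e ((y ⊗ₜ 1) * X) = y * e X := by
    intro y X
    induction X with
    | zero => simp
    | add a b ha hb => simp only [map_add, ha, hb, mul_add]
    | tmul a b => simp [e]
  rw [h2, h3] at h1
  rw [← h1, ← sum_comulOne r]
  refine Finset.sum_congr rfl fun i _ => ?_
  rw [← hR.source_mul (hr i), h4]
  exact congrArg (· ⊗ₜ _) ((congrArg (_ * ·) hR.rid_counit).trans (mul_one _))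

/-- `1₍₂₎` passes through `R` into the first leg, where `S` turns it into `S(1₍₂₎)` standing next to
`1₍₁₎`. -/
theorem IsQuasitriangular.comulOne_mul_rTensor_antipode :
    Δ₁ * (S ℂ (H := H)).rTensor H R = (S ℂ (H := H)).rTensor H R := by
  obtain ⟨r, -, hr⟩ := exists_repr_one (H := H)
  have h1 : ∀ (q : H) (X : H ⊗[ℂ] H), (1 ⊗ₜ q) * (S ℂ (H := H)).rTensor H X =
      (S ℂ (H := H)).rTensor H ((1 ⊗ₜ q) * X) := by
    intro q X
    induction X with
    | zero => simp
    | add a b ha hb => simp only [map_add, ha, hb, mul_add]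
    | tmul a b => simp
  have h2 : ∀ (q : H) (X : H ⊗[ℂ] H), (S ℂ (H := H)).rTensor H (X * (q ⊗ₜ 1)) =
      (S ℂ q ⊗ₜ 1) * (S ℂ (H := H)).rTensor H X := by
    intro q X
    induction X with
    | zero => simp
    | add a b ha hb => simp only [map_add, ha, hb, add_mul, mul_add]
    | tmul a b => simp [antipode_mul]
  have h3 : ∀ i, (r.left i ⊗ₜ r.right i) * (S ℂ (H := H)).rTensor H R =
      ((r.left i * S ℂ (r.right i)) ⊗ₜ 1) * (S ℂ (H := H)).rTensor H R := by
    intro i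
    rw [show (r.left i ⊗ₜ[ℂ] r.right i) = (r.left i ⊗ₜ 1) * (1 ⊗ₜ r.right i) by simp, mul_assoc, h1,
      hR.target_mul (hr i), h2, ← mul_assoc]
    simp
  rw [← sum_comulOne r, Finset.sum_mul, Finset.sum_congr rfl fun i _ => h3 i, ← Finset.sum_mul,
    ← TensorProduct.sum_tmul, sum_left_mul_antipode, targetMap_one,
    ← Algebra.TensorProduct.one_def, one_mul]

theorem IsQuasitriangular.lTensor_antipodeInv_mul_comulOp :
    (T).lTensor H R * comulOp ℂ H 1 = (T).lTensor H R := by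
  obtain ⟨r, -, hr⟩ := exists_repr_one (H := H)
  have h1 : ∀ (q : H) (X : H ⊗[ℂ] H), (T).lTensor H X * (q ⊗ₜ 1) =
      (T).lTensor H (X * (q ⊗ₜ 1)) := by
    intro q X
    induction X with
    | zero => simp
    | add a b ha hb => simp only [map_add, ha, hb, add_mul]
    | tmul a b => simp
  have h2 : ∀ (q : H) (X : H ⊗[ℂ] H), (T).lTensor H ((1 ⊗ₜ q) * X) =
      (T).lTensor H X * (1 ⊗ₜ T q) := by
    intro q X
    induction X with
    | zero => simp
    | add a b ha hb => simp only [map_add, ha, hb, add_mul, mul_add]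
    | tmul a b => simp [antipodeInv_mul]
  have h3 : ∀ i, (T).lTensor H R * (r.right i ⊗ₜ r.left i) =
      (T).lTensor H R * (1 ⊗ₜ (T (r.right i) * r.left i)) := by
    intro i
    rw [show (r.right i ⊗ₜ[ℂ] r.left i) = (r.right i ⊗ₜ 1) * (1 ⊗ₜ r.left i) by simp, ← mul_assoc,
      h1, ← hR.target_mul (hr i), h2, mul_assoc]
    simp
  rw [sum_comulOp_one r, Finset.mul_sum, Finset.sum_congr rfl fun i _ => h3 i, ← Finset.mul_sum,
    ← TensorProduct.tmul_sum, sum_one_antipodeInv_mul, ← Algebra.TensorProduct.one_def, mul_one]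

theorem IsQuasitriangular.rTensor_antipode_mul : (S ℂ (H := H)).rTensor H R * R = Δ₁ := by
  obtain ⟨Rb, ⟨X, hX⟩, hb, hb'⟩ := hR.inv
  have : Rb = (S ℂ (H := H)).rTensor H R := by
    rw [← hR.comulOne_mul_rTensor_antipode, ← hb', mul_assoc, hR.mul_rTensor_antipode, hX,
      mul_assoc, mul_assoc, mul_assoc, ← comulOp_map_mul, one_mul]
  rw [← this, hb']

/-- A left inverse and a right inverse of `R` in the same corner coincide. Invariance of `R` under
`S ⊗ S` follows by applying `id ⊗ S`. -/
theorem IsQuasitriangular.rTensor_antipode_eq :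
    (S ℂ (H := H)).rTensor H R = (T).lTensor H R := by
  rw [← hR.comulOne_mul_rTensor_antipode, ← hR.lTensor_antipodeInv_mul, mul_assoc,
    hR.mul_rTensor_antipode, hR.lTensor_antipodeInv_mul_comulOp]

theorem IsQuasitriangular.lTensor_antipode_rTensor :
    (S ℂ (H := H)).lTensor H ((S ℂ (H := H)).rTensor H R) = R := by
  rw [hR.rTensor_antipode_eq]
  have : ∀ X : H ⊗[ℂ] H, (S ℂ (H := H)).lTensor H ((T).lTensor H X) = X := by
    intro X
    induction X with
    | zero => simp
    | add a b ha hb => simp only [map_add, ha, hb]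
    | tmul a b => simp [antipode_antipodeInv]
  exact this R

theorem IsQuasitriangular.map_antipode :
    TensorProduct.map (S ℂ (H := H)) (S ℂ (H := H)) R = R := by
  conv_rhs => rw [← hR.lTensor_antipode_rTensor]
  rw [← LinearMap.comp_apply, LinearMap.lTensor_comp_rTensor]

end RMatrix

/-! ### The Drinfeld element implements `S²` and is invertible. -/

section Drinfeld

variable {H : Type u} [Ring H] [Algebra ℂ H] [Coalgebra ℂ H] [StarRing H] [StarModule ℂ H]
  [CStarQuantumGroupoid H]

local notation "Δ₁" => comulOne ℂ H
local notation "T" => antipodeInv (H := H)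

/-- The linear map `a ⊗ b ↦ S(b) a`. -/
def antipodeMul : H ⊗[ℂ] H →ₗ[ℂ] H :=
  LinearMap.mul' ℂ H ∘ₗ TensorProduct.map (S ℂ (H := H)) LinearMap.id ∘ₗ
    (TensorProduct.comm ℂ H H).toLinearMap

@[simp]
theorem antipodeMul_tmul (a b : H) : antipodeMul (a ⊗ₜ b) = S ℂ b * a := by
  simp [antipodeMul]

theorem antipodeMul_eq (R : H ⊗[ℂ] H) : antipodeMul R = drinfeldElement R := rfl

theorem antipodeMul_mul_tmul (X : H ⊗[ℂ] H) (x y : H) :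
    antipodeMul (X * (x ⊗ₜ y)) = S ℂ y * antipodeMul X * x := by
  induction X with
  | zero => simp
  | add a b ha hb => simp only [map_add, add_mul, mul_add, ha, hb]
  | tmul a b => simp [antipode_mul, mul_assoc]

theorem map_antipode_mul (X Y : H ⊗[ℂ] H) :
    TensorProduct.map (S ℂ (H := H)) (S ℂ (H := H)) (X * Y) =
      TensorProduct.map (S ℂ (H := H)) (S ℂ (H := H)) Y *
        TensorProduct.map (S ℂ (H := H)) (S ℂ (H := H)) X := by
  induction X with
  | zero => simp
  | add a b ha hb => simp only [map_add, add_mul, mul_add, ha, hb]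
  | tmul a b =>
    induction Y with
    | zero => simp
    | add a b ha hb => simp only [map_add, add_mul, mul_add, ha, hb]
    | tmul c d => simp [antipode_mul]

theorem sum_sourceMap_mul_antipode {ι : Type*} {h : H} (r : Repr ℂ h ι) :
    ∑ i ∈ r.index, sourceMap ℂ (r.left i) * S ℂ (r.right i) = S ℂ h := by
  let L : H ⊗[ℂ] H →ₗ[ℂ] H := LinearMap.mul' ℂ H ∘ₗ (S ℂ (H := H)).lTensor H
  have h1 := congrArg L (sourceMap_rTensor_comul h)
  have h2 : ∀ X : H ⊗[ℂ] H, L ((1 ⊗ₜ h) * X) = L X * S ℂ h := by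
    intro X
    induction X with
    | zero => simp
    | add a b ha hb => simp only [map_add, add_mul, mul_add, ha, hb]
    | tmul a b => simp [L, antipode_mul, mul_assoc]
  have h3 : L Δ₁ = 1 := (QuantumGroupoid.mul_antipode 1).trans targetMap_one
  rw [h2, h3, one_mul, ← r.eq] at h1
  simpa [L] using h1

variable {R : H ⊗[ℂ] H} (hR : IsQuasitriangular R)

include hR

theorem IsQuasitriangular.antipodeMul_source_mul {z : H} (hz : z ∈ sourceSpace H) :
    antipodeMul ((z ⊗ₜ 1) * R) = S ℂ z * drinfeldElement R := by
  rw [hR.source_mul hz, antipodeMul_mul_tmul, mul_one, antipodeMul_eq]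

theorem IsQuasitriangular.antipodeMul_target_mul {z : H} (hz : z ∈ targetSpace H) :
    antipodeMul ((1 ⊗ₜ z) * R) = drinfeldElement R * z := by
  rw [hR.target_mul hz, antipodeMul_mul_tmul, antipodeMul_eq, S, antipode_one, one_mul]

/-- Apply `a ⊗ b ↦ S(b) a` to `Δ^op(h) R = R Δ(h)`. On the left, `S(h₍₁₎) h₍₂₎ = ε_s(h)` appears
between the legs of `R` and is moved through it. -/
theorem IsQuasitriangular.sum_antipode_drinfeldElement {ι : Type*} {h : H} (r : Repr ℂ h ι) :
    ∑ i ∈ r.index, S ℂ (r.right i) * drinfeldElement R * r.left i =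
      S ℂ (sourceMap ℂ h) * drinfeldElement R := by
  have h1 := congrArg antipodeMul (hR.comulOp_mul h)
  have h2 : ∀ X : H ⊗[ℂ] H, antipodeMul (TensorProduct.comm ℂ H H (Δ h) * X) =
      antipodeMul ((sourceMap ℂ h ⊗ₜ 1) * X) := by
    intro X
    induction X with
    | zero => simp
    | add a b ha hb => simp only [map_add, mul_add, ha, hb]
    | tmul a b =>
      rw [← sum_antipode_mul_right r, ← r.eq]
      simp [Finset.sum_mul, TensorProduct.sum_tmul, antipode_mul, mul_assoc]
  rw [comulOp_apply, h2, hR.antipodeMul_source_mul (LinearMap.mem_range_self _ _)] at h1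
  rw [h1, ← r.eq, Finset.mul_sum, map_sum]
  exact Finset.sum_congr rfl fun i _ => (antipodeMul_mul_tmul _ _ _).symm

/-- Compute `S(h₍₂₎ S(h₍₃₎)) u h₍₁₎` with both bracketings of the iterated coproduct. Contracting
`h₍₂₎ S(h₍₃₎)` first gives `S(1₍₂₎) u 1₍₁₎ h = u h`. Contracting `S(h₍₂₎) u h₍₁₎` first gives
`S(ε_s(h₍₁₎) S(h₍₂₎)) u = S²(h) u`. -/
theorem IsQuasitriangular.drinfeldElement_mul (h : H) :
    drinfeldElement R * h = S ℂ (S ℂ h) * drinfeldElement R := by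
  set w := drinfeldElement R with hw
  let L : H ⊗[ℂ] (H ⊗[ℂ] H) →ₗ[ℂ] H := LinearMap.mul' ℂ H ∘ₗ
    (TensorProduct.comm ℂ H H).toLinearMap ∘ₗ
    TensorProduct.map (LinearMap.mulLeft ℂ w) (S ℂ (H := H) ∘ₗ LinearMap.mul' ℂ H ∘ₗ
      (S ℂ (H := H)).lTensor H)
  have hL : ∀ x y z : H, L (x ⊗ₜ (y ⊗ₜ z)) = S ℂ (y * S ℂ z) * (w * x) := by
    intro x y z; simp [L]
  let r := ℛ ℂ h
  have h1 := congrArg L (Coalgebra.coassoc_apply (R := ℂ) h)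
  have h2 : L ((Δ).lTensor H (Δ h)) = w * h := by
    let K : H ⊗[ℂ] H →ₗ[ℂ] H := LinearMap.mul' ℂ H ∘ₗ (TensorProduct.comm ℂ H H).toLinearMap ∘ₗ
      TensorProduct.map (LinearMap.mulLeft ℂ w) (S ℂ (H := H))
    have h3 : ∀ X, L ((Δ).lTensor H X) = K ((targetMap ℂ).lTensor H X) := by
      intro X
      induction X with
      | zero => simp
      | add a b ha hb => simp only [map_add, ha, hb]
      | tmul a b =>
        simp only [L, K, LinearMap.comp_apply, LinearMap.lTensor_tmul, TensorProduct.map_tmul,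
          QuantumGroupoid.mul_antipode]
    have h4 : ∀ X : H ⊗[ℂ] H, K (X * (h ⊗ₜ 1)) = K X * h := by
      intro X
      induction X with
      | zero => simp
      | add a b ha hb => simp only [map_add, add_mul, ha, hb]
      | tmul a b => simp [K, mul_assoc]
    rw [h3, targetMap_lTensor_comul, h4]
    congr 1
    let s := ℛ ℂ (1 : H)
    have h5 := hR.sum_antipode_drinfeldElement s
    rw [sourceMap_one, S, antipode_one, one_mul] at h5
    rw [← sum_comulOne s]
    simpa [K, mul_assoc] using h5
  have h6 : L (TensorProduct.assoc ℂ H H H ((Δ).rTensor H (Δ h))) = S ℂ (S ℂ h) * w := by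
    have h7 : ∀ x y : H, L (TensorProduct.assoc ℂ H H H (Δ x ⊗ₜ y)) =
        S ℂ (sourceMap ℂ x * S ℂ y) * w := by
      intro x y
      let s := ℛ ℂ x
      rw [antipode_mul, mul_assoc, ← hR.sum_antipode_drinfeldElement s, ← s.eq]
      simp [TensorProduct.sum_tmul, hL, Finset.mul_sum, antipode_mul, mul_assoc, w]
    rw [← sum_sourceMap_mul_antipode r, ← r.eq]
    simp only [map_sum, LinearMap.rTensor_tmul, h7, Finset.sum_mul]
  rw [← h2, ← h6, h1]

theorem IsQuasitriangular.drinfeldElement_mul_antipodeInv (h : H) :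
    drinfeldElement R * T h = S ℂ h * drinfeldElement R := by
  rw [hR.drinfeldElement_mul, antipode_antipodeInv]

/-- The element `R⁽²⁾ S²(R⁽¹⁾)` is right inverse to the Drinfeld element. -/
theorem IsQuasitriangular.drinfeldElement_mul_inverse :
    drinfeldElement R * LinearMap.mul' ℂ H (TensorProduct.comm ℂ H H
      ((S ℂ (H := H) ∘ₗ S ℂ (H := H)).rTensor H R)) = 1 := by
  -- Since `u b = S²(b) u`, the product `u b S²(a)` arises from `R (S²(a) ⊗ S(b))` by `x ⊗ y ↦ S(y)
  -- x`. For `a ⊗ b = R` the second factor is `R̄ = (S ⊗ id)R`, by invariance under `S ⊗ S`.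
  have h1 : ∀ X : H ⊗[ℂ] H, drinfeldElement R * LinearMap.mul' ℂ H (TensorProduct.comm ℂ H H
      ((S ℂ (H := H) ∘ₗ S ℂ (H := H)).rTensor H X)) =
      antipodeMul (R * (S ℂ (H := H)).rTensor H
        (TensorProduct.map (S ℂ (H := H)) (S ℂ (H := H)) X)) := by
    intro X
    induction X with
    | zero => simp
    | add a b ha hb => simp only [map_add, mul_add, ha, hb]
    | tmul a b =>
      simp only [TensorProduct.map_tmul, LinearMap.rTensor_tmul, antipodeMul_mul_tmul]
      rw [antipodeMul_eq, ← hR.drinfeldElement_mul]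
      simp [mul_assoc]
  rw [h1, hR.map_antipode, hR.mul_rTensor_antipode]
  let s := ℛ ℂ (1 : H)
  rw [sum_comulOp_one s]
  simpa [sourceMap_one] using sum_antipode_mul_right s

theorem IsQuasitriangular.isUnit_drinfeldElement : IsUnit (drinfeldElement R) := by
  have : IsArtinianRing H := IsArtinianRing.of_finite ℂ H
  exact IsUnit.of_mul_eq_one _ hR.drinfeldElement_mul_inverse

theorem IsQuasitriangular.inverse_drinfeldElement : Ring.inverse (drinfeldElement R) =
    LinearMap.mul' ℂ H (TensorProduct.comm ℂ H H
      ((S ℂ (H := H) ∘ₗ S ℂ (H := H)).rTensor H R)) := by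
  have := congrArg (Ring.inverse (drinfeldElement R) * ·) hR.drinfeldElement_mul_inverse
  simp only [← mul_assoc, Ring.inverse_mul_cancel _ hR.isUnit_drinfeldElement, one_mul,
    mul_one] at this
  exact this.symm

theorem IsQuasitriangular.antipode_inverse_drinfeldElement :
    S ℂ (Ring.inverse (drinfeldElement R)) =
      LinearMap.mul' ℂ H ((S ℂ (H := H) ∘ₗ S ℂ (H := H)).rTensor H R) := by
  rw [hR.inverse_drinfeldElement]
  conv_rhs => rw [← hR.map_antipode]
  generalize R = X
  induction X with
  | zero => simp
  | add a b ha hb => simp only [map_add, ha, hb]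
  | tmul a b => simp [antipode_mul]

/-- `ε_t(xy)` depends on `y` only through `ε_t(y)`, so `R` may be replaced by `(ε_t ⊗ id)R =
Δ^op(1)`; there remains `S(1₍₁₎) 1₍₂₎ = 1`. -/
theorem IsQuasitriangular.targetMap_drinfeldElement : targetMap ℂ (drinfeldElement R) = 1 := by
  have h1 : ∀ X : H ⊗[ℂ] H, targetMap ℂ (antipodeMul X) =
      targetMap ℂ (antipodeMul ((targetMap ℂ).rTensor H X)) := by
    intro X
    induction X with
    | zero => simp
    | add a b ha hb => simp only [map_add, ha, hb]
    | tmul a b => simp [targetMap_mul_targetMap]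
  let s := ℛ ℂ (1 : H)
  rw [← antipodeMul_eq, h1, hR.rTensor_targetMap, sum_comulOp_one s]
  have := sum_antipode_mul_right s
  simp only [map_sum, antipodeMul_tmul] at this ⊢
  rw [← map_sum, this, sourceMap_one, targetMap_one]

end Drinfeld

/-! ### The coproduct of the Drinfeld element. -/

section DrinfeldComul

open Algebra.TensorProduct (includeLeft includeRight)

variable {H : Type u} [Ring H] [Algebra ℂ H] [Coalgebra ℂ H] [StarRing H] [StarModule ℂ H]
  [CStarQuantumGroupoid H]

local notation "Δ₁" => comulOne ℂ H
local notation "T" => antipodeInv (H := H)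

/-- The embedding `a ⊗ (b ⊗ c) ↦ (a ⊗ b) ⊗ (c ⊗ 1)`. -/
def legs123 : H ⊗[ℂ] (H ⊗[ℂ] H) →ₐ[ℂ] (H ⊗[ℂ] H) ⊗[ℂ] (H ⊗[ℂ] H) :=
  (Algebra.TensorProduct.map (AlgHom.id ℂ (H ⊗[ℂ] H)) includeLeft).comp
    (Algebra.TensorProduct.assoc ℂ ℂ ℂ H H H).symm.toAlgHom

/-- The embedding `a ⊗ (b ⊗ c) ↦ (a ⊗ b) ⊗ (1 ⊗ c)`. -/
def legs124 : H ⊗[ℂ] (H ⊗[ℂ] H) →ₐ[ℂ] (H ⊗[ℂ] H) ⊗[ℂ] (H ⊗[ℂ] H) :=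
  (Algebra.TensorProduct.map (AlgHom.id ℂ (H ⊗[ℂ] H)) includeRight).comp
    (Algebra.TensorProduct.assoc ℂ ℂ ℂ H H H).symm.toAlgHom

theorem legs123_tmul (a b c : H) : legs123 (a ⊗ₜ (b ⊗ₜ c)) = (a ⊗ₜ b) ⊗ₜ[ℂ] (c ⊗ₜ (1 : H)) := rfl

theorem legs124_tmul (a b c : H) : legs124 (a ⊗ₜ (b ⊗ₜ c)) = (a ⊗ₜ b) ⊗ₜ[ℂ] ((1 : H) ⊗ₜ c) := rfl

/-- The right action `m · (x ⊗ y) = (S ⊗ S)(y) m x` of `(H ⊗ H) ⊗ (H ⊗ H)` on `H ⊗ H`. -/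
def rightAct (m : H ⊗[ℂ] H) : (H ⊗[ℂ] H) ⊗[ℂ] (H ⊗[ℂ] H) →ₗ[ℂ] H ⊗[ℂ] H :=
  LinearMap.mul' ℂ (H ⊗[ℂ] H) ∘ₗ
    TensorProduct.map (TensorProduct.map (S ℂ (H := H)) (S ℂ (H := H))) (LinearMap.mulLeft ℂ m) ∘ₗ
      (TensorProduct.comm ℂ (H ⊗[ℂ] H) (H ⊗[ℂ] H)).toLinearMap

theorem rightAct_tmul (m x y : H ⊗[ℂ] H) : rightAct m (x ⊗ₜ y) =
    TensorProduct.map (S ℂ (H := H)) (S ℂ (H := H)) y * (m * x) := by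
  simp [rightAct]

theorem rightAct_add (m n : H ⊗[ℂ] H) : rightAct (m + n) = rightAct m + rightAct n := by
  refine TensorProduct.ext' fun x y => ?_
  simp [rightAct_tmul, add_mul, mul_add]

theorem rightAct_zero : rightAct (0 : H ⊗[ℂ] H) = 0 := by
  refine TensorProduct.ext' fun x y => ?_
  simp [rightAct_tmul]

theorem rightAct_mul (m : H ⊗[ℂ] H) (s t : (H ⊗[ℂ] H) ⊗[ℂ] (H ⊗[ℂ] H)) :
    rightAct m (s * t) = rightAct (rightAct m s) t := by
  induction t with
  | zero => simp
  | add a b ha hb => simp only [mul_add, map_add, ha, hb]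
  | tmul x y =>
    induction s with
    | zero => simp [rightAct_zero]
    | add a b ha hb => simp only [add_mul, map_add, ha, hb, rightAct_add, LinearMap.add_apply]
    | tmul x' y' => simp [rightAct_tmul, map_antipode_mul, mul_assoc]

theorem map_antipode_one :
    TensorProduct.map (S ℂ (H := H)) (S ℂ (H := H)) 1 = 1 := by
  simp [Algebra.TensorProduct.one_def, antipode_one]

theorem rightAct_legs123_leg12 (m X : H ⊗[ℂ] H) : rightAct m (legs123 (leg12 X)) = m * X := by
  induction X with
  | zero => simp
  | add a b ha hb => simp only [mul_add, map_add, ha, hb]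
  | tmul a b =>
    simp [leg12, legs123_tmul, rightAct_tmul, ← Algebra.TensorProduct.one_def, map_antipode_one]

theorem legs124_leg12 (X : H ⊗[ℂ] H) : legs124 (leg12 X) = legs123 (leg12 X) := by
  induction X with
  | zero => simp
  | add a b ha hb => simp only [map_add, ha, hb]
  | tmul a b => simp [leg12, legs123_tmul, legs124_tmul]

theorem comul_rTensor_leg12 (X : H ⊗[ℂ] H) :
    (Δ).rTensor (H ⊗[ℂ] H) (leg12 X) = legs123 (comulId ℂ H X) := by
  have h : ∀ (Y : H ⊗[ℂ] H) (b : H), Y ⊗ₜ[ℂ] (b ⊗ₜ[ℂ] (1 : H)) =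
      legs123 (TensorProduct.assoc ℂ H H H (Y ⊗ₜ b)) := by
    intro Y b
    induction Y with
    | zero => simp
    | add c d hc hd => simp only [TensorProduct.add_tmul, map_add, hc, hd]
    | tmul c d => rfl
  induction X with
  | zero => simp
  | add a b ha hb => simp only [map_add, ha, hb]
  | tmul a b => exact h _ _

theorem comul_rTensor_leg13 (X : H ⊗[ℂ] H) :
    (Δ).rTensor (H ⊗[ℂ] H) (leg13 X) = legs124 (comulId ℂ H X) := by
  have h : ∀ (Y : H ⊗[ℂ] H) (b : H), Y ⊗ₜ[ℂ] ((1 : H) ⊗ₜ[ℂ] b) =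
      legs124 (TensorProduct.assoc ℂ H H H (Y ⊗ₜ b)) := by
    intro Y b
    induction Y with
    | zero => simp
    | add c d hc hd => simp only [TensorProduct.add_tmul, map_add, hc, hd]
    | tmul c d => rfl
  induction X with
  | zero => simp
  | add a b ha hb => simp only [map_add, ha, hb]
  | tmul a b => exact h _ _

theorem comul_rTensor_mul (X Y : H ⊗[ℂ] (H ⊗[ℂ] H)) : (Δ).rTensor (H ⊗[ℂ] H) (X * Y) =
    (Δ).rTensor (H ⊗[ℂ] H) X * (Δ).rTensor (H ⊗[ℂ] H) Y := by
  induction X with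
  | zero => simp
  | add a b ha hb => simp only [add_mul, map_add, ha, hb]
  | tmul a b =>
    induction Y with
    | zero => simp
    | add a b ha hb => simp only [mul_add, map_add, ha, hb]
    | tmul c d => simp [comul_mul]

theorem comm_comm (X : H ⊗[ℂ] H) : TensorProduct.comm ℂ H H (TensorProduct.comm ℂ H H X) = X :=
  (TensorProduct.comm ℂ H H).symm_apply_apply X

/-- Interchanging the first two factors. -/
def swap12 : H ⊗[ℂ] (H ⊗[ℂ] H) →ₐ[ℂ] H ⊗[ℂ] (H ⊗[ℂ] H) :=
  (Algebra.TensorProduct.leftComm ℂ H H H).toAlgHom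

theorem swap12_tmul (a b c : H) : swap12 (a ⊗ₜ (b ⊗ₜ c)) = b ⊗ₜ[ℂ] (a ⊗ₜ[ℂ] c) := rfl

theorem rightAct_sum {ι : Type*} (s : Finset ι) (f : ι → H ⊗[ℂ] H) :
    rightAct (∑ i ∈ s, f i) = ∑ i ∈ s, rightAct (f i) := by
  classical
  induction s using Finset.induction_on with
  | empty => simp [rightAct_zero]
  | insert i s hi h => simp [Finset.sum_insert hi, rightAct_add, h]

theorem rightAct_legs123_leg13 (a b : H) (X : H ⊗[ℂ] H) :
    rightAct (S ℂ a ⊗ₜ b) (legs123 (leg13 X)) = antipodeMul ((1 ⊗ₜ a) * X) ⊗ₜ b := by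
  induction X with
  | zero => simp
  | add c d hc hd => simp only [map_add, mul_add, TensorProduct.add_tmul, hc, hd]
  | tmul c d =>
    simp [leg13, legs123_tmul, rightAct_tmul, antipode_mul, antipode_one, mul_assoc]

theorem rightAct_legs124_leg23 (a b : H) (X : H ⊗[ℂ] H) :
    rightAct (a ⊗ₜ b) (legs124 (leg23 X)) = a ⊗ₜ antipodeMul ((b ⊗ₜ 1) * X) := by
  induction X with
  | zero => simp
  | add c d hc hd => simp only [map_add, mul_add, TensorProduct.tmul_add, hc, hd]
  | tmul c d =>
    simp [leg23, legs124_tmul, rightAct_tmul, antipode_one]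

variable {R : H ⊗[ℂ] H} (hR : IsQuasitriangular R)

include hR

theorem IsQuasitriangular.leg12_mul_comulId (X : H ⊗[ℂ] H) :
    leg12 R * QGroupoid.comulId ℂ H X = swap12 (QGroupoid.comulId ℂ H X) * leg12 R := by
  have h : ∀ (Y : H ⊗[ℂ] H) (b : H), TensorProduct.assoc ℂ H H H (Y ⊗ₜ b) =
      leg12 Y * (1 ⊗ₜ (1 ⊗ₜ b)) := by
    intro Y b
    induction Y with
    | zero => simp
    | add c d hc hd => simp only [TensorProduct.add_tmul, map_add, add_mul, hc, hd]
    | tmul c d => simp [leg12]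
  have h' : ∀ (Y : H ⊗[ℂ] H) (b : H), swap12 (TensorProduct.assoc ℂ H H H (Y ⊗ₜ b)) =
      leg12 (TensorProduct.comm ℂ H H Y) * (1 ⊗ₜ (1 ⊗ₜ b)) := by
    intro Y b
    induction Y with
    | zero => simp
    | add c d hc hd => simp only [TensorProduct.add_tmul, map_add, add_mul, hc, hd]
    | tmul c d => simp [leg12, swap12_tmul]
  have h2 : ∀ (Y : H ⊗[ℂ] H) (b : H), (1 ⊗ₜ (1 ⊗ₜ b)) * leg12 Y = leg12 Y * (1 ⊗ₜ (1 ⊗ₜ b)) := by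
    intro Y b
    induction Y with
    | zero => simp
    | add c d hc hd => simp only [map_add, add_mul, mul_add, hc, hd]
    | tmul c d => simp [leg12]
  induction X with
  | zero => simp
  | add a b ha hb => simp only [map_add, mul_add, add_mul, ha, hb]
  | tmul a b =>
    change leg12 R * TensorProduct.assoc ℂ H H H (Δ a ⊗ₜ b) =
      swap12 (TensorProduct.assoc ℂ H H H (Δ a ⊗ₜ b)) * leg12 R
    rw [h', h, mul_assoc, h2, ← mul_assoc, ← mul_assoc, ← map_mul, ← map_mul,
      ← hR.comulOp_mul, comulOp_apply]

/-- The Yang–Baxter equation. -/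
theorem IsQuasitriangular.yang_baxter :
    leg12 R * QGroupoid.comulId ℂ H R = leg23 R * leg13 R * leg12 R := by
  have h1 : ∀ X : H ⊗[ℂ] H, swap12 (leg13 X) = leg23 X := by
    intro X
    induction X with
    | zero => simp
    | add c d hc hd => simp only [map_add, hc, hd]
    | tmul c d => simp [leg13, leg23, swap12_tmul]
  have h2 : ∀ X : H ⊗[ℂ] H, swap12 (leg23 X) = leg13 X := by
    intro X
    induction X with
    | zero => simp
    | add c d hc hd => simp only [map_add, hc, hd]
    | tmul c d => simp [leg13, leg23, swap12_tmul]
  rw [hR.leg12_mul_comulId, hR.comulId, map_mul, h1, h2]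

theorem IsQuasitriangular.comulOp_lTensor :
    (comulOp ℂ H).lTensor H R = leg12 R * leg13 R := by
  have h1 : ∀ X : H ⊗[ℂ] H, (comulOp ℂ H).lTensor H X =
      (Algebra.TensorProduct.map (AlgHom.id ℂ H)
        (Algebra.TensorProduct.comm ℂ H H).toAlgHom) (QGroupoid.idComul ℂ H X) := by
    intro X
    induction X with
    | zero => simp
    | add c d hc hd => simp only [map_add, hc, hd]
    | tmul c d => rfl
  have h2 : ∀ X : H ⊗[ℂ] H, (Algebra.TensorProduct.map (AlgHom.id ℂ H)
        (Algebra.TensorProduct.comm ℂ H H).toAlgHom) (leg13 X) = leg12 X := by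
    intro X
    induction X with
    | zero => simp
    | add c d hc hd => simp only [map_add, hc, hd]
    | tmul c d => simp [leg13, leg12]
  have h3 : ∀ X : H ⊗[ℂ] H, (Algebra.TensorProduct.map (AlgHom.id ℂ H)
        (Algebra.TensorProduct.comm ℂ H H).toAlgHom) (leg12 X) = leg13 X := by
    intro X
    induction X with
    | zero => simp
    | add c d hc hd => simp only [map_add, hc, hd]
    | tmul c d => simp [leg13, leg12]
  rw [h1, hR.idComul, map_mul, h2, h3]

theorem IsQuasitriangular.comm_mul_self_mul_comul (h : H) :
    TensorProduct.comm ℂ H H R * R * Δ h = Δ h * (TensorProduct.comm ℂ H H R * R) := by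
  have := congrArg (TensorProduct.comm ℂ H H) (hR.comulOp_mul h)
  rw [comm_mul, comm_mul, comulOp_apply, comm_comm, ← comulOp_apply] at this
  rw [mul_assoc, ← hR.comulOp_mul, ← mul_assoc, ← mul_assoc, this]

/-- Up to a flip and `S` on one leg, this action multiplies out to `(id ⊗ S⁻¹)(R) R = Δ(1)`. -/
theorem IsQuasitriangular.rightAct_comm_leg23 :
    rightAct (TensorProduct.comm ℂ H H R) (legs123 (leg23 R)) =
      (S ℂ (H := H)).rTensor H (comulOp ℂ H 1) := by
  have h1 : ∀ X Y : H ⊗[ℂ] H, rightAct (TensorProduct.comm ℂ H H X) (legs123 (leg23 Y)) =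
      (S ℂ (H := H)).rTensor H (TensorProduct.comm ℂ H H ((T).lTensor H X * Y)) := by
    intro X Y
    induction X with
    | zero => simp [rightAct_zero]
    | add a b ha hb => simp only [map_add, add_mul, rightAct_add, LinearMap.add_apply, ha, hb]
    | tmul a b =>
      induction Y with
      | zero => simp
      | add c d hc hd => simp only [map_add, mul_add, hc, hd]
      | tmul c d =>
        simp [leg23, legs123_tmul, rightAct_tmul, antipode_mul, antipode_one, antipode_antipodeInv]
  rw [h1, hR.lTensor_antipodeInv_mul, comulOp_one]

/-- Under the right action of the fourth tensor power, `R₂₁ R Δ(u)` is `R₂₁` acted on by `R₁₂ (Δ ⊗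
Δ^op)(R)`, a product of five `R`-matrices. Two Yang–Baxter moves rewrite it as `R₂₃ R₁₃ R₂₄ R₁₄
R₁₂`. Acting in this order, `R₂₃` turns `R₂₁` into `(S ⊗ id)Δ^op(1)`, `R₁₃` and `R₂₄` create the two
factors `u`, and `R₁₄`, `R₁₂` cancel to `Δ(1)`. -/
theorem IsQuasitriangular.mul_comul_drinfeldElement :
    TensorProduct.comm ℂ H H R * R * Δ (drinfeldElement R) =
      (drinfeldElement R ⊗ₜ drinfeldElement R) * Δ₁ := by
  set w := drinfeldElement R with hw
  have h1 : ∀ X : H ⊗[ℂ] H, TensorProduct.comm ℂ H H R * R * Δ (antipodeMul X) =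
      rightAct (TensorProduct.comm ℂ H H R * R)
        ((Δ).rTensor (H ⊗[ℂ] H) ((comulOp ℂ H).lTensor H X)) := by
    intro X
    induction X with
    | zero => simp
    | add a b ha hb => simp only [map_add, mul_add, ha, hb]
    | tmul a b =>
      rw [antipodeMul_tmul, comul_mul, ← mul_assoc, hR.comm_mul_self_mul_comul, S,
        QuantumGroupoid.comul_antipode, mul_assoc]
      exact (rightAct_tmul _ _ _).symm
  obtain ⟨r, hr, hr'⟩ := exists_repr_one (H := H)
  have key : legs123 (leg12 R) * (legs123 (QGroupoid.comulId ℂ H R) *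
      legs124 (QGroupoid.comulId ℂ H R)) = legs123 (leg23 R) * legs123 (leg13 R) *
        legs124 (leg23 R) * legs124 (leg13 R) * legs123 (leg12 R) := by
    rw [← mul_assoc, ← map_mul, hR.yang_baxter, map_mul, mul_assoc, ← legs124_leg12, ← map_mul,
      hR.yang_baxter]
    simp only [map_mul, mul_assoc]
  have h2 : ∀ i, rightAct (rightAct (S ℂ (r.right i) ⊗ₜ r.left i) (legs123 (leg13 R)))
      (legs124 (leg23 R)) = (w ⊗ₜ w) * (r.right i ⊗ₜ T (r.left i)) := by
    intro i
    rw [rightAct_legs123_leg13, hR.antipodeMul_target_mul (hr' i), rightAct_legs124_leg23,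
      hR.antipodeMul_source_mul (hr i), ← hR.drinfeldElement_mul_antipodeInv]
    simp [w]
  have h3 : rightAct (rightAct ((S ℂ (H := H)).rTensor H
      (∑ i ∈ r.index, r.right i ⊗ₜ r.left i)) (legs123 (leg13 R)))
      (legs124 (leg23 R)) = (w ⊗ₜ w) * (T).lTensor H (comulOp ℂ H 1) := by
    rw [sum_comulOp_one r]
    simp only [map_sum, LinearMap.rTensor_tmul, rightAct_sum, LinearMap.sum_apply, h2,
      Finset.mul_sum, LinearMap.lTensor_tmul]
  have h4 : ∀ X Y : H ⊗[ℂ] H, rightAct ((w ⊗ₜ w) * (T).lTensor H X) (legs124 (leg13 Y)) =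
      (w ⊗ₜ w) * (T).lTensor H (X * Y) := by
    intro X Y
    induction X with
    | zero => simp [rightAct_zero]
    | add a b ha hb =>
      simp only [map_add, add_mul, mul_add, rightAct_add, LinearMap.add_apply, ha, hb]
    | tmul a b =>
      induction Y with
      | zero => simp
      | add c d hc hd => simp only [map_add, mul_add, hc, hd]
      | tmul c d =>
        simp only [leg13, Algebra.TensorProduct.map_tmul, AlgHom.id_apply,
          Algebra.TensorProduct.includeRight_apply, legs124_tmul, rightAct_tmul,
          TensorProduct.map_tmul, LinearMap.lTensor_tmul, Algebra.TensorProduct.tmul_mul_tmul,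
          mul_one, S, antipode_one, one_mul, antipodeInv_mul]
        rw [← mul_assoc, ← mul_assoc w (T d), hR.drinfeldElement_mul_antipodeInv, mul_assoc,
          mul_assoc]
  rw [hw, ← antipodeMul_eq, h1, hR.comulOp_lTensor, comul_rTensor_mul, comul_rTensor_leg12,
    comul_rTensor_leg13, ← rightAct_legs123_leg12, ← rightAct_mul, key, rightAct_mul, rightAct_mul,
    rightAct_mul, rightAct_mul, hR.rightAct_comm_leg23, sum_comulOp_one r, antipodeMul_eq, ← hw,
    h3, h4, hR.comulOp_one_mul, rightAct_legs123_leg12, mul_assoc,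
    hR.lTensor_antipodeInv_mul]

end DrinfeldComul

open ComplexOrder

/-! ### Balanced elements: uniqueness and existence. -/

section Balanced

variable {A : Type u} [Ring A] [Algebra ℂ A] [StarRing A] [StarModule ℂ A] [FiniteDimensional ℂ A]
  {τ : A →ₗ[ℂ] ℂ}

theorem star_mem_center {z : A} (hz : z ∈ Subalgebra.center ℂ A) :
    star z ∈ Subalgebra.center ℂ A := by
  rw [Subalgebra.mem_center_iff] at hz ⊢
  intro b
  have := congrArg star (hz (star b))
  simpa using this.symm

theorem inv_mem_center {z : Aˣ} (hz : (z : A) ∈ Subalgebra.center ℂ A) :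
    ((z⁻¹ : Aˣ) : A) ∈ Subalgebra.center ℂ A := by
  rw [Subalgebra.mem_center_iff] at hz ⊢
  intro b
  have : Commute b (z : A) := hz b
  exact this.units_inv_right.eq

/-- Every linear functional is of the form `τ(c ·)`. -/
theorem IsFaithful.exists_density (hτ : IsFaithful τ) (χ : A →ₗ[ℂ] ℂ) :
    ∃ c, ∀ x, χ x = τ (c * x) := by
  let L : A →ₗ[ℂ] Module.Dual ℂ A :=
    (LinearMap.compRight ℂ τ) ∘ₗ (Algebra.lmul ℂ A).toLinearMap
  have hL : ∀ c x, L c x = τ (c * x) := fun _ _ => rfl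
  have hinj : Function.Injective L := (injective_iff_map_eq_zero L).2 fun c hc => by
    refine star_eq_zero.1 (hτ.eq_zero ?_)
    rw [star_star, ← hL, hc, LinearMap.zero_apply]
  obtain ⟨c, hc⟩ := (LinearMap.injective_iff_surjective_of_finrank_eq_finrank
    (Subspace.dual_finrank_eq (K := ℂ) (V := A)).symm).1 hinj χ
  exact ⟨c, fun x => by rw [← hL, hc]⟩

/-- Every trace is of the form `τ(c ·)` with `c` central. -/
theorem IsFaithful.exists_central_density (hτ : IsFaithful τ) (hc : ∀ a b, τ (a * b) = τ (b * a))
    (χ : A →ₗ[ℂ] ℂ) (hχ : ∀ a b, χ (a * b) = χ (b * a)) :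
    ∃ c ∈ Subalgebra.center ℂ A, ∀ x, χ x = τ (c * x) := by
  obtain ⟨c, h⟩ := hτ.exists_density χ
  refine ⟨c, Subalgebra.mem_center_iff.2 fun b => hτ.eq_of_forall fun a => ?_, h⟩
  have h1 := hχ b a
  rw [h, h, ← mul_assoc, hc, hc c] at h1
  rw [h1, ← mul_assoc]

/-- An invertible element is balanced if it and its inverse agree as functionals on the center. -/
def IsBalanced (τ : A →ₗ[ℂ] ℂ) (g : Aˣ) : Prop :=
  ∀ z ∈ Subalgebra.center ℂ A, τ (z * g) = τ (z * (g⁻¹ : Aˣ))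

theorem IsFaithful.isUnit_add_one (hτ : IsFaithful τ) (a : A) : IsUnit (star a * a + 1) :=
  isUnit_of_injective fun b hb => by
    have h1 : τ (star (a * b) * (a * b)) + τ (star b * b) = 0 := by
      rw [← map_add, ← map_zero τ, ← mul_zero (star b), ← hb]
      simp [add_mul, mul_add, mul_assoc]
    have h2 := (add_eq_zero_iff_of_nonneg (hτ.isPositive (a * b)) (hτ.isPositive b)).1 h1
    exact hτ.eq_zero h2.2

theorem IsFaithful.exists_unit_root (hτ : IsFaithful τ) (g : Aˣ)
    (hg : ∃ a, (g : A) = star a * a) :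
    ∃ t : Aˣ, star (t : A) = t ∧ t ^ 4 = g ∧ (∀ b : A, b * g = g * b → b * t = t * b) ∧
      ∀ K : Subalgebra ℂ A, (g : A) ∈ K → (t : A) ∈ K := by
  obtain ⟨a, ha⟩ := hg
  have hau : ∀ b, a * b = 0 → b = 0 := fun b hb => by
    have : (g : A) * b = 0 := by rw [ha, mul_assoc, hb, mul_zero]
    exact (Units.mul_right_eq_zero g).1 this
  have h1 : IsPosDef τ (g : A) := by
    rw [ha]
    exact isPosDef_star_mul_self hτ (isUnit_of_injective hau)
  obtain ⟨t, h2, h3, ⟨t, rfl⟩, h5, h6⟩ := h1.exists_root hτ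
  exact ⟨t, h2, Units.ext (by simpa using h3), h5, h6⟩

/-- Elements implementing the same automorphism differ by a central `w`. Balance of both gives `τ(z
(w - w⁻¹) g) = 0` for central `z`; choosing `z = (w - w⁻¹)*` and using positivity of `g` forces `w =
w⁻¹`. Since `w` is also positive, `w + 1` is invertible and `w = 1`. -/
theorem IsBalanced.unique (hτ : IsFaithful τ) {g g' : Aˣ} (hg : IsBalanced τ g)
    (hg' : IsBalanced τ g') (hp : ∃ a, (g : A) = star a * a) (hp' : ∃ a, (g' : A) = star a * a)
    (h : ∀ x : A, g * x * (g⁻¹ : Aˣ) = g' * x * (g'⁻¹ : Aˣ)) : g' = g := by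
  obtain ⟨t, ht, rfl, -⟩ := hτ.exists_unit_root g hp
  set g := t ^ 4 with hgt
  obtain ⟨w, hw⟩ : ∃ w, w * g = g' := ⟨g' * g⁻¹, by simp⟩
  have hwc : (w : A) ∈ Subalgebra.center ℂ A := by
    rw [Subalgebra.mem_center_iff]
    intro b
    have h1 := h ((g⁻¹ : Aˣ) * b * g)
    have h2 : b = w * b * (w⁻¹ : Aˣ) := by
      simpa [← hw, mul_assoc, -Units.val_pow_eq_pow_val] using h1
    calc b * w = w * b * (w⁻¹ : Aˣ) * w := by rw [← h2]
      _ = w * b := by simp [mul_assoc]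
  have hwi := inv_mem_center hwc
  have h1 : ∀ z ∈ Subalgebra.center ℂ A, τ (z * (w - (w⁻¹ : Aˣ)) * g) = 0 := by
    intro z hz
    have h2 := hg' z hz
    have h3 := hg _ (mul_mem hz hwi)
    rw [← hw] at h2
    rw [mul_sub, sub_mul, map_sub, h3, sub_eq_zero]
    simp only [Units.val_mul, mul_inv_rev, mul_assoc] at h2 ⊢
    rw [h2, Subalgebra.mem_center_iff.1 hwi]
  have h2 : ((w : A) - (w⁻¹ : Aˣ)) = 0 := by
    have hy := sub_mem hwc hwi
    set y := ((w : A) - (w⁻¹ : Aˣ))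
    have h3 := h1 _ (star_mem_center hy)
    have h4 : star y * y * (g : A) = star (y * (t : A) ^ 2) * (y * (t : A) ^ 2) := by
      have e1 := Subalgebra.mem_center_iff.1 (mul_mem (star_mem_center hy) hy) ((t : A) ^ 2)
      simp only [star_mul, star_pow, ht, hgt, Units.val_pow_eq_pow_val]
      rw [show star y * y * (t : A) ^ 4 = star y * y * (t : A) ^ 2 * (t : A) ^ 2 by
        rw [mul_assoc _ ((t : A) ^ 2), ← pow_add], ← e1]
      simp only [mul_assoc]
    rw [h4] at h3
    have h5 := hτ.eq_zero h3
    rwa [← Units.val_pow_eq_pow_val, Units.mul_left_eq_zero] at h5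
  obtain ⟨a, ha⟩ := hp'
  have h3 : (w : A) = star (a * ((t ^ 2)⁻¹ : Aˣ)) * (a * ((t ^ 2)⁻¹ : Aˣ)) := by
    have e2 : star (((t ^ 2)⁻¹ : Aˣ) : A) = ((t ^ 2)⁻¹ : Aˣ) := by
      have : star t = t := Units.ext ht
      rw [← Units.coe_star, star_inv, star_pow, this]
    rw [star_mul, e2, mul_assoc, ← mul_assoc (star a), ← ha, ← hw, Units.val_mul, mul_assoc,
      ← mul_assoc _ (w : A), Subalgebra.mem_center_iff.1 hwc, mul_assoc, ← Units.val_mul,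
      ← Units.val_mul]
    rw [show (t ^ 2)⁻¹ * (g * (t ^ 2)⁻¹) = 1 by rw [hgt]; group]
    simp
  have h4 : (((w : A) + 1) * (w - 1)) = 0 := by
    have : (w : A) * w = 1 := by
      conv_lhs => rw [sub_eq_zero.1 h2]
      simp [sub_eq_zero.1 h2]
    rw [mul_sub, add_mul, this]; simp [add_comm]
  have h5 := hτ.isUnit_add_one (a * ((t ^ 2)⁻¹ : Aˣ))
  rw [← h3] at h5
  have h6 : w = 1 := Units.ext (sub_eq_zero.1 (h5.mul_right_eq_zero.1 h4))
  rw [← hw, h6, one_mul]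

/-- Let `c = Σ e_i g e_i*` and `c' = Σ e_i g⁻¹ e_i*`, central and positive. On the centre they
represent `τ(g ·)` and `τ(g⁻¹ ·)` up to the central invertible `D = Σ e_i* e_i`, so `wg` is balanced
once `w c = w⁻¹ c'`. Fourth roots of `c` and `c'` give `w = s²` with `s` central and self-adjoint,
and then `wg = (s t²)*(s t²)` for a fourth root `t` of `g`. -/
theorem exists_balanced (hτ : IsFaithful τ) (hc : ∀ a b, τ (a * b) = τ (b * a)) (g : Aˣ)
    (hp : ∃ a, (g : A) = star a * a) : ∃ w : Aˣ, (w : A) ∈ Subalgebra.center ℂ A ∧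
      IsBalanced τ (w * g) ∧ ∃ a, ((w * g : Aˣ) : A) = star a * a := by
  obtain ⟨n, e, he, hD, hD', he'⟩ := exists_casimir hτ hc
  obtain ⟨t, ht, htg, -⟩ := hτ.exists_unit_root g hp
  have hst : star t = t := Units.ext ht
  set D := ∑ i, star (e i) * e i
  have hDc : D ∈ Subalgebra.center ℂ A := Subalgebra.mem_center_iff.2 hD
  obtain ⟨D', hDD'⟩ := hD'.isUnit
  have key : ∀ z ∈ Subalgebra.center ℂ A, ∀ x, τ (z * ∑ i, e i * x * star (e i)) =
      τ (z * D * x) := by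
    intro z hz x
    simp only [D, Finset.mul_sum, Finset.sum_mul, map_sum]
    refine Finset.sum_congr rfl fun i _ => ?_
    rw [← mul_assoc, hc, ← mul_assoc, ← mul_assoc, Subalgebra.mem_center_iff.1 hz (star (e i)),
      mul_assoc z]
  have pos : ∀ s : Aˣ, star s = s → ∃ c : Aˣ, (c : A) = ∑ i, e i * ((s ^ 2 : Aˣ) : A) * star (e i) ∧
      (c : A) ∈ Subalgebra.center ℂ A ∧ ∃ r : Aˣ, star r = r ∧ r ^ 4 = c ∧
        (r : A) ∈ Subalgebra.center ℂ A := by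
    intro s hs
    have hcc : ∑ i, e i * ((s ^ 2 : Aˣ) : A) * star (e i) ∈ Subalgebra.center ℂ A :=
      Subalgebra.mem_center_iff.2 (he _)
    have hpd : IsPosDef τ (∑ i, e i * ((s ^ 2 : Aˣ) : A) * star (e i)) := by
      intro b hb
      have hs' : star (s : A) = s := by rw [← Units.coe_star, hs]
      have e1 : τ (star b * ((∑ i, e i * ((s ^ 2 : Aˣ) : A) * star (e i)) * b)) =
          ∑ i, τ (star (s * (star (e i) * b)) * (s * (star (e i) * b))) := by
        simp [Finset.sum_mul, Finset.mul_sum, hs', pow_two, mul_assoc]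
      rw [e1]
      refine lt_of_le_of_ne (Finset.sum_nonneg fun i _ => hτ.isPositive _) fun h => hb ?_
      have h2 := (Finset.sum_eq_zero_iff_of_nonneg fun i _ => hτ.isPositive _).1 h.symm
      exact he' b fun i => (Units.mul_right_eq_zero s).1 (hτ.eq_zero (h2 i (Finset.mem_univ i)))
    obtain ⟨r, hr, hr4, ⟨r, rfl⟩, -, hrK⟩ := hpd.exists_root hτ
    exact ⟨r ^ 4, by simpa using hr4, by simpa [hr4] using hcc, r, Units.ext hr, rfl, hrK _ hcc⟩
  obtain ⟨c, hcs, hcc, r, hr, hrc, hrC⟩ := pos (t ^ 2) (by rw [star_pow, hst])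
  obtain ⟨c', hcs', hcc', r', hr', hrc', hrC'⟩ := pos ((t ^ 2)⁻¹) (by rw [star_inv, star_pow, hst])
  have e1 : (t ^ 2) ^ 2 = g := by rw [← htg]; group
  have e2 : ((t ^ 2)⁻¹) ^ 2 = g⁻¹ := by rw [← htg]; group
  rw [e1] at hcs
  rw [e2] at hcs'
  have comm : Commute r r' := Units.ext (Subalgebra.mem_center_iff.1 hrC' r)
  have commt : Commute r t := Units.ext (Subalgebra.mem_center_iff.1 hrC t).symm
  have commt' : Commute r' t := Units.ext (Subalgebra.mem_center_iff.1 hrC' t).symm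
  set s : Aˣ := r' * r⁻¹ with hs
  have hsC : (s : A) ∈ Subalgebra.center ℂ A := by
    rw [hs, Units.val_mul]
    exact mul_mem hrC' (inv_mem_center hrC)
  have hss : star s = s := by
    rw [hs, star_mul, star_inv, hr, hr']
    exact comm.inv_left.eq
  have hs4 : s ^ 4 * c = c' := by
    rw [hs, comm.symm.inv_right.mul_pow, ← hrc, ← hrc']
    group
  have hs2C : ((s ^ 2 : Aˣ) : A) ∈ Subalgebra.center ℂ A := by
    rw [Units.val_pow_eq_pow_val]
    exact pow_mem hsC 2
  have comms : Commute s t := Units.ext (Subalgebra.mem_center_iff.1 hsC t).symm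
  refine ⟨s ^ 2, hs2C, fun z hz => ?_, (s * t ^ 2 : Aˣ), ?_⟩
  · have hDi := inv_mem_center (z := D') (by rw [hDD']; exact hDc)
    have hzD := mul_mem hz hDi
    have e3 : z * (D'⁻¹ : Aˣ) * D = z := by rw [← hDD', mul_assoc]; simp
    have hs2i := inv_mem_center hs2C
    have h1 := key _ (mul_mem hs2C hzD) g
    have h2 := key _ (mul_mem hs2i hzD) (g⁻¹ : Aˣ)
    rw [mul_assoc _ _ D, e3, ← hcs] at h1
    rw [mul_assoc _ _ D, e3, ← hcs'] at h2
    rw [Units.val_mul, ← mul_assoc, Subalgebra.mem_center_iff.1 hs2C z, ← h1, mul_inv_rev,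
      Units.val_mul, Subalgebra.mem_center_iff.1 hs2i, ← mul_assoc z,
      Subalgebra.mem_center_iff.1 hs2i z, ← h2, ← hs4, Subalgebra.mem_center_iff.1 hzD,
      Subalgebra.mem_center_iff.1 hzD, mul_assoc _ _ (c : A), mul_assoc _ _ ((s ^ 4 * c : Aˣ) : A),
      ← Units.val_mul, ← Units.val_mul]
    congr 3
    group
  · rw [← Units.coe_star, star_mul, star_pow, hst, hss, ← Units.val_mul,
      ← (comms.pow_right 2).eq, mul_assoc, ← mul_assoc (t ^ 2), ← (comms.pow_right 2).eq, ← htg]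
    rw [pow_two s]
    group

end Balanced

open ComplexOrder

/-! ### Characters of simple modules. -/

section SimpleModules

variable {A : Type u} [Ring A] [Algebra ℂ A] [StarRing A] [StarModule ℂ A] [FiniteDimensional ℂ A]
  {τ : A →ₗ[ℂ] ℂ}

section Module

variable (V : Type u) [AddCommGroup V] [Module ℂ V] [Module A V] [IsScalarTower ℂ A V]
  [FiniteDimensional ℂ V]

/-- The character of a module. -/
def character : A →ₗ[ℂ] ℂ := LinearMap.trace ℂ V ∘ₗ (Algebra.lsmul ℂ ℂ V).toLinearMap

theorem character_apply (a : A) :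
    character V a = LinearMap.trace ℂ V (Algebra.lsmul ℂ ℂ V a) := rfl

theorem character_mul_comm (a b : A) : character V (a * b) = character V (b * a) := by
  simp only [character_apply, map_mul]
  exact LinearMap.trace_mul_comm _ _ _

variable [IsSimpleModule A V]

theorem character_one_ne_zero : character (A := A) V 1 ≠ 0 := by
  have : Nontrivial V := IsSimpleModule.nontrivial A V
  rw [character_apply, map_one, LinearMap.trace_one]
  exact_mod_cast Module.finrank_pos.ne'

/-- Central elements act on simple modules by scalars. -/
theorem exists_smul_eq_of_mem_center {z : A} (hz : z ∈ Subalgebra.center ℂ A) :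
    ∃ c : ℂ, ∀ v : V, z • v = c • v := by
  have : Nontrivial V := IsSimpleModule.nontrivial A V
  obtain ⟨c, hc⟩ := Module.End.exists_eigenvalue (Algebra.lsmul ℂ ℂ V z)
  refine ⟨c, ?_⟩
  let N : Submodule A V :=
    { carrier := {v | z • v = c • v}
      add_mem' := fun {a b} ha hb => by
        change z • (a + b) = c • (a + b)
        rw [smul_add, smul_add]
        exact congrArg₂ (· + ·) ha hb
      zero_mem' := by simp
      smul_mem' := fun a v hv => by
        change z • a • v = c • a • v
        have hv' : z • v = c • v := hv
        rw [← mul_smul, ← Subalgebra.mem_center_iff.1 hz, mul_smul, hv', smul_algebra_smul_comm] }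
  obtain ⟨v, hv, hv0⟩ := hc.exists_hasEigenvector
  have hN : N = ⊤ := (eq_bot_or_eq_top N).resolve_left fun h => hv0 (by
    have : v ∈ N := Module.End.mem_eigenspace_iff.1 hv
    rwa [h, Submodule.mem_bot] at this)
  intro v
  have : v ∈ N := hN ▸ Submodule.mem_top
  exact this

variable {V}

theorem character_mul_of_smul {z : A} {c : ℂ} (h : ∀ v : V, z • v = c • v) (a : A) :
    character V (z * a) = c * character V a := by
  have : Algebra.lsmul ℂ ℂ V (z * a) = c • Algebra.lsmul ℂ ℂ V a := by
    ext v
    simp [h]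
  rw [character_apply, this, map_smul, smul_eq_mul, character_apply]

theorem character_casimir (n : ℕ) (e : Fin n → A) (x : A) :
    character V (∑ i, e i * x * star (e i)) = character V ((∑ i, star (e i) * e i) * x) := by
  simp only [Finset.sum_mul, map_sum]
  refine Finset.sum_congr rfl fun i _ => ?_
  rw [character_mul_comm, mul_assoc]

end Module

/-- A character is a trace, hence `τ(c ·)` with `c` central. -/
theorem IsBalanced.trace_eq (hτ : IsFaithful τ) (hc : ∀ a b, τ (a * b) = τ (b * a)) {g : Aˣ}
    (hg : IsBalanced τ g) (V : Type u) [AddCommGroup V] [Module ℂ V] [Module A V]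
    [IsScalarTower ℂ A V] [FiniteDimensional ℂ V] :
    character V ((g⁻¹ : Aˣ) : A) = character V (g : A) := by
  obtain ⟨c, hcc, h⟩ := hτ.exists_central_density hc (character V) (character_mul_comm V)
  rw [h, h, hg c hcc]

/-- The central element `Σ e_i g e_i*` is positive definite, so it acts on `V` by a nonzero scalar.
By cyclicity its character is a multiple of that of `g`, because `Σ e_i* e_i` is central too. -/
theorem character_ne_zero_of_pos (hτ : IsFaithful τ) (hc : ∀ a b, τ (a * b) = τ (b * a)) {g : Aˣ}
    (hp : ∃ a, (g : A) = star a * a) (V : Type u) [AddCommGroup V] [Module ℂ V] [Module A V]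
    [IsScalarTower ℂ A V] [FiniteDimensional ℂ V] [IsSimpleModule A V] :
    character V (g : A) ≠ 0 := by
  obtain ⟨n, e, he, hD, hD', he'⟩ := exists_casimir hτ hc
  obtain ⟨t, ht, htg, -⟩ := hτ.exists_unit_root g hp
  have hpd : IsPosDef τ (∑ i, e i * (g : A) * star (e i)) := by
    intro b hb
    have e1 : τ (star b * ((∑ i, e i * (g : A) * star (e i)) * b)) =
        ∑ i, τ (star ((t ^ 2 : Aˣ) * (star (e i) * b)) * ((t ^ 2 : Aˣ) * (star (e i) * b))) := by
      have : (g : A) = (t : A) * t * t * t := by rw [← htg]; simp [pow_succ]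
      simp [Finset.sum_mul, Finset.mul_sum, ht, this, pow_two, mul_assoc]
    rw [e1]
    refine lt_of_le_of_ne (Finset.sum_nonneg fun i _ => hτ.isPositive _) fun h => hb ?_
    have h2 := (Finset.sum_eq_zero_iff_of_nonneg fun i _ => hτ.isPositive _).1 h.symm
    exact he' b fun i => (Units.mul_right_eq_zero _).1 (hτ.eq_zero (h2 i (Finset.mem_univ i)))
  have hcc : ∑ i, e i * (g : A) * star (e i) ∈ Subalgebra.center ℂ A :=
    Subalgebra.mem_center_iff.2 (he _)
  obtain ⟨d, hd⟩ := exists_smul_eq_of_mem_center V (Subalgebra.mem_center_iff.2 hD)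
  obtain ⟨c, hcv⟩ := exists_smul_eq_of_mem_center V hcc
  have h1 := character_casimir (V := V) n e (g : A)
  rw [character_mul_of_smul hd, ← mul_one (∑ i, e i * (g : A) * star (e i)),
    character_mul_of_smul hcv] at h1
  intro h0
  rw [h0, mul_zero, mul_eq_zero] at h1
  have hc0 : c = 0 := h1.resolve_right (character_one_ne_zero V)
  obtain ⟨C, hC⟩ := hpd.isUnit
  have : Nontrivial V := IsSimpleModule.nontrivial A V
  obtain ⟨v, hv⟩ := exists_ne (0 : V)
  refine hv ?_
  rw [← one_smul A v, ← C.inv_mul, mul_smul, hC, hcv, hc0, zero_smul, smul_zero]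

/-- Take a minimal left ideal inside `Ac`. If `c` annihilated it, so would `c*`, since `(c* y)*(c*
y) = y* c* c y`. Then every element `y = bc` of it would satisfy `y* y = b* (c* y) = 0`. -/
theorem exists_simple_smul_ne_zero (hA : ∀ x : A, star x * x = 0 → x = 0) {c : A}
    (hc : c ∈ Subalgebra.center ℂ A) (h0 : c ≠ 0) :
    ∃ J : Submodule A A, IsSimpleModule A J ∧ ∃ v : J, c • v ≠ 0 := by
  have : IsArtinian A A := isArtinian_of_tower ℂ inferInstance
  have hne : Submodule.span A {c} ≠ ⊥ := by simpa using h0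
  obtain ⟨J, hJ, hle⟩ := (eq_bot_or_exists_atom_le (Submodule.span A {c})).resolve_left hne
  refine ⟨J, isSimpleModule_iff_isAtom.2 hJ, ?_⟩
  by_contra! h
  obtain ⟨y, hy, hy0⟩ := Submodule.exists_mem_ne_zero_of_ne_bot hJ.1
  refine hy0 ?_
  have h1 : c * y = 0 := congrArg Subtype.val (h ⟨y, hy⟩)
  have hc' := star_mem_center hc
  have h2 : star c * y = 0 := by
    refine hA _ ?_
    rw [star_mul, star_star, mul_assoc, ← mul_assoc c, ← Subalgebra.mem_center_iff.1 hc,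
      mul_assoc (star c), h1, mul_zero, mul_zero]
  obtain ⟨b, rfl⟩ := Submodule.mem_span_singleton.1 (hle hy)
  refine hA _ ?_
  rw [smul_eq_mul] at h2 ⊢
  rw [star_mul, ← Subalgebra.mem_center_iff.1 hc', mul_assoc, h2, mul_zero]

/-- The central element `Σ e_i (g - g⁻¹) e_i*` acts on simple modules by scalars, which vanish
because the characters agree; so it is zero. Dividing by `Σ e_i* e_i` turns this into the condition
on `τ`. -/
theorem isBalanced_of_trace_eq (hA : ∀ x : A, star x * x = 0 → x = 0) (hτ : IsFaithful τ)
    (hc : ∀ a b, τ (a * b) = τ (b * a)) {g : Aˣ}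
    (h : ∀ (V : Type u) [AddCommGroup V] [Module ℂ V] [Module A V] [IsScalarTower ℂ A V]
      [FiniteDimensional ℂ V] [IsSimpleModule A V],
      character V ((g⁻¹ : Aˣ) : A) = character V (g : A)) : IsBalanced τ g := by
  obtain ⟨n, e, he, hD, hD', -⟩ := exists_casimir hτ hc
  set x : A := g - (g⁻¹ : Aˣ) with hx
  have hcc : ∑ i, e i * x * star (e i) ∈ Subalgebra.center ℂ A :=
    Subalgebra.mem_center_iff.2 (he _)
  have h1 : ∑ i, e i * x * star (e i) = 0 := by
    by_contra h0
    obtain ⟨J, hJ, v, hv⟩ := exists_simple_smul_ne_zero hA hcc h0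
    obtain ⟨d, hd⟩ := exists_smul_eq_of_mem_center J (Subalgebra.mem_center_iff.2 hD)
    obtain ⟨c, hcv⟩ := exists_smul_eq_of_mem_center J hcc
    have h1 := character_casimir (V := J) n e x
    rw [character_mul_of_smul hd, ← mul_one (∑ i, e i * x * star (e i)),
      character_mul_of_smul hcv, hx, map_sub, h J, sub_self, mul_zero, mul_eq_zero] at h1
    have hc0 : c = 0 := h1.resolve_right (character_one_ne_zero J)
    rw [hcv, hc0, zero_smul] at hv
    exact hv rfl
  obtain ⟨D, hDD⟩ := hD'.isUnit
  have hDc : (D : A) ∈ Subalgebra.center ℂ A := Subalgebra.mem_center_iff.2 (by rwa [hDD])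
  intro z hz
  have h2 : τ (z * (D⁻¹ : Aˣ) * ∑ i, e i * x * star (e i)) = τ (z * x) := by
    have hzD := mul_mem hz (inv_mem_center hDc)
    have h3 : z * x = z * (D⁻¹ : Aˣ) * D * x := by simp [mul_assoc]
    rw [h3, hDD]
    generalize z * (D⁻¹ : Aˣ) = y at hzD
    simp only [Finset.mul_sum, Finset.sum_mul, map_sum]
    refine Finset.sum_congr rfl fun i _ => ?_
    rw [← mul_assoc, hc, ← mul_assoc, ← mul_assoc, Subalgebra.mem_center_iff.1 hzD (star (e i)),
      mul_assoc y]
  rw [h1, mul_zero, map_zero, hx, mul_sub, map_sub] at h2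
  exact (sub_eq_zero.1 h2.symm)

end SimpleModules

open ComplexOrder

/-! ### The canonical element: existence, uniqueness and antipode. -/

section Canonical

variable {H : Type u} [Ring H] [Algebra ℂ H] [Coalgebra ℂ H] [StarRing H] [StarModule ℂ H]
  [CStarQuantumGroupoid H]

local notation "Δ₁" => comulOne ℂ H
local notation "T" => antipodeInv (H := H)
local notation "τ" => regularTrace H

variable (H) in
theorem isFaithful_regularTrace' : IsFaithful (τ) :=
  isFaithful_regularTrace CStarQuantumGroupoid.star_mul_self_eq_zero

variable (H) in
-- `τ ∘ S` is again a trace. Its central density replaces any claim that `τ` is invariant under `S`.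
theorem exists_regularTrace_antipode : ∃ κ ∈ Subalgebra.center ℂ H, ∀ x, τ (S ℂ x) = τ (κ * x) :=
  (isFaithful_regularTrace' H).exists_central_density regularTrace_mul_comm (τ ∘ₗ S ℂ)
    fun a b => by
      simp only [LinearMap.comp_apply, S, antipode_mul]
      exact regularTrace_mul_comm _ _

/-- `zu` implements `S²` for every invertible central `z`; the point is positivity. For `z = Σ e_i κ
u⁻¹ e_i*` one finds `τ(b* z u b) = Σ τ(S(b e_i)* S(b e_i))`, because `u⁻¹ c* u = S⁻²(c*)` and `S(c)*
= S⁻¹(c*)`. -/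
theorem IsQuasitriangular.exists_pos_implementing {R : H ⊗[ℂ] H} (hR : IsQuasitriangular R) :
    ∃ g : Hˣ, (∃ a, (g : H) = star a * a) ∧ ∀ h : H, S ℂ (S ℂ h) = g * h * (g⁻¹ : Hˣ) := by
  have hτ := isFaithful_regularTrace' H
  obtain ⟨κ, hκ, hκS⟩ := exists_regularTrace_antipode H
  obtain ⟨n, e, he, -, -, he'⟩ := exists_casimir hτ regularTrace_mul_comm
  obtain ⟨w, hw⟩ := hR.isUnit_drinfeldElement
  have hu : ∀ h : H, w * h = S ℂ (S ℂ h) * w := fun h => by rw [hw, hR.drinfeldElement_mul]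
  have h1 : ∀ c : H, τ (κ * ((w⁻¹ : Hˣ) * star c * w) * c) = τ (star (S ℂ c) * S ℂ c) := by
    intro c
    have e1 : (w⁻¹ : Hˣ) * star c * w = T (T (star c)) := by
      rw [mul_assoc, Units.inv_mul_eq_iff_eq_mul, hu, antipode_antipodeInv, antipode_antipodeInv]
    rw [e1, mul_assoc, ← hκS, S, antipode_mul, antipode_antipodeInv, regularTrace_mul_comm,
      star_antipode]
  set z := ∑ i, e i * (κ * (w⁻¹ : Hˣ)) * star (e i) with hz
  have hzc : ∀ h, h * z = z * h := he _
  have hpd : IsPosDef (τ) (z * w) := by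
    intro b hb
    have e1 : τ (star b * (z * w * b)) = ∑ i, τ (star (S ℂ (b * e i)) * S ℂ (b * e i)) := by
      rw [mul_assoc z, ← mul_assoc, hzc, hz, Finset.sum_mul, Finset.sum_mul, map_sum]
      refine Finset.sum_congr rfl fun i _ => ?_
      rw [← h1, mul_assoc, mul_assoc, mul_assoc, regularTrace_mul_comm]
      simp only [star_mul, mul_assoc]
    rw [e1]
    refine lt_of_le_of_ne (Finset.sum_nonneg fun i _ => hτ.isPositive _) fun h => hb ?_
    have h2 := (Finset.sum_eq_zero_iff_of_nonneg fun i _ => hτ.isPositive _).1 h.symm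
    refine star_eq_zero.1 (he' _ fun i => ?_)
    have h3 := hτ.eq_zero (h2 i (Finset.mem_univ i))
    have h4 : b * e i = 0 := by rw [← antipodeInv_antipode (b * e i), h3, map_zero]
    rw [← star_mul, h4, star_zero]
  obtain ⟨t, ht, ht4, -⟩ := hpd.exists_root hτ
  obtain ⟨g, hg⟩ := hpd.isUnit
  refine ⟨g, ⟨t ^ 2, ?_⟩, fun h => ?_⟩
  · rw [hg, ← ht4, star_pow, ht, ← pow_add]
  · rw [Units.eq_mul_inv_iff_mul_eq, hg, ← mul_assoc, hzc, mul_assoc, ← hu, mul_assoc]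

/-- The properties that characterise the canonical group-like element. -/
structure IsCanonical (g : Hˣ) : Prop where
  balanced : IsBalanced (τ) g
  pos : ∃ a, (g : H) = star a * a
  antipode_sq : ∀ h : H, S ℂ (S ℂ h) = g * h * (g⁻¹ : Hˣ)

theorem IsCanonical.unique {g g' : Hˣ} (hg : IsCanonical g) (hg' : IsCanonical g') : g' = g :=
  hg.balanced.unique (isFaithful_regularTrace' H) hg'.balanced hg.pos hg'.pos fun x => by
    rw [← hg.antipode_sq, hg'.antipode_sq]

theorem IsQuasitriangular.exists_isCanonical {R : H ⊗[ℂ] H} (hR : IsQuasitriangular R) :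
    ∃ g : Hˣ, IsCanonical g := by
  obtain ⟨g, hg, hgS⟩ := hR.exists_pos_implementing
  obtain ⟨w, hw, hb, hp⟩ := exists_balanced (isFaithful_regularTrace' H) regularTrace_mul_comm g hg
  refine ⟨w * g, hb, hp, fun h => ?_⟩
  rw [hgS, mul_inv_rev, Units.val_mul, Units.val_mul, ← mul_assoc, Units.eq_mul_inv_iff_mul_eq,
    Subalgebra.mem_center_iff.1 hw]
  simp [mul_assoc]

variable {g : Hˣ} (hg : IsCanonical g)

include hg

theorem IsCanonical.antipode_sq_mul (h : H) : S ℂ (S ℂ h) * g = g * h := by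
  rw [hg.antipode_sq, mul_assoc, Units.inv_mul, mul_one]

theorem IsCanonical.mul_antipodeInv (h : H) : g * T h = S ℂ h * g := by
  rw [← hg.antipode_sq_mul, antipode_antipodeInv]

theorem IsCanonical.inv_mul_antipode (h : H) : (g⁻¹ : Hˣ) * S ℂ h = T h * (g⁻¹ : Hˣ) := by
  rw [Units.inv_mul_eq_iff_eq_mul, ← mul_assoc, hg.mul_antipodeInv, mul_assoc, Units.mul_inv,
    mul_one]

theorem IsCanonical.exists_root : ∃ t : Hˣ, star t = t ∧ t ^ 4 = g ∧ S ℂ (S ℂ (t : H)) = t := by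
  obtain ⟨t, ht, htg, -⟩ := (isFaithful_regularTrace' H).exists_unit_root g hg.pos
  refine ⟨t, Units.ext ht, htg, ?_⟩
  rw [hg.antipode_sq, ← htg, ← Units.val_mul, ← Units.val_mul]
  congr 1
  group

/-- `S(g⁻¹)` is canonical too, so uniqueness gives `S(g⁻¹) = g`. Balance passes through `S` since
`τ(z S(x)) = τ(κ S⁻¹(z) x)` with `κ S⁻¹(z)` central. Positivity holds because `t⁻²`, with `t⁴ = g`,
is fixed by `S²`, which makes `S(t⁻²)` self-adjoint. -/
theorem IsCanonical.antipode : S ℂ (g : H) = (g⁻¹ : Hˣ) := by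
  have hanti : ∀ a b : H, a * b = 1 → S ℂ b * S ℂ a = 1 := fun a b h => by
    rw [S, ← antipode_mul, h, antipode_one]
  obtain ⟨κ, hκ, hκS⟩ := exists_regularTrace_antipode H
  obtain ⟨t, ht, htg, htS⟩ := hg.exists_root
  let k : Hˣ := ⟨S ℂ ((g⁻¹ : Hˣ) : H), S ℂ (g : H), hanti _ _ g.mul_inv, hanti _ _ g.inv_mul⟩
  have hk : IsCanonical k := by
    refine ⟨fun z hz => ?_, ⟨S ℂ (((t ^ 2)⁻¹ : Hˣ) : H), ?_⟩, fun h => ?_⟩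
    · change τ (z * S ℂ ((g⁻¹ : Hˣ) : H)) = τ (z * S ℂ (g : H))
      have hz' : κ * T z ∈ Subalgebra.center ℂ H := mul_mem hκ <|
        Subalgebra.mem_center_iff.2 fun b => by
          rw [← antipodeInv_antipode b, ← antipodeInv_mul, ← antipodeInv_mul,
            Subalgebra.mem_center_iff.1 hz]
      have e1 : ∀ x, τ (z * S ℂ x) = τ (κ * T z * x) := by
        intro x
        rw [mul_assoc, ← hκS, S, antipode_mul, antipode_antipodeInv, regularTrace_mul_comm]
      rw [e1, e1, hg.balanced _ hz']
    · have h1 : star (S ℂ (((t ^ 2)⁻¹ : Hˣ) : H)) = S ℂ (((t ^ 2)⁻¹ : Hˣ) : H) := by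
        have e1 : S ℂ (S ℂ (((t ^ 2)⁻¹ : Hˣ) : H)) = ((t ^ 2)⁻¹ : Hˣ) := by
          rw [hg.antipode_sq, ← htg, ← Units.val_mul, ← Units.val_mul]
          congr 1
          group
        rw [S, star_antipode, ← Units.coe_star, star_inv, star_pow, ht]
        conv_lhs => rw [← e1]
        rw [S, antipodeInv_antipode]
      rw [h1, S, ← antipode_mul, ← Units.val_mul, ← mul_inv_rev, ← pow_add, htg]
    · obtain ⟨x, rfl⟩ : ∃ x, S ℂ x = h := ⟨T h, antipode_antipodeInv h⟩
      change _ = S ℂ ((g⁻¹ : Hˣ) : H) * S ℂ x * S ℂ (g : H)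
      rw [hg.antipode_sq x, S, antipode_mul, antipode_mul, mul_assoc]
  exact congrArg Units.inv (hg.unique hk)

end Canonical

open ComplexOrder

/-! ### The canonical element is group-like. -/

section CanonicalComul

variable {H : Type u} [Ring H] [Algebra ℂ H] [Coalgebra ℂ H] [StarRing H] [StarModule ℂ H]
  [CStarQuantumGroupoid H]

local notation "Δ₁" => comulOne ℂ H
local notation "T" => antipodeInv (H := H)
local notation "τ" => regularTrace H
local notation "ττ" => tensorFunctional (regularTrace H) (regularTrace H)

/-- `id ⊗ f`. -/
def sliceRight (f : H →ₗ[ℂ] ℂ) : H ⊗[ℂ] H →ₗ[ℂ] H :=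
  (TensorProduct.rid ℂ H).toLinearMap ∘ₗ f.lTensor H

/-- `f ⊗ id`. -/
def sliceLeft (f : H →ₗ[ℂ] ℂ) : H ⊗[ℂ] H →ₗ[ℂ] H :=
  (TensorProduct.lid ℂ H).toLinearMap ∘ₗ f.rTensor H

@[simp]
theorem sliceRight_tmul (f : H →ₗ[ℂ] ℂ) (a b : H) : sliceRight f (a ⊗ₜ b) = f b • a := by
  simp [sliceRight]

@[simp]
theorem sliceLeft_tmul (f : H →ₗ[ℂ] ℂ) (a b : H) : sliceLeft f (a ⊗ₜ b) = f a • b := by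
  simp [sliceLeft]

theorem sliceRight_mul (f : H →ₗ[ℂ] ℂ) (h : H) (X : H ⊗[ℂ] H) :
    sliceRight f ((h ⊗ₜ 1) * X) = h * sliceRight f X := by
  induction X with
  | zero => simp
  | add a b ha hb => simp only [map_add, mul_add, ha, hb]
  | tmul a b => simp

theorem sliceRight_mul' (f : H →ₗ[ℂ] ℂ) (h : H) (X : H ⊗[ℂ] H) :
    sliceRight f (X * (h ⊗ₜ 1)) = sliceRight f X * h := by
  induction X with
  | zero => simp
  | add a b ha hb => simp only [map_add, add_mul, ha, hb]
  | tmul a b => simp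

theorem sliceLeft_mul (f : H →ₗ[ℂ] ℂ) (h : H) (X : H ⊗[ℂ] H) :
    sliceLeft f ((1 ⊗ₜ h) * X) = h * sliceLeft f X := by
  induction X with
  | zero => simp
  | add a b ha hb => simp only [map_add, mul_add, ha, hb]
  | tmul a b => simp

theorem sliceLeft_mul' (f : H →ₗ[ℂ] ℂ) (h : H) (X : H ⊗[ℂ] H) :
    sliceLeft f (X * (1 ⊗ₜ h)) = sliceLeft f X * h := by
  induction X with
  | zero => simp
  | add a b ha hb => simp only [map_add, add_mul, ha, hb]
  | tmul a b => simp

theorem tensorFunctional_eq_sliceRight (f₁ f₂ : H →ₗ[ℂ] ℂ) (a b : H) (X : H ⊗[ℂ] H) :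
    tensorFunctional f₁ f₂ ((a ⊗ₜ b) * X) = f₁ (a * sliceRight (f₂ ∘ₗ LinearMap.mulLeft ℂ b) X) := by
  induction X with
  | zero => simp
  | add a b ha hb => simp only [map_add, mul_add, ha, hb]
  | tmul a b => simp [mul_comm]

theorem tensorFunctional_eq_sliceLeft (f₁ f₂ : H →ₗ[ℂ] ℂ) (a b : H) (X : H ⊗[ℂ] H) :
    tensorFunctional f₁ f₂ ((a ⊗ₜ b) * X) = f₂ (b * sliceLeft (f₁ ∘ₗ LinearMap.mulLeft ℂ a) X) := by
  induction X with
  | zero => simp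
  | add a b ha hb => simp only [map_add, mul_add, ha, hb]
  | tmul a b => simp

theorem tensorFunctional_mul_comm (X Y : H ⊗[ℂ] H) : ττ (X * Y) = ττ (Y * X) := by
  induction X with
  | zero => simp
  | add a b ha hb => simp only [map_add, add_mul, mul_add, ha, hb]
  | tmul a b =>
    induction Y with
    | zero => simp
    | add a b ha hb => simp only [map_add, add_mul, mul_add, ha, hb]
    | tmul c d =>
      simp only [Algebra.TensorProduct.tmul_mul_tmul, tensorFunctional_tmul]
      rw [regularTrace_mul_comm a, regularTrace_mul_comm b]

variable (H) in
theorem isFaithful_tensor : IsFaithful (ττ) :=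
  (isFaithful_regularTrace' H).tensor_isFaithful (isFaithful_regularTrace' H)

/-- The elements of the corner `Δ(1)(H ⊗ H)Δ(1)` that commute with the image of `Δ`. -/
structure CommutesComul (e : H ⊗[ℂ] H) : Prop where
  corner : Δ₁ * e = e
  comm : ∀ h : H, Δ h * e = e * Δ h

theorem CommutesComul.corner' {e : H ⊗[ℂ] H} (he : CommutesComul e) : e * Δ₁ = e := by
  rw [comulOne, ← he.comm]
  exact he.corner

theorem CommutesComul.star {e : H ⊗[ℂ] H} (he : CommutesComul e) : CommutesComul (star e) := by
  refine ⟨?_, fun h => ?_⟩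
  · have := congrArg Star.star he.corner'
    rwa [star_mul, star_comulOne] at this
  · have := congrArg Star.star (he.comm (Star.star h))
    rw [star_mul, star_mul, ← CStarQuantumGroupoid.comul_star, star_star] at this
    exact this.symm

theorem CommutesComul.mul {e f : H ⊗[ℂ] H} (he : CommutesComul e) (hf : CommutesComul f) :
    CommutesComul (e * f) :=
  ⟨by rw [← mul_assoc, he.corner], fun h => by
    rw [← mul_assoc, he.comm, mul_assoc, hf.comm, mul_assoc]⟩

theorem CommutesComul.sub {e f : H ⊗[ℂ] H} (he : CommutesComul e) (hf : CommutesComul f) :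
    CommutesComul (e - f) :=
  ⟨by rw [mul_sub, he.corner, hf.corner], fun h => by rw [mul_sub, sub_mul, he.comm, hf.comm]⟩

variable {g : Hˣ} (hg : IsCanonical g)

include hg

/-- The partial quantum trace of an endomorphism is an endomorphism. Write `(h ⊗ 1)Δ(1) = Σ (1 ⊗
S⁻¹(h₍₂₎))Δ(h₍₁₎)` and pass `Δ(h₍₁₎)` through `e`. By `g S⁻¹(y) = S(y) g` the remaining factor goes
round the trace and becomes `S(h₍₂₎)`, and the sum recombines to `Δ(1)(h ⊗ 1)`. -/
theorem IsCanonical.sliceRight_mem_center {e : H ⊗[ℂ] H} (he : CommutesComul e) :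
    sliceRight (τ ∘ₗ LinearMap.mulLeft ℂ (g : H)) e ∈ Subalgebra.center ℂ H := by
  rw [Subalgebra.mem_center_iff]
  intro h
  let r := ℛ ℂ h
  have h1 : ∀ (y : H) (X : H ⊗[ℂ] H),
      sliceRight (τ ∘ₗ LinearMap.mulLeft ℂ (g : H)) ((1 ⊗ₜ T y) * X) =
        sliceRight (τ ∘ₗ LinearMap.mulLeft ℂ (g : H)) (X * (1 ⊗ₜ S ℂ y)) := by
    intro y X
    induction X with
    | zero => simp
    | add a b ha hb => simp only [map_add, add_mul, mul_add, ha, hb]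
    | tmul a b =>
      simp only [Algebra.TensorProduct.tmul_mul_tmul, one_mul, mul_one, sliceRight_tmul,
        LinearMap.comp_apply, LinearMap.mulLeft_apply]
      rw [← mul_assoc, hg.mul_antipodeInv, mul_assoc, regularTrace_mul_comm, mul_assoc]
  rw [← sliceRight_mul, ← he.corner, ← mul_assoc, ← sum_antipodeInv_mul_comul r, Finset.sum_mul,
    map_sum]
  simp only [mul_assoc, h1, he.comm]
  rw [← map_sum, ← Finset.mul_sum, sum_comul_mul_antipode, ← mul_assoc, he.corner', he.corner,
    sliceRight_mul']

/-- The mirror image; `g⁻¹` replaces `g` because on the first leg `S` must become `S⁻¹`. -/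
theorem IsCanonical.sliceLeft_mem_center {e : H ⊗[ℂ] H} (he : CommutesComul e) :
    sliceLeft (τ ∘ₗ LinearMap.mulLeft ℂ ((g⁻¹ : Hˣ) : H)) e ∈ Subalgebra.center ℂ H := by
  rw [Subalgebra.mem_center_iff]
  intro h
  let r := ℛ ℂ h
  have h1 : ∀ (y : H) (X : H ⊗[ℂ] H),
      sliceLeft (τ ∘ₗ LinearMap.mulLeft ℂ ((g⁻¹ : Hˣ) : H)) ((S ℂ y ⊗ₜ 1) * X) =
        sliceLeft (τ ∘ₗ LinearMap.mulLeft ℂ ((g⁻¹ : Hˣ) : H)) (X * (T y ⊗ₜ 1)) := by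
    intro y X
    induction X with
    | zero => simp
    | add a b ha hb => simp only [map_add, add_mul, mul_add, ha, hb]
    | tmul a b =>
      simp only [Algebra.TensorProduct.tmul_mul_tmul, one_mul, mul_one, sliceLeft_tmul,
        LinearMap.comp_apply, LinearMap.mulLeft_apply]
      rw [← mul_assoc, hg.inv_mul_antipode, mul_assoc, regularTrace_mul_comm, mul_assoc]
  rw [← sliceLeft_mul, ← he.corner, ← mul_assoc, ← sum_antipode_mul_comul r, Finset.sum_mul,
    map_sum]
  simp only [mul_assoc, h1, he.comm]
  rw [← map_sum, ← Finset.mul_sum, sum_comul_mul_antipodeInv, ← mul_assoc, he.corner', he.corner,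
    sliceLeft_mul']

/-- Balance is used in one leg at a time: the central right slice leads from `g ⊗ g` to `g⁻¹ ⊗ g`,
the central left slice from there to `g⁻¹ ⊗ g⁻¹`. -/
theorem IsCanonical.tensor_eq {e : H ⊗[ℂ] H} (he : CommutesComul e) :
    ττ (((g : H) ⊗ₜ[ℂ] (g : H)) * e) = ττ ((((g⁻¹ : Hˣ) : H) ⊗ₜ ((g⁻¹ : Hˣ) : H)) * e) := by
  rw [tensorFunctional_eq_sliceRight, regularTrace_mul_comm,
    hg.balanced _ (hg.sliceRight_mem_center he), regularTrace_mul_comm,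
    ← tensorFunctional_eq_sliceRight, tensorFunctional_eq_sliceLeft, regularTrace_mul_comm,
    hg.balanced _ (hg.sliceLeft_mem_center he), regularTrace_mul_comm,
    ← tensorFunctional_eq_sliceLeft]

/-- As `e` commutes with the image of `Δ`, the functional `h ↦ (τ ⊗ τ)(Δ(h) e)` is a trace on `H`
and has a central density. -/
theorem IsCanonical.comul_eq {e : H ⊗[ℂ] H} (he : CommutesComul e) :
    ττ (Δ (g : H) * e) = ττ (Δ ((g⁻¹ : Hˣ) : H) * e) := by
  obtain ⟨c, hc, h⟩ := (isFaithful_regularTrace' H).exists_central_density regularTrace_mul_comm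
    (ττ ∘ₗ LinearMap.mulRight ℂ e ∘ₗ Δ) fun a b => by
      simp only [LinearMap.comp_apply, LinearMap.mulRight_apply, comul_mul]
      rw [mul_assoc, he.comm, ← mul_assoc, tensorFunctional_mul_comm, mul_assoc]
  have h1 := h g
  have h2 := h ((g⁻¹ : Hˣ) : H)
  simp only [LinearMap.comp_apply, LinearMap.mulRight_apply] at h1 h2
  rw [h1, h2, hg.balanced c hc]

/-- Both `g ⊗ g` and `Δ(g)` implement `S² ⊗ S²` on `Δ(h)`, the second because `Δ ∘ S² = (S² ⊗ S²) ∘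
Δ`. -/
theorem IsCanonical.mul_comul (h : H) : ((g : H) ⊗ₜ[ℂ] (g : H)) * Δ h = Δ (g : H) * Δ h * Δ ((g⁻¹ : Hˣ) : H) *
    ((g : H) ⊗ₜ[ℂ] (g : H)) := by
  have h1 : Δ (S ℂ (S ℂ h)) = TensorProduct.map (S ℂ (H := H) ∘ₗ S ℂ) (S ℂ (H := H) ∘ₗ S ℂ) (Δ h) := by
    have h2 : ∀ X : H ⊗[ℂ] H, TensorProduct.comm ℂ H H
        (TensorProduct.map (S ℂ (H := H)) (S ℂ (H := H)) (TensorProduct.comm ℂ H H X)) =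
        TensorProduct.map (S ℂ (H := H)) (S ℂ (H := H)) X := by
      intro X
      induction X with
      | zero => simp
      | add a b ha hb => simp only [map_add, ha, hb]
      | tmul a b => simp
    rw [S, QuantumGroupoid.comul_antipode, comulOp_apply, QuantumGroupoid.comul_antipode,
      comulOp_apply, h2, TensorProduct.map_comp]
    rfl
  have h2 : ∀ X : H ⊗[ℂ] H, ((g : H) ⊗ₜ[ℂ] (g : H)) * X =
      TensorProduct.map (S ℂ (H := H) ∘ₗ S ℂ) (S ℂ (H := H) ∘ₗ S ℂ) X * ((g : H) ⊗ₜ[ℂ] (g : H)) := by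
    intro X
    induction X with
    | zero => simp
    | add a b ha hb => simp only [map_add, mul_add, add_mul, ha, hb]
    | tmul a b => simp [hg.antipode_sq_mul]
  rw [h2, ← h1, hg.antipode_sq, comul_mul, comul_mul]

theorem IsCanonical.tmul_mul_comulOne : ((g : H) ⊗ₜ[ℂ] (g : H)) * Δ₁ = Δ₁ * ((g : H) ⊗ₜ[ℂ] (g : H)) := by
  rw [comulOne, hg.mul_comul, ← comul_mul, mul_one, ← comul_mul, Units.mul_inv]

/-- The uniqueness argument for balanced elements, in the corner cut out by `Δ(1)`, for `W =
Δ(g⁻¹)(g ⊗ g)` in the commutant of `Δ(H)`; its inverse there is `V`. Balance of `g` leg by leg, and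
of `g` through `Δ`, gives `(τ ⊗ τ)(Δ(g)(W - V)e) = 0` for all `e` in the commutant. Taking `e = (W -
V)*` yields `W = V`, and positivity yields `W = Δ(1)`. -/
theorem IsCanonical.comul : Δ (g : H) = ((g : H) ⊗ₜ[ℂ] (g : H)) * Δ₁ := by
  obtain ⟨t, ht, htg, -⟩ := hg.exists_root
  set G : H ⊗[ℂ] H := (g : H) ⊗ₜ[ℂ] (g : H) with hG
  set G' : H ⊗[ℂ] H := ((g⁻¹ : Hˣ) : H) ⊗ₜ ((g⁻¹ : Hˣ) : H) with hG'
  have hGG' : G * G' = 1 := by simp [hG, hG', Algebra.TensorProduct.one_def]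
  have hG'G : G' * G = 1 := by simp [hG, hG', Algebra.TensorProduct.one_def]
  set D := Δ (g : H) with hD
  set D' := Δ ((g⁻¹ : Hˣ) : H) with hD'
  have hDD' : D * D' = Δ₁ := by rw [hD, hD', ← comul_mul, Units.mul_inv, comulOne]
  have hD'D : D' * D = Δ₁ := by rw [hD, hD', ← comul_mul, Units.inv_mul, comulOne]
  have e1 : ∀ h, Δ₁ * Δ h = Δ h := comulOne_mul_comul
  have e2 : ∀ h, Δ h * Δ₁ = Δ h := comul_mul_comulOne
  have hc : ∀ h, G * Δ h = D * Δ h * D' * G := hg.mul_comul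
  have hG1 : G * Δ₁ = Δ₁ * G := hg.tmul_mul_comulOne
  have hG1' : G' * Δ₁ = Δ₁ * G' := by
    calc G' * Δ₁ = G' * Δ₁ * (G * G') := by rw [hGG', mul_one]
      _ = G' * (Δ₁ * G) * G' := by simp only [mul_assoc]
      _ = Δ₁ * G' := by rw [← hG1, ← mul_assoc, hG'G, one_mul]
  have hW : CommutesComul (D' * G) := ⟨by rw [← mul_assoc, e1], fun h => by
    rw [mul_assoc D', hc]; simp only [← mul_assoc, hD'D, e1]⟩
  have hV : CommutesComul (G' * D) := ⟨by rw [← mul_assoc, ← hG1', mul_assoc, e1], fun h => by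
    have h1 := congrArg (fun x => G' * x * G' * D) (hc h)
    simp only [mul_assoc] at h1
    rw [← mul_assoc G' G, hG'G, one_mul, ← mul_assoc G G', hGG', one_mul, hD'D, e2] at h1
    rw [h1, mul_assoc]⟩
  have hWV : D' * G * (G' * D) = Δ₁ := by
    rw [mul_assoc, ← mul_assoc G, hGG', one_mul, hD'D]
  have hVW : G' * D * (D' * G) = Δ₁ := by
    rw [mul_assoc, ← mul_assoc D, hDD', ← hG1, ← mul_assoc, hG'G, one_mul]
  set W := D' * G with hWd
  set V := G' * D with hVd
  have hDW : D * W = G * Δ₁ := by rw [hWd, ← mul_assoc, hDD', hG1]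
  have hD'V : D' * V = G' * Δ₁ := by rw [hV.comm, hVd, mul_assoc, hDD']
  have key : ∀ e, CommutesComul e → ττ (D * (W - V) * e) = 0 := by
    intro e he
    have h1 := hg.tensor_eq he
    have h2 := hg.comul_eq (hV.mul he)
    change ττ (G * e) = ττ (G' * e) at h1
    rw [← he.corner, ← mul_assoc, ← mul_assoc, ← hDW, ← hD'V] at h1
    rw [mul_sub, sub_mul, map_sub, h1, sub_eq_zero, mul_assoc D, h2, mul_assoc]
  have hroot : ∃ s : H, star s = s ∧ s * s = g ∧ ∃ s' : H, star s' = s' ∧ s * s' = 1 ∧ s' * s = 1 ∧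
      s' * s' = (g⁻¹ : Hˣ) := by
    refine ⟨(t ^ 2 : Hˣ), ?_, ?_, ((t ^ 2)⁻¹ : Hˣ), ?_, Units.mul_inv _, Units.inv_mul _, ?_⟩
    · rw [← Units.coe_star, star_pow, ht]
    · rw [← Units.val_mul, ← pow_add, htg]
    · rw [← Units.coe_star, star_inv, star_pow, ht]
    · rw [← Units.val_mul, ← mul_inv_rev, ← pow_add, htg]
  obtain ⟨s, hs, hsg, s', hs', hss', hs's, hsg'⟩ := hroot
  have hy := hW.sub hV
  have h0 : W - V = 0 := by
    set y := W - V
    have h1 := key _ hy.star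
    have h2 : ττ (star (star y * Δ s) * (star y * Δ s)) = 0 := by
      rw [← h1, star_mul, star_star, ← CStarQuantumGroupoid.comul_star, hs, hD, ← hsg, comul_mul,
        tensorFunctional_mul_comm, mul_assoc (star y), ← mul_assoc (Δ s), tensorFunctional_mul_comm,
        mul_assoc, mul_assoc]
    have h3 := (isFaithful_tensor H).eq_zero h2
    have h4 : star y = 0 := by
      rw [← hy.star.corner', comulOne, ← hss', comul_mul, ← mul_assoc, h3, zero_mul]
    exact star_eq_zero.1 h4
  have hW2 : W * W = Δ₁ := by
    conv_lhs => rw [sub_eq_zero.1 h0]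
    rw [← hVW, sub_eq_zero.1 h0]
  -- Here `s` and `s'` are square roots of `g` and `g⁻¹`; `W` commutes with `Δ(s')`, so the factors
  -- `Δ(s')` can be collected against `Δ(g)`.
  have hpos : W = star ((s ⊗ₜ s) * Δ s') * ((s ⊗ₜ s) * Δ s') := by
    have h1 : star (s ⊗ₜ[ℂ] s) * (s ⊗ₜ s) = G := by simp [hs, hsg, hG]
    rw [star_mul, ← CStarQuantumGroupoid.comul_star, hs', mul_assoc, ← mul_assoc (star (s ⊗ₜ[ℂ] s)),
      h1]
    have h2 : G * Δ s' = D * W * Δ s' := by rw [hDW, mul_assoc, e1]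
    rw [h2, mul_assoc, ← hW.comm, ← mul_assoc D, ← mul_assoc, hD, ← comul_mul, ← comul_mul, ← hsg,
      mul_assoc s, hss', mul_one, hs's]
    exact hW.corner.symm
  have h5 := (isFaithful_tensor H).isUnit_add_one ((s ⊗ₜ s) * Δ s')
  rw [← hpos] at h5
  have h6 : (W + 1) * (W - Δ₁) = 0 := by
    rw [mul_sub, add_mul, add_mul, hW2, hW.corner']; simp [add_comm]
  have h7 := sub_eq_zero.1 (h5.mul_right_eq_zero.1 h6)
  rw [← hDW, h7, e2]

end CanonicalComul

/-! ### Agreement with the definition through irreducible representations. -/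

section CanonicalGrouplike

variable {H : Type u} [Ring H] [Algebra ℂ H] [Coalgebra ℂ H] [StarRing H] [StarModule ℂ H]
  [CStarQuantumGroupoid H]

theorem IsCanonical.isCanonicalGrouplike {g : Hˣ} (hg : IsCanonical g) :
    IsCanonicalGrouplike (g : H) where
  isUnit := g.isUnit
  positive := hg.pos
  antipode_sq h := by rw [hg.antipode_sq, Ring.inverse_unit]
  trace_eq V := by
    intro _ _ _ _ _ _
    rw [Ring.inverse_unit]
    exact ⟨hg.balanced.trace_eq (isFaithful_regularTrace' H) regularTrace_mul_comm V,
      character_ne_zero_of_pos (isFaithful_regularTrace' H) regularTrace_mul_comm hg.pos V⟩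
  antipode := by rw [hg.antipode, Ring.inverse_unit]
  comul := hg.comul
  comul' := by rw [hg.comul, hg.tmul_mul_comulOne]

theorem IsCanonicalGrouplike.isCanonical {g : Hˣ} (hg : IsCanonicalGrouplike (g : H)) :
    IsCanonical g where
  balanced := isBalanced_of_trace_eq CStarQuantumGroupoid.star_mul_self_eq_zero
    (isFaithful_regularTrace' H) regularTrace_mul_comm fun V => by
      intro _ _ _ _ _ _
      have := (hg.trace_eq V).1
      rwa [Ring.inverse_unit] at this
  pos := hg.positive
  antipode_sq h := by rw [hg.antipode_sq, Ring.inverse_unit]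

theorem IsQuasitriangular.existsUnique_isCanonicalGrouplike {R : H ⊗[ℂ] H}
    (hR : IsQuasitriangular R) : ∃! g : H, IsCanonicalGrouplike g := by
  obtain ⟨g, hg⟩ := hR.exists_isCanonical
  refine ⟨g, hg.isCanonicalGrouplike, fun g' hg' => ?_⟩
  obtain ⟨g', rfl⟩ := hg'.isUnit
  exact congrArg Units.val (hg.unique hg'.isCanonical)

end CanonicalGrouplike

open ComplexOrder

/-! ### Growth of powers of central elements. -/

section Growth

variable {A : Type u} [Ring A] [Algebra ℂ A] [StarRing A] [StarModule ℂ A]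

/-- Iteration gives `(a 1 / a 0)^(2^k) ≤ a (2^k) / a 0 ≤ C` for all `k`, which is impossible for a
ratio above `1`, however large `C` is. -/
theorem le_of_sq_le_mul {a : ℕ → ℝ} {C : ℝ} (h0 : 0 ≤ a 0) (h1 : ∀ n, a (n + 1) ≤ C * a 0)
    (h2 : ∀ n, a n ^ 2 ≤ a 0 * a (2 * n)) : a 1 ≤ a 0 := by
  rcases h0.eq_or_lt with h0 | h0
  · have := h1 0
    rwa [← h0, mul_zero, h0] at this
  by_contra! h
  have h3 : ∀ k, (a 1 / a 0) ^ 2 ^ k ≤ a (2 ^ k) / a 0 := by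
    intro k
    induction k with
    | zero => simp
    | succ k ih =>
      rw [pow_succ 2 k, pow_mul]
      have hpos : 0 ≤ (a 1 / a 0) ^ 2 ^ k := by
        have : 0 < a 1 / a 0 := div_pos (h0.trans h) h0
        positivity
      calc ((a 1 / a 0) ^ 2 ^ k) ^ 2 ≤ (a (2 ^ k) / a 0) ^ 2 := pow_le_pow_left₀ hpos ih 2
        _ ≤ a (2 ^ k * 2) / a 0 := by
          rw [div_pow, div_le_div_iff₀ (by positivity) h0, mul_comm (2 ^ k)]
          nlinarith [h2 (2 ^ k)]
  have h4 : ∀ k, (a 1 / a 0) ^ 2 ^ k ≤ C := by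
    intro k
    refine (h3 k).trans ?_
    rw [div_le_iff₀ h0]
    obtain ⟨m, hm⟩ := Nat.exists_eq_succ_of_ne_zero (pow_ne_zero k (two_ne_zero (α := ℕ)))
    rw [hm]
    exact h1 m
  have h5 : 1 < a 1 / a 0 := (one_lt_div h0).2 h
  obtain ⟨n, hn⟩ := pow_unbounded_of_one_lt C h5
  exact absurd ((pow_le_pow_right₀ h5.le (Nat.lt_two_pow_self (n := n)).le).trans (h4 n)) (not_le.2 hn)

/-- Apply the growth lemma to `a_n = f(r yⁿ r)` with `y = z r⁻²`, so that `a_0 = f(r²)` and `a_1 =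
f(z)`. Cauchy–Schwarz gives `a_n² ≤ a_0 a_{2n}`; the hypothesis with `w = r⁻ⁿ` gives the uniform
bound. -/
theorem IsPositiveFunctional.le_of_pow_le {f : A →ₗ[ℂ] ℂ} (hf : IsPositiveFunctional f)
    {z r i : A} (hz : z ∈ Subalgebra.center ℂ A) (hr : r ∈ Subalgebra.center ℂ A)
    (hi : i ∈ Subalgebra.center ℂ A) (hzs : star z = z) (hrs : star r = r) (his : star i = i)
    (hri : r * i = 1) {C : ℝ}
    (h : ∀ (n : ℕ) (w : A), star w = w → (f (w * (z ^ (n + 1) * w))).re ≤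
      C * (f (w * ((r * r) ^ (n + 1) * w))).re) : (f z).re ≤ (f (r * r)).re := by
  obtain ⟨z, rfl⟩ : ∃ z' : Subalgebra.center ℂ A, (z' : A) = z := ⟨⟨z, hz⟩, rfl⟩
  obtain ⟨r, rfl⟩ : ∃ r' : Subalgebra.center ℂ A, (r' : A) = r := ⟨⟨r, hr⟩, rfl⟩
  obtain ⟨i, rfl⟩ : ∃ i' : Subalgebra.center ℂ A, (i' : A) = i := ⟨⟨i, hi⟩, rfl⟩
  have hri' : r * i = 1 := Subtype.ext hri
  set y : Subalgebra.center ℂ A := z * (i * i) with hy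
  have hys : star (y : A) = y := by
    have h1 : i * i * z = y := by rw [hy, mul_comm]
    rw [hy]
    simp only [MulMemClass.coe_mul, star_mul, hzs, his]
    exact congrArg Subtype.val h1
  have h0 : r * (y ^ 0 * r) = r * r := by ring
  have h1 : r * (y ^ 1 * r) = z := by
    calc r * (y ^ 1 * r) = z * (r * i) * (r * i) := by rw [hy]; ring
      _ = z := by rw [hri', mul_one, mul_one]
  have key := le_of_sq_le_mul (a := fun n => (f ((r * (y ^ n * r) :) : Subalgebra.center ℂ A)).re)
    (C := C) ?_ (fun n => ?_) (fun n => ?_)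
  · simpa only [h0, h1, MulMemClass.coe_mul] using key
  · have := hf r
    rw [hrs] at this
    simpa only [h0, MulMemClass.coe_mul] using (Complex.nonneg_iff.1 this).1
  · have h2 := h n ((i ^ n : Subalgebra.center ℂ A) : A) (by
      simp only [SubmonoidClass.coe_pow, star_pow, his])
    have h3 : i ^ n * (z ^ (n + 1) * i ^ n) = r * (y ^ (n + 1) * r) := by
      calc i ^ n * (z ^ (n + 1) * i ^ n) = z ^ (n + 1) * i ^ n * i ^ n * 1 * 1 := by ring
        _ = z ^ (n + 1) * i ^ n * i ^ n * (r * i) * (r * i) := by rw [hri']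
        _ = r * (y ^ (n + 1) * r) := by rw [hy]; ring
    have h4 : i ^ n * ((r * r) ^ (n + 1) * i ^ n) = r * r := by
      calc i ^ n * ((r * r) ^ (n + 1) * i ^ n) = (r * i) ^ n * (r * i) ^ n * (r * r) := by ring
        _ = r * r := by rw [hri', one_pow, one_mul, one_mul]
    rw [← h3, h0, ← h4]
    exact_mod_cast h2
  · have h2 := hf.cauchy_schwarz (r : A) ((y ^ n * r : Subalgebra.center ℂ A) : A)
    have h3 : star ((y ^ n * r : Subalgebra.center ℂ A) : A) * ((y ^ n * r : _) : A) =
        ((r * (y ^ (2 * n) * r) : Subalgebra.center ℂ A) : A) := by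
      have e1 : star ((y ^ n * r : Subalgebra.center ℂ A) : A) = (r * y ^ n : _) := by
        simp only [MulMemClass.coe_mul, SubmonoidClass.coe_pow, star_mul, star_pow, hys, hrs]
      rw [e1, ← MulMemClass.coe_mul]
      congr 1
      ring
    rw [h3, hrs, ← MulMemClass.coe_mul, ← MulMemClass.coe_mul] at h2
    rw [h0]
    refine le_trans ?_ h2
    rw [← sq_abs]
    exact pow_le_pow_left₀ (abs_nonneg _) (Complex.abs_re_le_norm _) 2

variable [FiniteDimensional ℂ A]

/-- `C` is the squared operator norm of left multiplication by `x` on the Hilbert space of `f`; then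
`C - x* x` is positive and has a self-adjoint root. -/
theorem IsFaithful.exists_bound {f : A →ₗ[ℂ] ℂ} (hf : IsFaithful f) (x : A) :
    ∃ (C : ℝ) (y : A), star y * y = (C : ℂ) • 1 - star x * x := by
  let _ : NormedAddCommGroup A := hf.core.toNormedAddCommGroup
  let _ : InnerProductSpace ℂ A := InnerProductSpace.ofCore hf.core.toCore
  let L := LinearMap.toContinuousLinearMap (LinearMap.mulLeft ℂ x)
  have him : ∀ b, f (star b * b) = ((‖b‖ ^ 2 : ℝ) : ℂ) := fun b => by
    have := inner_self_eq_norm_sq_to_K (𝕜 := ℂ) b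
    exact_mod_cast this
  have hx : ∀ b, 0 ≤ f (star b * (((‖L‖ ^ 2 : ℝ) : ℂ) • 1 - star x * x) * b) := by
    intro b
    have e1 : star b * (((‖L‖ ^ 2 : ℝ) : ℂ) • 1 - star x * x) * b =
        ((‖L‖ ^ 2 : ℝ) : ℂ) • (star b * b) - star (x * b) * (x * b) := by
      simp [mul_sub, sub_mul, mul_assoc]
    rw [e1, map_sub, map_smul, him, him, smul_eq_mul, ← Complex.ofReal_mul, ← Complex.ofReal_sub,
      Complex.zero_le_real, sub_nonneg, ← mul_pow]
    exact pow_le_pow_left₀ (norm_nonneg _) (L.le_opNorm b) 2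
  obtain ⟨y, hy, hy'⟩ : ∃ y : A, star y = y ∧ y ^ 4 = ((‖L‖ ^ 2 : ℝ) : ℂ) • 1 - star x * x :=
    (hf.exists_root fun b => by rw [← mul_assoc]; exact hx b).elim fun _ h => ⟨_, h⟩
  refine ⟨‖L‖ ^ 2, y ^ 2, ?_⟩
  rw [star_pow, hy, ← pow_add, hy']

end Growth

open ComplexOrder

/-! ### Unitarity of the `R`-matrix. -/

section UnitaryR

variable {H : Type u} [Ring H] [Algebra ℂ H] [Coalgebra ℂ H] [StarRing H] [StarModule ℂ H]
  [CStarQuantumGroupoid H]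

local notation "Δ₁" => comulOne ℂ H
local notation "T" => antipodeInv (H := H)
local notation "τ" => regularTrace H
local notation "ττ" => tensorFunctional (regularTrace H) (regularTrace H)

theorem idComul_mul (X Y : H ⊗[ℂ] H) : idComul ℂ H (X * Y) = idComul ℂ H X * idComul ℂ H Y := by
  induction X with
  | zero => simp
  | add a b ha hb => simp only [map_add, add_mul, ha, hb]
  | tmul a b =>
    induction Y with
    | zero => simp
    | add a b ha hb => simp only [map_add, mul_add, ha, hb]
    | tmul c d => simp [idComul, comul_mul]

theorem idComul_star (X : H ⊗[ℂ] H) : idComul ℂ H (star X) = star (idComul ℂ H X) := by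
  induction X with
  | zero => simp
  | add a b ha hb => simp only [map_add, star_add, ha, hb]
  | tmul a b => simp [idComul, CStarQuantumGroupoid.comul_star]

theorem leg12_star (X : H ⊗[ℂ] H) : leg12 (star X) = star (leg12 X) := by
  induction X with
  | zero => simp
  | add a b ha hb => simp only [map_add, star_add, ha, hb]
  | tmul a b => simp [leg12]

theorem leg13_star (X : H ⊗[ℂ] H) : leg13 (star X) = star (leg13 X) := by
  induction X with
  | zero => simp
  | add a b ha hb => simp only [map_add, star_add, ha, hb]
  | tmul a b => simp [leg13]

/-- The convolution powers of a functional; the power with index `n` is the `n + 1`-st one. -/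
def convPow (f : H →ₗ[ℂ] ℂ) : ℕ → (H →ₗ[ℂ] ℂ)
  | 0 => f
  | n + 1 => tensorFunctional f (convPow f n) ∘ₗ Δ

theorem convPow_isPositive {f : H →ₗ[ℂ] ℂ} (hf : IsFaithful f) (n : ℕ) :
    IsPositiveFunctional (convPow f n) := by
  induction n with
  | zero => exact hf.isPositive
  | succ n ih =>
    intro a
    simp only [convPow, LinearMap.comp_apply, comul_mul, CStarQuantumGroupoid.comul_star]
    exact hf.tensor_isPositive ih _

theorem sliceRight_conv (f f' : H →ₗ[ℂ] ℂ) {X Y Q P : H ⊗[ℂ] H}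
    (h : idComul ℂ H P = leg12 X * leg13 Q * leg12 Y) :
    sliceRight (tensorFunctional f f' ∘ₗ Δ) P =
      sliceRight f (X * (sliceRight f' Q ⊗ₜ 1) * Y) := by
  let L : H ⊗[ℂ] (H ⊗[ℂ] H) →ₗ[ℂ] H :=
    (TensorProduct.rid ℂ H).toLinearMap ∘ₗ (tensorFunctional f f').lTensor H
  have h1 : sliceRight (tensorFunctional f f' ∘ₗ Δ) P = L (idComul ℂ H P) := by
    simp only [sliceRight, L, idComul, LinearMap.comp_apply, LinearMap.lTensor_comp]
  rw [h1, h]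
  clear h1 h
  induction X with
  | zero => simp
  | add a b ha hb => simp only [map_add, add_mul, ha, hb]
  | tmul a b =>
    induction Y with
    | zero => simp
    | add c d hc hd => simp only [map_add, mul_add, hc, hd]
    | tmul c d =>
      induction Q with
      | zero => simp
      | add x y hx hy =>
        simp only [map_add, mul_add, add_mul, hx, hy, TensorProduct.add_tmul]
      | tmul x y => simp [L, leg12, leg13, smul_smul]

theorem tmul_mul_comm_of_mem_center {z : H} (hz : z ∈ Subalgebra.center ℂ H) (X : H ⊗[ℂ] H) :
    X * (z ⊗ₜ 1) = (z ⊗ₜ 1) * X := by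
  induction X with
  | zero => simp
  | add a b ha hb => simp only [add_mul, mul_add, ha, hb]
  | tmul a b => simp [Subalgebra.mem_center_iff.1 hz]

/-- `id ⊗ Δ` turns `B'B` into `B'₁₂ (B'B)₁₃ B₁₂`. Slicing the last leg puts a power of a central
element between `B'` and `B`, from where it can be pulled out; so convolution powers become ordinary
powers. -/
theorem sliceRight_convPow (f : H →ₗ[ℂ] ℂ) {B B' : H ⊗[ℂ] H}
    (hB : idComul ℂ H B = leg13 B * leg12 B) (hB' : idComul ℂ H B' = leg12 B' * leg13 B')
    (hz : sliceRight f (B' * B) ∈ Subalgebra.center ℂ H) (n : ℕ) :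
    sliceRight (convPow f n) (B' * B) = sliceRight f (B' * B) ^ (n + 1) := by
  induction n with
  | zero => simp [convPow]
  | succ n ih =>
    have h1 : idComul ℂ H (B' * B) = leg12 B' * leg13 (B' * B) * leg12 B := by
      rw [idComul_mul, hB, hB', map_mul]
      simp only [mul_assoc]
    rw [convPow, sliceRight_conv f _ h1, ih,
      tmul_mul_comm_of_mem_center (pow_mem hz _), mul_assoc, sliceRight_mul, pow_succ _ (n + 1)]

theorem star_sliceRight {f : H →ₗ[ℂ] ℂ} (hf : IsPositiveFunctional f) (X : H ⊗[ℂ] H) :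
    star (sliceRight f X) = sliceRight f (star X) := by
  induction X with
  | zero => simp
  | add a b ha hb => simp only [map_add, star_add, ha, hb]
  | tmul a b => simp [hf.map_star]

theorem tensorFunctional_sandwich (f f' : H →ₗ[ℂ] ℂ) (a b : H) (X : H ⊗[ℂ] H) :
    tensorFunctional f f' ((a ⊗ₜ 1) * (X * (b ⊗ₜ 1))) = f (a * (sliceRight f' X * b)) := by
  induction X with
  | zero => simp
  | add a b ha hb => simp only [map_add, mul_add, add_mul, ha, hb]
  | tmul a b => simp [mul_comm]

theorem commutesComul_comulOne : CommutesComul (Δ₁) :=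
  ⟨comulOne_mul_self, fun h => by rw [comul_mul_comulOne, comulOne_mul_comul]⟩

theorem star_comulOp (h : H) : star (comulOp ℂ H h) = comulOp ℂ H (star h) := by
  have : ∀ X : H ⊗[ℂ] H, star (TensorProduct.comm ℂ H H X) = TensorProduct.comm ℂ H H (star X) := by
    intro X
    induction X with
    | zero => simp
    | add a b ha hb => simp only [map_add, star_add, ha, hb]
    | tmul a b => simp
  rw [comulOp_apply, this, ← CStarQuantumGroupoid.comul_star, ← comulOp_apply]

theorem IsCanonical.isFaithful {g : Hˣ} (hg : IsCanonical g) :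
    IsFaithful (τ ∘ₗ LinearMap.mulLeft ℂ (g : H)) := by
  obtain ⟨t, ht, htg, -⟩ := hg.exists_root
  intro a ha
  have h1 : star (((t ^ 2 : Hˣ)) : H) = (t ^ 2 : Hˣ) := by rw [← Units.coe_star, star_pow, ht]
  have h2 : (g : H) = (t ^ 2 : Hˣ) * (t ^ 2 : Hˣ) := by rw [← Units.val_mul, ← pow_add, htg]
  have h3 : (τ ∘ₗ LinearMap.mulLeft ℂ (g : H)) (star a * a) =
      τ (star (a * (t ^ 2 : Hˣ)) * (a * (t ^ 2 : Hˣ))) := by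
    rw [LinearMap.comp_apply, LinearMap.mulLeft_apply, h2, mul_assoc, regularTrace_mul_comm,
      star_mul, h1]
    simp only [mul_assoc]
  rw [h3]
  exact isFaithful_regularTrace' H _ fun h => ha ((Units.mul_left_eq_zero _).1 h)

/-- A bound `B* B ≤ C` persists, with the same `C`, under slices by all convolution powers of `F =
τ(g ·)`. It then reads `τ(w zⁿ⁺¹ w) ≤ C τ(w dⁿ⁺¹ w)`, where `z` and `d` are the central slices of
`B* B` and `Δ(1)`, and the growth lemma removes `C`. The elements `R` and `R'` serve only to
identify the slices of `Δ(1)`. -/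
theorem IsCanonical.le_of_idComul {g : Hˣ} (hg : IsCanonical g) {R R' B : H ⊗[ℂ] H}
    (hR : idComul ℂ H R = leg13 R * leg12 R) (hR' : idComul ℂ H R' = leg12 R' * leg13 R')
    (hRR : R' * R = Δ₁)
    (hB : idComul ℂ H B = leg13 B * leg12 B) (hBc : CommutesComul (star B * B)) :
    (tensorFunctional (τ) (τ ∘ₗ LinearMap.mulLeft ℂ (g : H)) (star B * B)).re ≤
      (tensorFunctional (τ) (τ ∘ₗ LinearMap.mulLeft ℂ (g : H)) Δ₁).re := by
  have hτ := isFaithful_regularTrace' H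
  have hF := hg.isFaithful
  have hz := hg.sliceRight_mem_center hBc
  have hd := hg.sliceRight_mem_center commutesComul_comulOne
  set F : H →ₗ[ℂ] ℂ := τ ∘ₗ LinearMap.mulLeft ℂ (g : H)
  have hone : ∀ X, tensorFunctional (τ) F X = τ (sliceRight F X) := fun X => by
    have := tensorFunctional_sandwich (τ) F 1 1 X
    simpa [← Algebra.TensorProduct.one_def] using this
  set d := sliceRight F Δ₁ with hdd
  set z := sliceRight F (star B * B) with hzd
  have hzn : ∀ n, sliceRight (convPow F n) (star B * B) = z ^ (n + 1) := fun n =>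
    sliceRight_convPow F hB (by rw [idComul_star, hB, star_mul, ← leg12_star, ← leg13_star]) hz n
  have hdn : ∀ n, sliceRight (convPow F n) Δ₁ = d ^ (n + 1) := fun n => by
    have := sliceRight_convPow F hR hR' (by rw [hRR]; exact hd) n
    rwa [hRR] at this
  have hst : star (Δ₁) * Δ₁ = Δ₁ := by rw [star_comulOne, comulOne_mul_self]
  have hdp : IsPosDef (τ) d := by
    intro b hb
    rw [hdd, ← tensorFunctional_sandwich]
    have h1 : (star b ⊗ₜ[ℂ] (1 : H)) * (Δ₁ * (b ⊗ₜ 1)) =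
        star (Δ₁ * (b ⊗ₜ 1)) * (Δ₁ * (b ⊗ₜ 1)) := by
      conv_lhs => rw [← hst]
      simp [mul_assoc]
    rw [h1]
    refine hτ.tensor_isFaithful hF _ fun h => hb ?_
    -- The counit on the second leg recovers `b` from `Δ(1)(b ⊗ 1)`, so `d` is definite.
    have h2 := sliceRight_mul' (counit (R := ℂ)) b Δ₁
    rw [h, map_zero] at h2
    have h3 : sliceRight (counit (R := ℂ)) Δ₁ = 1 := rid_counit_comul 1
    rw [h3, one_mul] at h2
    exact h2.symm
  obtain ⟨q, hq, hq4, ⟨q, rfl⟩, -, hqK⟩ := hdp.exists_root hτ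
  have hqs : star q = q := Units.ext hq
  have hqc : ((q ^ 2 : Hˣ) : H) ∈ Subalgebra.center ℂ H := by
    rw [Units.val_pow_eq_pow_val]
    exact pow_mem (hqK _ hd) 2
  have hqd : ((q ^ 2 : Hˣ) : H) * (q ^ 2 : Hˣ) = d := by
    rw [← hq4, ← Units.val_mul, ← pow_add, Units.val_pow_eq_pow_val]
  obtain ⟨C, Y, hY⟩ := (isFaithful_tensor H).exists_bound B
  rw [hone, hone, ← hzd, ← hdd, ← hqd]
  refine hτ.isPositive.le_of_pow_le (C := C) hz hqc (inv_mem_center hqc) ?_ ?_ ?_ (Units.mul_inv _)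
    fun n w hw => ?_
  · rw [hzd, star_sliceRight hF.isPositive, star_mul, star_star]
  · rw [← Units.coe_star, star_pow, hqs]
  · rw [← Units.coe_star, star_inv, star_pow, hqs]
  -- `Y* Y = C - B* B`. The factor `Δ(1)` cuts `C` down to `CΔ(1)`, whose slices are the `C dⁿ⁺¹`.
  · have hpos := hτ.tensor_isPositive (convPow_isPositive hF n) (Y * (Δ₁ * (w ⊗ₜ 1)))
    have h1 : star (Y * (Δ₁ * (w ⊗ₜ 1))) * (Y * (Δ₁ * (w ⊗ₜ 1))) =
        (w ⊗ₜ 1) * (((C : ℂ) • Δ₁ - star B * B) * (w ⊗ₜ 1)) := by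
      rw [star_mul, mul_assoc, ← mul_assoc (star Y), hY, star_mul, star_comulOne, sub_mul,
        ← mul_assoc (star B * B), hBc.corner', smul_mul_assoc, one_mul, mul_assoc, mul_sub,
        mul_smul_comm, ← mul_assoc (Δ₁), comulOne_mul_self, ← mul_assoc (Δ₁) (star B * B),
        hBc.corner, sub_mul, smul_mul_assoc]
      simp [hw]
    rw [h1, tensorFunctional_sandwich, map_sub, map_smul, hzn, hdn, sub_mul, mul_sub, map_sub,
      sub_nonneg, smul_mul_assoc, mul_smul_comm, map_smul, smul_eq_mul] at hpos
    rw [hqd]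
    have := (Complex.le_def.1 hpos).1
    rwa [Complex.re_ofReal_mul] at this

/-- The `R`-matrix is unitary. -/
theorem IsQuasitriangular.star_eq {R : H ⊗[ℂ] H} (hR : IsQuasitriangular R) :
    star R = (S ℂ (H := H)).rTensor H R := by
  obtain ⟨g, hg⟩ := hR.exists_isCanonical
  set R' := (S ℂ (H := H)).rTensor H R with hR'
  have h1 : QGroupoid.idComul ℂ H R' = leg12 R' * leg13 R' := by
    have h2 : ∀ X : H ⊗[ℂ] H, QGroupoid.idComul ℂ H ((S ℂ (H := H)).rTensor H X) =
        (S ℂ (H := H)).rTensor (H ⊗[ℂ] H) (QGroupoid.idComul ℂ H X) := by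
      intro X
      induction X with
      | zero => simp
      | add a b ha hb => simp only [map_add, ha, hb]
      | tmul a b => rfl
    have h3 : ∀ X Y : H ⊗[ℂ] H, (S ℂ (H := H)).rTensor (H ⊗[ℂ] H) (leg13 X * leg12 Y) =
        leg12 ((S ℂ (H := H)).rTensor H Y) * leg13 ((S ℂ (H := H)).rTensor H X) := by
      intro X Y
      induction X with
      | zero => simp
      | add a b ha hb => simp only [map_add, add_mul, mul_add, ha, hb]
      | tmul a b =>
        induction Y with
        | zero => simp
        | add a b ha hb => simp only [map_add, add_mul, mul_add, ha, hb]
        | tmul c d => simp [leg12, leg13, antipode_mul]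
    rw [h2, hR.idComul, h3]
  have h2 : R' * R = Δ₁ := hR.rTensor_antipode_mul
  have hRR' : R * R' = comulOp ℂ H 1 := hR.mul_rTensor_antipode
  have h3 : QGroupoid.idComul ℂ H (star R') = leg13 (star R') * leg12 (star R') := by
    rw [idComul_star, h1, star_mul, leg12_star, leg13_star]
  have h4 : CommutesComul (star R * R) := by
    refine ⟨?_, fun h => ?_⟩
    · have := congrArg star hR.mul_comulOne
      rw [star_mul, star_comulOne] at this
      rw [← mul_assoc, this]
    · have := congrArg star (hR.comulOp_mul (star h))
      rw [star_mul, star_mul, star_comulOp, star_star, ← CStarQuantumGroupoid.comul_star,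
        star_star] at this
      rw [← mul_assoc, ← this, mul_assoc, hR.comulOp_mul, mul_assoc]
  have h5 : ∀ h, R' * comulOp ℂ H h = Δ h * R' := by
    intro h
    calc R' * comulOp ℂ H h = R' * (comulOp ℂ H h * R) * R' := by
          rw [mul_assoc, mul_assoc, hRR', ← comulOp_map_mul, mul_one]
      _ = R' * R * Δ h * R' := by rw [hR.comulOp_mul]; simp only [mul_assoc]
      _ = Δ h * R' := by rw [h2, comulOne_mul_comul]
  have h6 : CommutesComul (R' * star R') := by
    refine ⟨?_, fun h => ?_⟩
    · rw [← mul_assoc, hR', hR.comulOne_mul_rTensor_antipode]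
    · have := congrArg star (h5 (star h))
      rw [star_mul, star_mul, star_comulOp, star_star, ← CStarQuantumGroupoid.comul_star,
        star_star] at this
      rw [← mul_assoc, ← h5, mul_assoc, this, mul_assoc]
  -- Both `R` and `R'*` satisfy `(id ⊗ Δ)B = B₁₃B₁₂`, so `R* R` and `R' R'*` are dominated by `Δ(1)`
  -- under a faithful functional. The mixed terms of `(R - R'*)*(R - R'*)` contribute exactly
  -- `-2Δ(1)`, which leaves no room for `R ≠ R'*`.
  have h7 := hg.le_of_idComul hR.idComul h1 h2 hR.idComul h4
  have h8 := hg.le_of_idComul hR.idComul h1 h2 h3 (by rwa [star_star])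
  have h9 : R - star R' = 0 := by
    by_contra h0
    have h10 := (isFaithful_regularTrace' H).tensor_isFaithful hg.isFaithful _ h0
    have h11 : star (R - star R') * (R - star R') = star R * R - Δ₁ - Δ₁ + R' * star R' := by
      have e : star R * star R' = Δ₁ := by rw [← star_mul, h2, star_comulOne]
      rw [star_sub, star_star, sub_mul, mul_sub, mul_sub, h2, e]
      abel
    rw [star_star] at h8
    rw [h11, map_add, map_sub, map_sub] at h10
    have := (Complex.lt_def.1 h10).1
    simp only [Complex.add_re, Complex.sub_re, Complex.zero_re] at this
    linarith
  rw [sub_eq_zero.1 h9, star_star]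

end UnitaryR

open ComplexOrder

/-! ### The scalar product of `H_t` and the ribbon element. -/

section Ribbon

variable {H : Type u} [Ring H] [Algebra ℂ H] [Coalgebra ℂ H] [StarRing H] [StarModule ℂ H]
  [CStarQuantumGroupoid H]

local notation "Δ₁" => comulOne ℂ H
local notation "T" => antipodeInv (H := H)
local notation "τ" => regularTrace H

variable (H) in
/-- The target counital subalgebra as a subalgebra. -/
def targetSubalgebra : Subalgebra ℂ H where
  carrier := targetSpace H
  mul_mem' := mul_mem_target
  one_mem' := one_mem_target
  add_mem' := add_mem
  zero_mem' := zero_mem _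
  algebraMap_mem' r := by
    rw [Algebra.algebraMap_eq_smul_one]
    exact Submodule.smul_mem _ _ one_mem_target

/-- Let `k = (τ ⊗ id)Δ(1)`, a positive invertible element of `H_t`. Then `ε(x* k x) = (τ ⊗ ε)((1 ⊗
x*)Δ(1)(1 ⊗ x))` for `x ∈ H_t`, and moving `x*` and `x` to the first leg turns this into `τ(S⁻¹(x)*
S⁻¹(x))`. Since `k = t⁴` with `t ∈ H_t`, every `z ∈ H_t` is `t² x` for such an `x`, and `z* z = x* k
x`. -/
theorem counit_star_mul_self_pos (z : H) (hz : z ∈ targetSpace H) (h0 : z ≠ 0) :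
    0 < (counit (R := ℂ) (star z * z)).re := by
  have hτ := isFaithful_regularTrace' H
  obtain ⟨r, -, hr⟩ := exists_repr_one (H := H)
  set k := sliceLeft (τ) Δ₁ with hk
  have hkt : k ∈ targetSubalgebra H := by
    rw [hk, ← sum_comulOne r, map_sum]
    refine sum_mem fun i _ => ?_
    rw [sliceLeft_tmul]
    exact Submodule.smul_mem _ _ (hr i)
  have hst : star (Δ₁) * Δ₁ = Δ₁ := by rw [star_comulOne, comulOne_mul_self]
  have hkp : IsPosDef (τ) k := by
    intro b hb
    have h1 : τ (star b * (k * b)) =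
        tensorFunctional (τ) (τ) (star (Δ₁ * (1 ⊗ₜ b)) * (Δ₁ * (1 ⊗ₜ b))) := by
      rw [star_mul, mul_assoc, ← mul_assoc (star (Δ₁)), hst, TensorProduct.star_tmul, star_one,
        tensorFunctional_eq_sliceLeft, LinearMap.mulLeft_one, LinearMap.comp_id, sliceLeft_mul']
    rw [h1]
    refine isFaithful_tensor H _ fun h => hb ?_
    have h2 := sliceLeft_mul' (counit (R := ℂ)) b Δ₁
    rw [h, map_zero] at h2
    have h3 : sliceLeft (counit (R := ℂ)) Δ₁ = 1 := lid_counit_comul 1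
    rw [h3, one_mul] at h2
    exact h2.symm
  obtain ⟨t, ht, ht4, htu, -, htK⟩ := hkp.exists_root hτ
  have hs : t ^ 2 ∈ targetSubalgebra H := pow_mem (htK _ hkt) 2
  -- Injectivity on the finite-dimensional `H_t` is what produces `t⁻² z` inside `H_t`.
  have hinj : Function.Injective (LinearMap.mulLeft ℂ (⟨t ^ 2, hs⟩ : targetSubalgebra H)) := by
    refine (injective_iff_map_eq_zero _).2 fun x hx => Subtype.ext ?_
    exact (htu.pow 2).mul_right_eq_zero.1 (congrArg Subtype.val hx)
  obtain ⟨x, hx⟩ := LinearMap.injective_iff_surjective.1 hinj ⟨z, hz⟩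
  have hxz : t ^ 2 * (x : H) = z := congrArg Subtype.val hx
  have hxt : (x : H) ∈ targetSpace H := x.2
  have h1 : star z * z = star (x : H) * (k * x) := by
    rw [← hxz, ← ht4, star_mul, star_pow, ht, mul_assoc, ← mul_assoc (t ^ 2), ← pow_add]
  have h2 : counit (R := ℂ) (star (x : H) * (k * x)) = τ (star (T (x : H)) * T (x : H)) := by
    have h3 : (1 ⊗ₜ star (x : H)) * (Δ₁ * (1 ⊗ₜ (x : H))) =
        (S ℂ (star (x : H)) ⊗ₜ 1) * (Δ₁ * (T (x : H) ⊗ₜ 1)) := by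
      rw [comulOne_mul_target hxt, ← mul_assoc, target_mul_comulOne (star_mem_target hxt),
        mul_assoc]
    have h4 : counit (R := ℂ) (star (x : H) * (k * x)) = tensorFunctional (τ) (counit (R := ℂ))
        ((1 ⊗ₜ star (x : H)) * (Δ₁ * (1 ⊗ₜ (x : H)))) := by
      rw [tensorFunctional_eq_sliceLeft, LinearMap.mulLeft_one, LinearMap.comp_id, sliceLeft_mul']
    have h5 : sliceRight (counit (R := ℂ)) Δ₁ = 1 := rid_counit_comul 1
    rw [h4, h3, tensorFunctional_sandwich, h5, one_mul]
    simp [antipodeInv]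
  rw [h1, h2]
  refine (Complex.lt_def.1 (hτ _ fun h => h0 ?_)).1
  rw [← hxz, ← antipode_antipodeInv (x : H), h, map_zero, mul_zero]

variable {R : H ⊗[ℂ] H} (hR : IsQuasitriangular R) {g : Hˣ} (hg : IsCanonical g)

/-- The ribbon element `u⁻¹ g`. -/
def ribbonElement (R : H ⊗[ℂ] H) (g : Hˣ) : H := Ring.inverse (drinfeldElement R) * g

include hR

theorem IsQuasitriangular.exists_unit : ∃ w : Hˣ, (w : H) = drinfeldElement R ∧
    Ring.inverse (drinfeldElement R) = (w⁻¹ : Hˣ) := by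
  obtain ⟨w, hw⟩ := hR.isUnit_drinfeldElement
  exact ⟨w, hw, by rw [← hw, Ring.inverse_unit]⟩

include hg

theorem IsQuasitriangular.isUnit_ribbonElement : IsUnit (ribbonElement R g) := by
  obtain ⟨w, hw, hwi⟩ := hR.exists_unit
  rw [ribbonElement, hwi]
  exact (w⁻¹ * g).isUnit

/-- `u` and `g` implement the same automorphism `S²`. -/
theorem IsQuasitriangular.ribbonElement_mem_center :
    ribbonElement R g ∈ Subalgebra.center ℂ H := by
  obtain ⟨w, hw, hwi⟩ := hR.exists_unit
  rw [Subalgebra.mem_center_iff, ribbonElement, hwi]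
  intro h
  rw [mul_assoc, ← hg.antipode_sq_mul, ← mul_assoc, ← mul_assoc]
  congr 1
  rw [Units.eq_inv_mul_iff_mul_eq, ← mul_assoc, hw, hR.drinfeldElement_mul, ← hw, mul_assoc,
    Units.mul_inv, mul_one]

/-- `g⁻¹ ν` and `g S(ν)` are the products of `g⁻¹ R⁽²⁾` and `g R⁽¹⁾` in the two orders, so they
agree under `τ(z ·)` for central `z`. Balance replaces `g⁻¹` by `g` in the first, and faithfulness
of `τ(g ·)` then kills `ν - S(ν)`. -/
theorem IsQuasitriangular.antipode_ribbonElement :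
    S ℂ (ribbonElement R g) = ribbonElement R g := by
  have hc := hR.ribbonElement_mem_center hg
  obtain ⟨w, hw, hwi⟩ := hR.exists_unit
  set ν := ribbonElement R g with hν
  have hSc : S ℂ ν ∈ Subalgebra.center ℂ H := by
    rw [Subalgebra.mem_center_iff] at hc ⊢
    intro b
    rw [← antipode_antipodeInv b, S, ← antipode_mul, ← antipode_mul, hc]
  have h1 : ∀ z ∈ Subalgebra.center ℂ H, τ (z * ((g⁻¹ : Hˣ) * ν)) = τ (z * (g * S ℂ ν)) := by
    intro z hz
    have e1 : (g⁻¹ : Hˣ) * ν = LinearMap.mul' ℂ H (TensorProduct.map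
        (LinearMap.mulLeft ℂ ((g⁻¹ : Hˣ) : H)) (LinearMap.mulLeft ℂ (g : H))
          (TensorProduct.comm ℂ H H R)) := by
      rw [hν, ribbonElement, hR.inverse_drinfeldElement]
      generalize R = X
      induction X with
      | zero => simp
      | add a b ha hb => simp only [map_add, add_mul, mul_add, ha, hb]
      | tmul a b => simp [mul_assoc, hg.antipode_sq_mul]
    have e2 : g * S ℂ ν = LinearMap.mul' ℂ H (TensorProduct.map
        (LinearMap.mulLeft ℂ (g : H)) (LinearMap.mulLeft ℂ ((g⁻¹ : Hˣ) : H)) R) := by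
      have e3 : ∀ x : H, (g⁻¹ : Hˣ) * S ℂ (S ℂ x) = x * (g⁻¹ : Hˣ) := fun x => by
        rw [hg.inv_mul_antipode, antipodeInv_antipode]
      rw [hν, ribbonElement, S, antipode_mul, hg.antipode, hR.antipode_inverse_drinfeldElement]
      generalize R = X
      induction X with
      | zero => simp
      | add a b ha hb => simp only [map_add, mul_add, ha, hb]
      | tmul a b =>
        simp only [LinearMap.rTensor_tmul, LinearMap.mul'_apply, LinearMap.comp_apply,
          TensorProduct.map_tmul, LinearMap.mulLeft_apply]
        rw [← mul_assoc _ _ b, e3]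
        simp only [mul_assoc]
    rw [e1, e2]
    generalize R = X
    induction X with
    | zero => simp
    | add a b ha hb => simp only [map_add, mul_add, ha, hb]
    | tmul a b =>
      simp only [TensorProduct.comm_tmul, LinearMap.mul'_apply, TensorProduct.map_tmul,
        LinearMap.mulLeft_apply]
      rw [← mul_assoc, regularTrace_mul_comm, ← mul_assoc, Subalgebra.mem_center_iff.1 hz,
        mul_assoc]
  have h2 : ν - S ℂ ν = 0 := by
    have hy := sub_mem hc hSc
    refine hg.isFaithful.eq_zero ?_
    have hz := star_mem_center hy
    have h3 := h1 _ hz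
    rw [Subalgebra.mem_center_iff.1 hc, ← mul_assoc, ← hg.balanced _ (mul_mem hz hc),
      Subalgebra.mem_center_iff.1 hSc, ← mul_assoc] at h3
    rw [LinearMap.comp_apply, LinearMap.mulLeft_apply, regularTrace_mul_comm, mul_sub, sub_mul,
      map_sub, h3, sub_self]
  exact (sub_eq_zero.1 h2).symm

/-- Unitarity of `R` gives `u* = S(u⁻¹)`. Hence `ν* = S(u) g`, which is inverse to `g⁻¹ S(u⁻¹) =
S(ν) = ν`. -/
theorem IsQuasitriangular.star_ribbonElement :
    star (ribbonElement R g) = Ring.inverse (ribbonElement R g) := by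
  obtain ⟨w, hw, hwi⟩ := hR.exists_unit
  have h1 : star (drinfeldElement R) = S ℂ (Ring.inverse (drinfeldElement R)) := by
    rw [hR.antipode_inverse_drinfeldElement]
    have e1 : ∀ X : H ⊗[ℂ] H, star (drinfeldElement X) =
        LinearMap.mul' ℂ H ((T).lTensor H (star X)) := by
      intro X
      rw [← antipodeMul_eq]
      induction X with
      | zero => simp
      | add a b ha hb => simp only [map_add, star_add, ha, hb]
      | tmul a b => simp [star_antipode]
    rw [e1, hR.star_eq]
    conv_lhs => rw [← hR.map_antipode]
    generalize R = X
    induction X with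
    | zero => simp
    | add a b ha hb => simp only [map_add, ha, hb]
    | tmul a b => simp [antipodeInv_antipode]
  have hgs : star (g : H) = g := by
    obtain ⟨a, ha⟩ := hg.pos
    rw [ha, star_mul, star_star]
  have hν : ribbonElement R g = ((w⁻¹ * g : Hˣ) : H) := by
    rw [ribbonElement, hwi, Units.val_mul]
  have hS : S ℂ (w : H) * S ℂ ((w⁻¹ : Hˣ) : H) = 1 := by
    rw [S, ← antipode_mul, Units.inv_mul, antipode_one]
  have h2 : star ((w⁻¹ : Hˣ) : H) = S ℂ (w : H) := by
    have e1 : S ℂ ((w⁻¹ : Hˣ) : H) * star ((w⁻¹ : Hˣ) : H) = 1 := by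
      rw [← hwi, ← h1, hwi, ← hw, ← star_mul, Units.inv_mul, star_one]
    calc star ((w⁻¹ : Hˣ) : H) = S ℂ (w : H) * S ℂ ((w⁻¹ : Hˣ) : H) * star ((w⁻¹ : Hˣ) : H) := by
          rw [hS, one_mul]
      _ = S ℂ (w : H) := by rw [mul_assoc, e1, mul_one]
  have h3 : S ℂ (S ℂ (w : H)) = w := by
    have := hR.drinfeldElement_mul w
    rw [← hw] at this
    exact ((Units.mul_left_inj w).1 this).symm
  have h4 := hR.antipode_ribbonElement hg
  rw [hν] at h4 ⊢
  rw [Ring.inverse_unit]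
  refine left_inv_eq_right_inv ?_ (Units.mul_inv _)
  have h5 := hg.antipode_sq_mul (S ℂ (w : H))
  rw [h3] at h5
  have h6 : star ((w⁻¹ * g : Hˣ) : H) = S ℂ (w : H) * g := by
    rw [Units.val_mul, star_mul, h2, hgs, h5]
  rw [h6, ← h4, Units.val_mul, S, antipode_mul, hg.antipode, mul_assoc,
    ← mul_assoc (g : H), Units.mul_inv, one_mul]
  exact hS

/-- Combine the coproducts of `u` and `g`; `R₂₁ R` commutes with `Δ(g)`, and `R₂₁` absorbs the
`Δ(1)` that is left over. -/
theorem IsQuasitriangular.comul_ribbonElement : Δ (ribbonElement R g) =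
    (ribbonElement R g ⊗ₜ ribbonElement R g) * (TensorProduct.comm ℂ H H R * R) := by
  obtain ⟨w, hw, hwi⟩ := hR.exists_unit
  have h1 := hR.mul_comul_drinfeldElement
  have h2 : Δ ((w⁻¹ : Hˣ) : H) = (((w⁻¹ : Hˣ) : H) ⊗ₜ ((w⁻¹ : Hˣ) : H)) *
      (TensorProduct.comm ℂ H H R * R) := by
    have h3 := congrArg (fun x => (((w⁻¹ : Hˣ) : H) ⊗ₜ ((w⁻¹ : Hˣ) : H)) * x *
      Δ ((w⁻¹ : Hˣ) : H)) h1
    simp only [← hw, mul_assoc, ← comul_mul, Units.mul_inv] at h3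
    rw [comulOne_mul_comul, ← mul_assoc _ _ (Δ ((w⁻¹ : Hˣ) : H)),
      Algebra.TensorProduct.tmul_mul_tmul, Units.inv_mul, ← Algebra.TensorProduct.one_def,
      one_mul] at h3
    rw [← h3]
    congr 2
    exact hR.mul_comulOne
  have h4 : Δ₁ * TensorProduct.comm ℂ H H R = TensorProduct.comm ℂ H H R := by
    have := congrArg (TensorProduct.comm ℂ H H) hR.comulOp_one_mul
    rwa [comm_mul, comulOp_one, comm_comm] at this
  rw [ribbonElement, hwi, comul_mul, h2, mul_assoc, hR.comm_mul_self_mul_comul, hg.comul,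
    mul_assoc, ← mul_assoc (Δ₁), h4, ← mul_assoc, Algebra.TensorProduct.tmul_mul_tmul]

/-- `ε_t(g) = g 1₍₁₎ S(1₍₂₎) g⁻¹ = 1 = ε_t(u)`, so `g` may be replaced by `u` in `ε_t(u⁻¹ g)`. This
makes the twist of the unit object trivial. -/
theorem IsQuasitriangular.targetMap_ribbonElement : targetMap ℂ (ribbonElement R g) = 1 := by
  obtain ⟨w, hw, hwi⟩ := hR.exists_unit
  have h1 : targetMap ℂ (g : H) = 1 := by
    have e1 : ∀ X : H ⊗[ℂ] H, LinearMap.mul' ℂ H ((S ℂ (H := H)).lTensor H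
        (((g : H) ⊗ₜ (g : H)) * X)) =
        g * LinearMap.mul' ℂ H ((S ℂ (H := H)).lTensor H X) * (g⁻¹ : Hˣ) := by
      intro X
      induction X with
      | zero => simp
      | add a b ha hb => simp only [map_add, mul_add, add_mul, ha, hb]
      | tmul a b => simp [antipode_mul, hg.antipode, mul_assoc]
    have e2 := QuantumGroupoid.mul_antipode (k := ℂ) (1 : H)
    rw [targetMap_one] at e2
    rw [← QuantumGroupoid.mul_antipode, hg.comul]
    refine (e1 _).trans ?_
    rw [comulOne]
    erw [e2]
    simp
  rw [ribbonElement, ← targetMap_mul_targetMap, h1, ← hR.targetMap_drinfeldElement,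
    targetMap_mul_targetMap, Ring.inverse_mul_cancel _ hR.isUnit_drinfeldElement, targetMap_one,
    hR.targetMap_drinfeldElement]

end Ribbon

namespace URep

/-! ### Isomorphisms and adjoints of module maps. -/

section Rep

variable {H : Type u} [Ring H] [Algebra ℂ H] [StarRing H]

/-- A bijective `H`-linear map as an isomorphism of unitary modules. -/
def mkIso {V W : URep H} (f : V.V →ₗ[ℂ] W.V) (k : W.V →ₗ[ℂ] V.V)
    (hf : ∀ (h : H) (v : V.V), f (V.ρ h v) = W.ρ h (f v))
    (hkf : ∀ v, k (f v) = v) (hfk : ∀ w, f (k w) = w) : V ≅ W where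
  hom := mkHom f hf
  inv := mkHom k fun h w => by
    rw [← hkf (V.ρ h (k w)), hf, hfk]
  hom_inv_id := hom_ext (LinearMap.ext hkf)
  inv_hom_id := hom_ext (LinearMap.ext hfk)

theorem lin_mkHom {V W : URep H} (f : V.V →ₗ[ℂ] W.V)
    (hf : ∀ (h : H) (v : V.V), f (V.ρ h v) = W.ρ h (f v)) : lin (mkHom f hf) = f := rfl

theorem lin_comp_apply {U V W : URep H} (f : U ⟶ V) (k : V ⟶ W) (u : U.V) :
    lin (f ≫ k) u = lin k (lin f u) := rfl

theorem lin_id_apply {V : URep H} (v : V.V) : lin (𝟙 V) v = v := rfl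

theorem lin_hom_inv {V W : URep H} (e : V ≅ W) (w : W.V) : lin e.hom (lin e.inv w) = w := by
  rw [← lin_comp_apply, e.inv_hom_id, lin_id_apply]

theorem lin_inv_hom {V W : URep H} (e : V ≅ W) (v : V.V) : lin e.inv (lin e.hom v) = v := by
  rw [← lin_comp_apply, e.hom_inv_id, lin_id_apply]

theorem hom_ext_apply {V W : URep H} {f k : V ⟶ W} (h : ∀ v, lin f v = lin k v) : f = k :=
  hom_ext (LinearMap.ext h)

theorem lin_conj {V W : URep H} (f : V ⟶ W) : lin (conj f) = LinearMap.adjoint (lin f) := rfl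

theorem conj_conj {V W : URep H} (f : V ⟶ W) : conj (conj f) = f :=
  hom_ext (LinearMap.adjoint_adjoint _)

theorem conj_comp {U V W : URep H} (f : U ⟶ V) (k : V ⟶ W) : conj (f ≫ k) = conj k ≫ conj f :=
  hom_ext (LinearMap.adjoint_comp _ _)

theorem conj_id (V : URep H) : conj (𝟙 V) = 𝟙 V :=
  hom_ext (LinearMap.adjoint_id)

theorem conj_eq_of_inner {V W : URep H} (f : V ⟶ W) (k : W ⟶ V)
    (h : ∀ v w, ⟪v, lin k w⟫_ℂ = ⟪lin f v, w⟫_ℂ) : conj f = k :=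
  hom_ext ((LinearMap.eq_adjoint_iff _ _).2 fun w v => by
    rw [← inner_conj_symm, h, inner_conj_symm]).symm

theorem conj_iso {V W : URep H} (e : V ≅ W)
    (h : ∀ v v', ⟪lin e.hom v, lin e.hom v'⟫_ℂ = ⟪v, v'⟫_ℂ) : conj e.hom = e.inv :=
  conj_eq_of_inner _ _ fun v w => by rw [← h, lin_hom_inv]

theorem comm_act (V W : URep H) (X : H ⊗[ℂ] H) (s : V.V ⊗[ℂ] W.V) :
    TensorProduct.comm ℂ V.V W.V (act V W X s) =
      act W V (TensorProduct.comm ℂ H H X) (TensorProduct.comm ℂ V.V W.V s) := by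
  induction X with
  | zero => simp
  | add x y hx hy => simp only [map_add, LinearMap.add_apply, hx, hy]
  | tmul a b =>
    induction s with
    | zero => simp
    | add s s' hs hs' => simp only [map_add, hs, hs']
    | tmul v w => simp only [act_tmul, TensorProduct.comm_tmul]

end Rep

/-! ### Tensor products of unitary modules. -/

section Tensor

variable {H : Type u} [Ring H] [Algebra ℂ H] [Coalgebra ℂ H] [StarRing H] [StarModule ℂ H]
  [CStarQuantumGroupoid H]

local notation "Δ₁" => comulOne ℂ H

theorem incl_proj (V W : URep H) (s : V.V ⊗[ℂ] W.V) : incl V W (proj V W s) = act V W Δ₁ s := rfl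

theorem incl_injective (V W : URep H) : Function.Injective (incl V W) := Subtype.val_injective

theorem act_comulOne_incl (V W : URep H) (x : (tensor V W).V) :
    act V W Δ₁ (incl V W x) = incl V W x := x.2.symm

theorem proj_incl (V W : URep H) (x : (tensor V W).V) : proj V W (incl V W x) = x :=
  incl_injective V W (by rw [incl_proj, act_comulOne_incl])

theorem proj_eq_iff {V W : URep H} {s t : V.V ⊗[ℂ] W.V} :
    proj V W s = proj V W t ↔ act V W Δ₁ s = act V W Δ₁ t :=
  (incl_injective V W).eq_iff.symm

theorem proj_act_comulOne (V W : URep H) (s : V.V ⊗[ℂ] W.V) :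
    proj V W (act V W Δ₁ s) = proj V W s := by
  rw [proj_eq_iff, ← Module.End.mul_apply, ← map_mul, comulOne_mul_self]

theorem proj_surjective (V W : URep H) : Function.Surjective (proj V W) :=
  fun x => ⟨incl V W x, proj_incl V W x⟩

theorem inner_tensor (V W : URep H) (x y : (tensor V W).V) :
    ⟪x, y⟫_ℂ = ⟪incl V W x, incl V W y⟫_ℂ := rfl

theorem inner_proj_right (V W : URep H) (s : V.V ⊗[ℂ] W.V) (y : (tensor V W).V) :
    ⟪y, proj V W s⟫_ℂ = ⟪incl V W y, s⟫_ℂ := by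
  have := inner_act V W Δ₁ (incl V W y) s
  rw [star_comulOne, act_comulOne_incl] at this
  exact this.symm

theorem incl_ρ (V W : URep H) (h : H) (x : (tensor V W).V) :
    incl V W ((tensor V W).ρ h x) = act V W (Δ h) (incl V W x) := rfl

theorem ρ_proj (V W : URep H) (h : H) (s : V.V ⊗[ℂ] W.V) :
    (tensor V W).ρ h (proj V W s) = proj V W (act V W (Δ h) s) := by
  refine incl_injective V W ?_
  rw [incl_ρ, incl_proj, incl_proj, ← Module.End.mul_apply, ← Module.End.mul_apply, ← map_mul,
    ← map_mul, comul_mul_comulOne, comulOne_mul_comul]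

theorem incl_proj_act_comul (V W : URep H) (h : H) (s : V.V ⊗[ℂ] W.V) :
    incl V W (proj V W (act V W (Δ h) s)) = act V W (Δ h) s := by
  rw [incl_proj, ← Module.End.mul_apply, ← map_mul, comulOne_mul_comul]

/-- Every vector of the subspace is `Δ(1)` applied to a sum of pure tensors, so maps out of `V ⊗ W`
can be compared on the vectors `Δ(1)(v ⊗ w)`. -/
theorem tensor_ext {V W : URep H} {X : Type*} [AddCommGroup X] [Module ℂ X]
    {f k : (tensor V W).V →ₗ[ℂ] X}
    (h : ∀ v w, f (proj V W (v ⊗ₜ w)) = k (proj V W (v ⊗ₜ w))) : f = k := by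
  have : f ∘ₗ proj V W = k ∘ₗ proj V W := TensorProduct.ext' h
  refine LinearMap.ext fun x => ?_
  obtain ⟨s, rfl⟩ := proj_surjective V W x
  exact LinearMap.congr_fun this s

theorem hom_tensor_ext {V W X : URep H} {f k : tensor V W ⟶ X}
    (h : ∀ v w, lin f (proj V W (v ⊗ₜ w)) = lin k (proj V W (v ⊗ₜ w))) : f = k :=
  hom_ext (tensor_ext h)

theorem tensor_ext_right {U V W : URep H} {X : Type*} [AddCommGroup X] [Module ℂ X]
    {f k : (tensor U (tensor V W)).V →ₗ[ℂ] X}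
    (h : ∀ u v w, f (proj U _ (u ⊗ₜ proj V W (v ⊗ₜ w))) =
      k (proj U _ (u ⊗ₜ proj V W (v ⊗ₜ w)))) : f = k :=
  tensor_ext fun u => LinearMap.congr_fun (f := f ∘ₗ proj U (tensor V W) ∘ₗ TensorProduct.mk ℂ _ _ u)
    (g := k ∘ₗ proj U (tensor V W) ∘ₗ TensorProduct.mk ℂ _ _ u) (tensor_ext (h u))

theorem tensor_ext_left {U V W : URep H} {X : Type*} [AddCommGroup X] [Module ℂ X]
    {f k : (tensor (tensor U V) W).V →ₗ[ℂ] X}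
    (h : ∀ u v w, f (proj _ W (proj U V (u ⊗ₜ v) ⊗ₜ w)) =
      k (proj _ W (proj U V (u ⊗ₜ v) ⊗ₜ w))) : f = k :=
  tensor_ext fun x w => LinearMap.congr_fun
    (f := f ∘ₗ proj (tensor U V) W ∘ₗ (TensorProduct.mk ℂ _ _).flip w)
    (g := k ∘ₗ proj (tensor U V) W ∘ₗ (TensorProduct.mk ℂ _ _).flip w)
    (tensor_ext fun u v => h u v w) x

theorem lin_tensorMap {V V' W W' : URep H} (f : V ⟶ V') (k : W ⟶ W') (s : V.V ⊗[ℂ] W.V) :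
    lin (tensorMap f k) (proj V W s) = proj V' W' (TensorProduct.map (lin f) (lin k) s) :=
  incl_injective V' W' (map_act f k Δ₁ s)

theorem lin_tensorMap_tmul {V V' W W' : URep H} (f : V ⟶ V') (k : W ⟶ W') (v : V.V) (w : W.V) :
    lin (tensorMap f k) (proj V W (v ⊗ₜ w)) = proj V' W' (lin f v ⊗ₜ lin k w) :=
  lin_tensorMap f k _

theorem incl_lin_tensorMap {V V' W W' : URep H} (f : V ⟶ V') (k : W ⟶ W') (x : (tensor V W).V) :
    incl V' W' (lin (tensorMap f k) x) = TensorProduct.map (lin f) (lin k) (incl V W x) := rfl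

theorem conj_tensorMap {V V' W W' : URep H} (f : V ⟶ V') (k : W ⟶ W') :
    conj (tensorMap f k) = tensorMap (conj f) (conj k) :=
  conj_eq_of_inner _ _ fun x y => by
    rw [inner_tensor, inner_tensor, incl_lin_tensorMap, incl_lin_tensorMap, lin_conj, lin_conj,
      ← TensorProduct.adjoint_map, LinearMap.adjoint_inner_right]

theorem tensorMap_id (V W : URep H) : tensorMap (𝟙 V) (𝟙 W) = 𝟙 (tensor V W) :=
  hom_tensor_ext fun v w => lin_tensorMap_tmul _ _ v w

theorem tensorMap_comp {V V' V'' W W' W'' : URep H} (f : V ⟶ V') (f' : V' ⟶ V'') (k : W ⟶ W')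
    (k' : W' ⟶ W'') : tensorMap f k ≫ tensorMap f' k' = tensorMap (f ≫ f') (k ≫ k') :=
  hom_tensor_ext fun v w => by simp only [lin_comp_apply, lin_tensorMap_tmul]

theorem add_tensorMap {V V' W W' : URep H} (f f' : V ⟶ V') (k : W ⟶ W') :
    tensorMap (f + f') k = tensorMap f k + tensorMap f' k :=
  hom_tensor_ext fun v w => by
    simp only [lin_add, LinearMap.add_apply, lin_tensorMap_tmul, TensorProduct.add_tmul, map_add]

theorem tensorMap_add {V V' W W' : URep H} (f : V ⟶ V') (k k' : W ⟶ W') :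
    tensorMap f (k + k') = tensorMap f k + tensorMap f k' :=
  hom_tensor_ext fun v w => by
    simp only [lin_add, LinearMap.add_apply, lin_tensorMap_tmul, TensorProduct.tmul_add, map_add]

theorem smul_tensorMap {V V' W W' : URep H} (a : ℂ) (f : V ⟶ V') (k : W ⟶ W') :
    tensorMap (a • f) k = a • tensorMap f k :=
  hom_tensor_ext fun v w => by
    simp only [lin_smul, LinearMap.smul_apply, lin_tensorMap_tmul, ← TensorProduct.smul_tmul',
      map_smul]

theorem tensorMap_smul {V V' W W' : URep H} (a : ℂ) (f : V ⟶ V') (k : W ⟶ W') :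
    tensorMap f (a • k) = a • tensorMap f k :=
  hom_tensor_ext fun v w => by
    simp only [lin_smul, LinearMap.smul_apply, lin_tensorMap_tmul, TensorProduct.tmul_smul,
      map_smul]

/-! #### The associativity isomorphism -/

/-- The action of `H ⊗ H ⊗ H` on `U ⊗ V ⊗ W`. -/
def act₃ (U V W : URep H) : H ⊗[ℂ] (H ⊗[ℂ] H) →ₐ[ℂ] Module.End ℂ (U.V ⊗[ℂ] (V.V ⊗[ℂ] W.V)) :=
  (Module.endTensorEndAlgHom (R := ℂ) (S := ℂ) (A := ℂ)).comp
    (Algebra.TensorProduct.map U.ρ (act V W))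

theorem act₃_tmul (U V W : URep H) (a : H) (X : H ⊗[ℂ] H) (u : U.V) (s : V.V ⊗[ℂ] W.V) :
    act₃ U V W (a ⊗ₜ X) (u ⊗ₜ s) = U.ρ a u ⊗ₜ act V W X s := rfl

/-- The embedding of `(U ⊗ V) ⊗ W` into the tensor product of vector spaces. -/
def inclLeft (U V W : URep H) : (tensor (tensor U V) W).V →ₗ[ℂ] U.V ⊗[ℂ] (V.V ⊗[ℂ] W.V) :=
  (TensorProduct.assoc ℂ U.V V.V W.V).toLinearMap ∘ₗ (incl U V).rTensor W.V ∘ₗ incl (tensor U V) W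

/-- The embedding of `U ⊗ (V ⊗ W)` into the tensor product of vector spaces. -/
def inclRight (U V W : URep H) : (tensor U (tensor V W)).V →ₗ[ℂ] U.V ⊗[ℂ] (V.V ⊗[ℂ] W.V) :=
  (incl V W).lTensor U.V ∘ₗ incl U (tensor V W)

/-- The projection onto `(U ⊗ V) ⊗ W`. -/
def projLeft (U V W : URep H) : U.V ⊗[ℂ] (V.V ⊗[ℂ] W.V) →ₗ[ℂ] (tensor (tensor U V) W).V :=
  proj (tensor U V) W ∘ₗ (proj U V).rTensor W.V ∘ₗ (TensorProduct.assoc ℂ U.V V.V W.V).symm.toLinearMap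

/-- The projection onto `U ⊗ (V ⊗ W)`. -/
def projRight (U V W : URep H) : U.V ⊗[ℂ] (V.V ⊗[ℂ] W.V) →ₗ[ℂ] (tensor U (tensor V W)).V :=
  proj U (tensor V W) ∘ₗ (proj V W).lTensor U.V

theorem projLeft_tmul (U V W : URep H) (u : U.V) (v : V.V) (w : W.V) :
    projLeft U V W (u ⊗ₜ (v ⊗ₜ w)) = proj _ W (proj U V (u ⊗ₜ v) ⊗ₜ w) := rfl

theorem projRight_tmul (U V W : URep H) (u : U.V) (v : V.V) (w : W.V) :
    projRight U V W (u ⊗ₜ (v ⊗ₜ w)) = proj U _ (u ⊗ₜ proj V W (v ⊗ₜ w)) := rfl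

theorem projLeft_inclLeft (U V W : URep H) (x : (tensor (tensor U V) W).V) :
    projLeft U V W (inclLeft U V W x) = x := by
  have h : (proj U V).rTensor W.V ∘ₗ (incl U V).rTensor W.V = LinearMap.id := by
    rw [← LinearMap.rTensor_comp, ← LinearMap.rTensor_id]
    exact congrArg _ (LinearMap.ext (proj_incl U V))
  simp only [projLeft, inclLeft, LinearMap.comp_apply, LinearEquiv.coe_coe,
    LinearEquiv.symm_apply_apply]
  refine (congrArg _ (LinearMap.congr_fun h _)).trans ?_
  rw [LinearMap.id_apply, proj_incl]

theorem projRight_inclRight (U V W : URep H) (x : (tensor U (tensor V W)).V) :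
    projRight U V W (inclRight U V W x) = x := by
  have h : (proj V W).lTensor U.V ∘ₗ (incl V W).lTensor U.V = LinearMap.id := by
    rw [← LinearMap.lTensor_comp, ← LinearMap.lTensor_id]
    exact congrArg _ (LinearMap.ext (proj_incl V W))
  simp only [projRight, inclRight, LinearMap.comp_apply]
  refine (congrArg _ (LinearMap.congr_fun h _)).trans ?_
  rw [LinearMap.id_apply, proj_incl]

theorem inclRight_injective (U V W : URep H) : Function.Injective (inclRight U V W) :=
  Function.LeftInverse.injective (projRight_inclRight U V W)

theorem assoc_act (U V W : URep H) (X : H ⊗[ℂ] H) (s : (tensor U V).V ⊗[ℂ] W.V) :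
    TensorProduct.assoc ℂ U.V V.V W.V ((incl U V).rTensor W.V (act (tensor U V) W X s)) =
      act₃ U V W (comulId ℂ H X)
        (TensorProduct.assoc ℂ U.V V.V W.V ((incl U V).rTensor W.V s)) := by
  induction X with
  | zero => simp
  | add x y hx hy => simp only [map_add, LinearMap.add_apply, hx, hy]
  | tmul a b =>
    induction s with
    | zero => simp
    | add s s' hs hs' => simp only [map_add, hs, hs']
    | tmul x w =>
      simp only [act_tmul, LinearMap.rTensor_tmul, incl_ρ, comulId, LinearMap.comp_apply,
        LinearEquiv.coe_coe]
      generalize Δ a = Y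
      generalize incl U V x = t
      induction Y with
      | zero => simp
      | add x y hx hy =>
        simp only [map_add, LinearMap.add_apply, TensorProduct.add_tmul, hx, hy]
      | tmul c d =>
        induction t with
        | zero => simp
        | add s s' hs hs' => simp only [map_add, TensorProduct.add_tmul, hs, hs']
        | tmul u v => rfl

theorem lTensor_act (U V W : URep H) (X : H ⊗[ℂ] H) (s : U.V ⊗[ℂ] (tensor V W).V) :
    (incl V W).lTensor U.V (act U (tensor V W) X s) =
      act₃ U V W (idComul ℂ H X) ((incl V W).lTensor U.V s) := by
  induction X with
  | zero => simp
  | add x y hx hy => simp only [map_add, LinearMap.add_apply, hx, hy]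
  | tmul a b =>
    induction s with
    | zero => simp
    | add s s' hs hs' => simp only [map_add, hs, hs']
    | tmul u x => rfl

/-- The nested projections compose to `(Δ ⊗ id)Δ(1)` times `Δ(1) ⊗ 1`, and a factorization of the
former absorbs the latter. The other bracketing leads to the same operator, so both are one subspace
of `U ⊗ V ⊗ W`. -/
theorem inclLeft_projLeft (U V W : URep H) (s : U.V ⊗[ℂ] (V.V ⊗[ℂ] W.V)) :
    inclLeft U V W (projLeft U V W s) = act₃ U V W (comulId ℂ H Δ₁) s := by
  have h : ∀ t : U.V ⊗[ℂ] V.V ⊗[ℂ] W.V, TensorProduct.assoc ℂ U.V V.V W.V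
      ((incl U V).rTensor W.V ((proj U V).rTensor W.V t)) =
        act₃ U V W (leg12 Δ₁) (TensorProduct.assoc ℂ U.V V.V W.V t) := by
    intro t
    rw [← LinearMap.comp_apply, ← LinearMap.rTensor_comp]
    change TensorProduct.assoc ℂ U.V V.V W.V ((act U V Δ₁).rTensor W.V t) = _
    generalize Δ₁ = Y
    induction t with
    | zero => simp
    | add s s' hs hs' => simp only [map_add, hs, hs']
    | tmul t w =>
      induction Y with
      | zero => simp
      | add x y hx hy => simp only [map_add, LinearMap.rTensor_add, LinearMap.add_apply, hx, hy]
      | tmul c d =>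
        induction t with
        | zero => simp
        | add s s' hs hs' => simp only [map_add, TensorProduct.add_tmul, hs, hs']
        | tmul u v =>
          simp [leg12, act₃_tmul, act_tmul]
  simp only [projLeft, inclLeft, LinearMap.comp_apply, LinearEquiv.coe_coe, incl_proj]
  rw [assoc_act, h, LinearEquiv.apply_symm_apply, ← Module.End.mul_apply, ← map_mul,
    QuantumGroupoid.comulId_one', mul_assoc, ← map_mul, comulOne_mul_self]

theorem inclRight_projRight (U V W : URep H) (s : U.V ⊗[ℂ] (V.V ⊗[ℂ] W.V)) :
    inclRight U V W (projRight U V W s) = act₃ U V W (comulId ℂ H Δ₁) s := by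
  have h : ∀ t : U.V ⊗[ℂ] (V.V ⊗[ℂ] W.V), (incl V W).lTensor U.V ((proj V W).lTensor U.V t) =
        act₃ U V W (leg23 Δ₁) t := by
    intro t
    rw [← LinearMap.comp_apply, ← LinearMap.lTensor_comp]
    induction t with
    | zero => simp
    | add s s' hs hs' => simp only [map_add, hs, hs']
    | tmul u t => simp [leg23, act₃_tmul, incl_proj]
  have h2 : idComul ℂ H Δ₁ = comulId ℂ H Δ₁ := (comulId_comulOne (H := H)).symm
  simp only [projRight, inclRight, LinearMap.comp_apply, incl_proj]
  rw [lTensor_act, h, ← Module.End.mul_apply, ← map_mul, h2,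
    QuantumGroupoid.comulId_one, mul_assoc, ← map_mul, comulOne_mul_self]

theorem inclLeft_ρ (U V W : URep H) (h : H) (x : (tensor (tensor U V) W).V) :
    inclLeft U V W ((tensor (tensor U V) W).ρ h x) =
      act₃ U V W (comulId ℂ H (Δ h)) (inclLeft U V W x) :=
  assoc_act U V W (Δ h) _

theorem inclRight_ρ (U V W : URep H) (h : H) (x : (tensor U (tensor V W)).V) :
    inclRight U V W ((tensor U (tensor V W)).ρ h x) =
      act₃ U V W (comulId ℂ H (Δ h)) (inclRight U V W x) := by
  have h2 : idComul ℂ H (Δ h) = comulId ℂ H (Δ h) := (coassoc_apply (R := ℂ) h).symm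
  rw [← h2]
  exact lTensor_act U V W (Δ h) _

theorem inclRight_projRight_inclLeft (U V W : URep H) (x : (tensor (tensor U V) W).V) :
    inclRight U V W (projRight U V W (inclLeft U V W x)) = inclLeft U V W x := by
  rw [inclRight_projRight, ← inclLeft_projLeft, projLeft_inclLeft]

theorem inclLeft_projLeft_inclRight (U V W : URep H) (x : (tensor U (tensor V W)).V) :
    inclLeft U V W (projLeft U V W (inclRight U V W x)) = inclRight U V W x := by
  rw [inclLeft_projLeft, ← inclRight_projRight, projRight_inclRight]

/-- The associativity isomorphism. -/
def assocIso (U V W : URep H) : tensor (tensor U V) W ≅ tensor U (tensor V W) :=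
  mkIso (projRight U V W ∘ₗ inclLeft U V W) (projLeft U V W ∘ₗ inclRight U V W)
    (fun h x => inclRight_injective U V W (by
      rw [inclRight_ρ, LinearMap.comp_apply, LinearMap.comp_apply, inclRight_projRight_inclLeft,
        inclRight_projRight_inclLeft, inclLeft_ρ]))
    (fun x => by
      rw [LinearMap.comp_apply, LinearMap.comp_apply, inclRight_projRight_inclLeft,
        projLeft_inclLeft])
    (fun x => by
      rw [LinearMap.comp_apply, LinearMap.comp_apply, inclLeft_projLeft_inclRight,
        projRight_inclRight])

theorem inclRight_assocIso (U V W : URep H) (x : (tensor (tensor U V) W).V) :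
    inclRight U V W (lin (assocIso U V W).hom x) = inclLeft U V W x :=
  inclRight_projRight_inclLeft U V W x

theorem assocIso_tmul (U V W : URep H) (u : U.V) (v : V.V) (w : W.V) :
    lin (assocIso U V W).hom (proj _ W (proj U V (u ⊗ₜ v) ⊗ₜ w)) =
      proj U _ (u ⊗ₜ proj V W (v ⊗ₜ w)) := by
  refine inclRight_injective U V W ?_
  rw [inclRight_assocIso, ← projLeft_tmul, ← projRight_tmul, inclLeft_projLeft,
    inclRight_projRight]

theorem assocIso_inv_tmul (U V W : URep H) (u : U.V) (v : V.V) (w : W.V) :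
    lin (assocIso U V W).inv (proj U _ (u ⊗ₜ proj V W (v ⊗ₜ w))) =
      proj _ W (proj U V (u ⊗ₜ v) ⊗ₜ w) := by
  rw [← assocIso_tmul, lin_inv_hom]

/-- Both bracketings embed isometrically into the same Hilbert space. -/
theorem conj_assocIso (U V W : URep H) : conj (assocIso U V W).hom = (assocIso U V W).inv := by
  refine conj_iso _ fun x y => ?_
  have h1 : ∀ x y : (tensor U (tensor V W)).V,
      ⟪inclRight U V W x, inclRight U V W y⟫_ℂ = ⟪x, y⟫_ℂ := by
    intro x y
    let i : (tensor V W).V →ₗᵢ[ℂ] V.V ⊗[ℂ] W.V := (tensorSpace V W).subtypeₗᵢ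
    exact TensorProduct.inner_map_map (LinearIsometry.id (R := ℂ) (E := U.V)) i _ _
  have h2 : ∀ x y : (tensor (tensor U V) W).V,
      ⟪inclLeft U V W x, inclLeft U V W y⟫_ℂ = ⟪x, y⟫_ℂ := by
    intro x y
    let i : (tensor U V).V →ₗᵢ[ℂ] U.V ⊗[ℂ] V.V := (tensorSpace U V).subtypeₗᵢ
    exact (TensorProduct.inner_assoc_assoc _ _).trans
      (TensorProduct.inner_map_map i (LinearIsometry.id (R := ℂ) (E := W.V)) _ _)
  rw [← h1, inclRight_assocIso, inclRight_assocIso, h2]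

end Tensor

end URep

/-! ### Cancellation identities behind the unit isomorphisms. -/

section Counital

variable {H : Type u} [Ring H] [Algebra ℂ H] [Coalgebra ℂ H] [StarRing H] [StarModule ℂ H]
  [CStarQuantumGroupoid H]

local notation "Δ₁" => comulOne ℂ H
local notation "T" => antipodeInv (H := H)

theorem mul_targetMap_rTensor_comul (h : H) :
    LinearMap.mul' ℂ H ((targetMap ℂ (H := H)).rTensor H (Δ h)) = h := by
  have h1 : ∀ X : H ⊗[ℂ] H, LinearMap.mul' ℂ H (X * (1 ⊗ₜ h)) = LinearMap.mul' ℂ H X * h := by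
    intro X
    induction X with
    | zero => simp
    | add a b ha hb => simp only [map_add, add_mul, ha, hb]
    | tmul a b => simp [mul_assoc]
  rw [targetMap_rTensor_comul, h1]
  change LinearMap.mul' ℂ H ((S ℂ (H := H)).rTensor H (Δ 1)) * h = h
  rw [QuantumGroupoid.antipode_mul', sourceMap_one, one_mul]

theorem mul_comm_antipodeInv_targetMap_comul (h : H) :
    LinearMap.mul' ℂ H (TensorProduct.comm ℂ H H ((T ∘ₗ targetMap ℂ (H := H)).lTensor H (Δ h))) =
      h := by
  have h1 : ∀ X : H ⊗[ℂ] H, LinearMap.mul' ℂ H (TensorProduct.comm ℂ H H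
      ((T).lTensor H (X * (h ⊗ₜ 1)))) =
        LinearMap.mul' ℂ H (TensorProduct.comm ℂ H H ((T).lTensor H X)) * h := by
    intro X
    induction X with
    | zero => simp
    | add a b ha hb => simp only [map_add, add_mul, ha, hb]
    | tmul a b => simp [mul_assoc]
  rw [LinearMap.lTensor_comp, LinearMap.comp_apply, targetMap_lTensor_comul, h1]
  let r := ℛ ℂ (1 : H)
  rw [← sum_comulOne r]
  simp only [map_sum, LinearMap.lTensor_tmul, TensorProduct.comm_tmul, LinearMap.mul'_apply]
  rw [sum_one_antipodeInv_mul, one_mul]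

end Counital

namespace URep

/-! ### The unit object and the unit isomorphisms. -/

section Unitors

variable {H : Type u} [Ring H] [Algebra ℂ H] [Coalgebra ℂ H] [StarRing H] [StarModule ℂ H]
  [CStarQuantumGroupoid H]
  {hpos : ∀ z ∈ targetSpace H, z ≠ 0 → 0 < (counit (R := ℂ) (star z * z)).re}

local notation "Δ₁" => comulOne ℂ H
local notation "T" => antipodeInv (H := H)

variable (hpos) in
/-- The unit of `H_t`. -/
def unitOne : (unitObj hpos).V := (⟨1, one_mem_target⟩ : targetSpace H)

theorem unitIncl_unitOne : unitIncl hpos (unitOne hpos) = 1 := rfl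

theorem unitIncl_mem (z : (unitObj hpos).V) : unitIncl hpos z ∈ targetSpace H := z.2

theorem unitIncl_injective : Function.Injective (unitIncl hpos) := Subtype.val_injective

theorem unitIncl_ρ (h : H) (z : (unitObj hpos).V) :
    unitIncl hpos ((unitObj hpos).ρ h z) = targetMap ℂ (h * unitIncl hpos z) := rfl

theorem inner_unitObj (t z : (unitObj hpos).V) :
    ⟪t, z⟫_ℂ = ε (star (unitIncl hpos t) * unitIncl hpos z) := rfl

theorem ρ_unitIncl_unitOne (z : (unitObj hpos).V) :
    (unitObj hpos).ρ (unitIncl hpos z) (unitOne hpos) = z :=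
  unitIncl_injective (by
    rw [unitIncl_ρ, unitIncl_unitOne, mul_one, targetMap_of_mem (unitIncl_mem z)])

/-- The tensor product is balanced over `H_t`, which acts on the left factor through `S⁻¹`. In
particular tensors with the unit object can be brought to the form `v ⊗ 1` or `1 ⊗ v`. -/
theorem proj_tmul_target (V W : URep H) {z : H} (hz : z ∈ targetSpace H) (v : V.V) (w : W.V) :
    proj V W (v ⊗ₜ W.ρ z w) = proj V W (V.ρ (T z) v ⊗ₜ w) := by
  have h1 := congrArg (fun X => act V W X (v ⊗ₜ w)) (comulOne_mul_target hz)
  simp only [map_mul, Module.End.mul_apply, act_tmul, map_one, Module.End.one_apply] at h1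
  exact proj_eq_iff.2 h1

theorem proj_tmul_unit (V : URep H) (v : V.V) (z : (unitObj hpos).V) :
    proj V (unitObj hpos) (v ⊗ₜ z) =
      proj V (unitObj hpos) (V.ρ (T (unitIncl hpos z)) v ⊗ₜ unitOne hpos) := by
  rw [← proj_tmul_target _ _ (unitIncl_mem z), ρ_unitIncl_unitOne]

theorem proj_unit_tmul (V : URep H) (z : (unitObj hpos).V) (v : V.V) :
    proj (unitObj hpos) V (z ⊗ₜ v) =
      proj (unitObj hpos) V (unitOne hpos ⊗ₜ V.ρ (unitIncl hpos z) v) := by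
  rw [proj_tmul_target _ _ (unitIncl_mem z)]
  congr 2
  refine unitIncl_injective ?_
  rw [unitIncl_ρ, unitIncl_unitOne, mul_one,
    targetMap_of_mem_source (antipodeInv_mem_source (unitIncl_mem z)), antipode_antipodeInv]

variable (hpos) in
/-- The map `z ⊗ v ↦ z v`. -/
def leftAct (V : URep H) : (unitObj hpos).V ⊗[ℂ] V.V →ₗ[ℂ] V.V :=
  TensorProduct.lift (V.ρ.toLinearMap ∘ₗ unitIncl hpos)

theorem leftAct_act (V : URep H) (X : H ⊗[ℂ] H) (v : V.V) :
    leftAct hpos V (act (unitObj hpos) V X (unitOne hpos ⊗ₜ v)) =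
      V.ρ (LinearMap.mul' ℂ H ((targetMap ℂ).rTensor H X)) v := by
  induction X with
  | zero => simp
  | add a b ha hb => simp only [map_add, LinearMap.add_apply, ha, hb]
  | tmul a b => simp [act_tmul, leftAct, unitIncl_ρ, unitIncl_unitOne]

theorem leftAct_incl_proj (V : URep H) (z : (unitObj hpos).V) (v : V.V) :
    leftAct hpos V (incl _ V (proj _ V (z ⊗ₜ v))) = V.ρ (unitIncl hpos z) v := by
  rw [proj_unit_tmul, incl_proj, leftAct_act]
  change V.ρ (LinearMap.mul' ℂ H ((targetMap ℂ).rTensor H (Δ 1))) _ = _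
  rw [mul_targetMap_rTensor_comul, map_one, Module.End.one_apply]

variable (hpos) in
/-- The left unit isomorphism. -/
def leftUnitIso (V : URep H) : tensor (unitObj hpos) V ≅ V :=
  mkIso (leftAct hpos V ∘ₗ incl _ V)
    (proj (unitObj hpos) V ∘ₗ TensorProduct.mk ℂ _ _ (unitOne hpos))
    (fun h x => by
      refine LinearMap.congr_fun (f := (leftAct hpos V ∘ₗ incl _ V) ∘ₗ (tensor _ V).ρ h)
        (g := V.ρ h ∘ₗ leftAct hpos V ∘ₗ incl _ V) (tensor_ext fun z v => ?_) x
      simp only [LinearMap.comp_apply]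
      rw [leftAct_incl_proj, proj_unit_tmul, ρ_proj, incl_proj_act_comul, leftAct_act,
        mul_targetMap_rTensor_comul])
    (fun x => by
      refine LinearMap.congr_fun (f := (proj (unitObj hpos) V ∘ₗ
        TensorProduct.mk ℂ _ _ (unitOne hpos)) ∘ₗ leftAct hpos V ∘ₗ incl _ V)
        (g := LinearMap.id) (tensor_ext fun z v => ?_) x
      simp only [LinearMap.comp_apply, LinearMap.id_apply]
      rw [leftAct_incl_proj, proj_unit_tmul _ z]
      rfl)
    (fun v => by
      change leftAct hpos V (incl _ V (proj _ V (unitOne hpos ⊗ₜ v))) = v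
      rw [leftAct_incl_proj, unitIncl_unitOne, map_one, Module.End.one_apply])

theorem leftUnitIso_tmul (V : URep H) (z : (unitObj hpos).V) (v : V.V) :
    lin (leftUnitIso hpos V).hom (proj _ V (z ⊗ₜ v)) = V.ρ (unitIncl hpos z) v :=
  leftAct_incl_proj V z v

theorem leftUnitIso_inv (V : URep H) (v : V.V) :
    lin (leftUnitIso hpos V).inv v = proj _ V (unitOne hpos ⊗ₜ v) := rfl

/-- Once `z` is moved to the other factor only `1 ⊗ v` occurs, and its scalar product with `1 ⊗ w`
is governed by `ε(1₍₁₎) 1₍₂₎ = 1`. -/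
theorem conj_leftUnitIso (V : URep H) :
    conj (leftUnitIso hpos V).hom = (leftUnitIso hpos V).inv := by
  refine conj_eq_of_inner _ _ fun x w => ?_
  have h2 : ∀ X : H ⊗[ℂ] H, ∀ v : V.V,
      ⟪act (unitObj hpos) V X (unitOne hpos ⊗ₜ v), unitOne hpos ⊗ₜ w⟫_ℂ =
        ⟪V.ρ (TensorProduct.lid ℂ H ((counit (R := ℂ) (A := H)).rTensor H X)) v, w⟫_ℂ := by
    intro X v
    induction X with
    | zero => simp
    | add a b ha hb => simp only [map_add, LinearMap.add_apply, inner_add_left, ha, hb]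
    | tmul a b =>
      have h3 : ε (targetMap ℂ a) = ε a := by simpa using counit_mul_targetMap (1 : H) a
      simp [act_tmul, TensorProduct.inner_tmul, inner_unitObj, unitIncl_ρ, unitIncl_unitOne,
        counit_star, h3, mul_comm]
  have h1 : ∀ v, ⟪proj _ V (unitOne hpos ⊗ₜ v), lin (leftUnitIso hpos V).inv w⟫_ℂ = ⟪v, w⟫_ℂ := by
    intro v
    rw [leftUnitIso_inv, inner_proj_right, incl_proj, h2]
    change ⟪V.ρ (TensorProduct.lid ℂ H ((counit (R := ℂ) (A := H)).rTensor H (Δ 1))) v, w⟫_ℂ = _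
    rw [lid_counit_comul, map_one, Module.End.one_apply]
  rw [← h1, ← leftUnitIso_inv, lin_inv_hom]

variable (hpos) in
/-- The map `v ⊗ z ↦ S⁻¹(z) v`. -/
def rightAct (V : URep H) : V.V ⊗[ℂ] (unitObj hpos).V →ₗ[ℂ] V.V :=
  TensorProduct.lift (V.ρ.toLinearMap ∘ₗ T ∘ₗ unitIncl hpos).flip

theorem rightAct_act (V : URep H) (X : H ⊗[ℂ] H) (v : V.V) :
    rightAct hpos V (act V (unitObj hpos) X (v ⊗ₜ unitOne hpos)) =
      V.ρ (LinearMap.mul' ℂ H (TensorProduct.comm ℂ H H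
        ((T ∘ₗ targetMap ℂ).lTensor H X))) v := by
  induction X with
  | zero => simp
  | add a b ha hb => simp only [map_add, LinearMap.add_apply, ha, hb]
  | tmul a b => simp [act_tmul, rightAct, unitIncl_ρ, unitIncl_unitOne]

theorem rightAct_incl_proj (V : URep H) (v : V.V) (z : (unitObj hpos).V) :
    rightAct hpos V (incl V _ (proj V _ (v ⊗ₜ z))) = V.ρ (T (unitIncl hpos z)) v := by
  rw [proj_tmul_unit, incl_proj, rightAct_act]
  change V.ρ (LinearMap.mul' ℂ H (TensorProduct.comm ℂ H H
        ((T ∘ₗ targetMap ℂ).lTensor H (Δ 1)))) _ = _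
  rw [mul_comm_antipodeInv_targetMap_comul, map_one, Module.End.one_apply]

variable (hpos) in
/-- The right unit isomorphism. -/
def rightUnitIso (V : URep H) : tensor V (unitObj hpos) ≅ V :=
  mkIso (rightAct hpos V ∘ₗ incl V _)
    (proj V (unitObj hpos) ∘ₗ (TensorProduct.mk ℂ _ _).flip (unitOne hpos))
    (fun h x => by
      refine LinearMap.congr_fun (f := (rightAct hpos V ∘ₗ incl V _) ∘ₗ (tensor V _).ρ h)
        (g := V.ρ h ∘ₗ rightAct hpos V ∘ₗ incl V _) (tensor_ext fun v z => ?_) x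
      simp only [LinearMap.comp_apply]
      rw [rightAct_incl_proj, proj_tmul_unit, ρ_proj, incl_proj_act_comul, rightAct_act,
        mul_comm_antipodeInv_targetMap_comul])
    (fun x => by
      refine LinearMap.congr_fun (f := (proj V (unitObj hpos) ∘ₗ
        (TensorProduct.mk ℂ _ _).flip (unitOne hpos)) ∘ₗ rightAct hpos V ∘ₗ incl V _)
        (g := LinearMap.id) (tensor_ext fun v z => ?_) x
      simp only [LinearMap.comp_apply, LinearMap.id_apply]
      rw [rightAct_incl_proj, proj_tmul_unit _ v z]
      rfl)
    (fun v => by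
      change rightAct hpos V (incl V _ (proj V _ (v ⊗ₜ unitOne hpos))) = v
      rw [rightAct_incl_proj, unitIncl_unitOne, antipodeInv_one, map_one, Module.End.one_apply])

theorem rightUnitIso_tmul (V : URep H) (v : V.V) (z : (unitObj hpos).V) :
    lin (rightUnitIso hpos V).hom (proj V _ (v ⊗ₜ z)) = V.ρ (T (unitIncl hpos z)) v :=
  rightAct_incl_proj V v z

theorem rightUnitIso_inv (V : URep H) (v : V.V) :
    lin (rightUnitIso hpos V).inv v = proj V _ (v ⊗ₜ unitOne hpos) := rfl

/-- `1₍₂₎` acts on the unit vector as `ε_t(1₍₂₎)`, and `id ⊗ ε_t` fixes `Δ(1)`. -/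
theorem rightUnitIso_inv_eq (V : URep H) (v : V.V) :
    (unitIncl hpos).lTensor V.V (incl V (unitObj hpos) (lin (rightUnitIso hpos V).inv v)) =
      rightUnitInv V v := by
  have h1 : ∀ X : H ⊗[ℂ] H,
      (unitIncl hpos).lTensor V.V (act V (unitObj hpos) X (v ⊗ₜ unitOne hpos)) =
        (V.ρ.toLinearMap.flip v).rTensor H ((targetMap ℂ).lTensor H X) := by
    intro X
    induction X with
    | zero => simp
    | add a b ha hb => simp only [map_add, LinearMap.add_apply, ha, hb]
    | tmul a b => simp [act_tmul, unitIncl_ρ, unitIncl_unitOne]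
  rw [rightUnitIso_inv, incl_proj, h1, rightUnitInv]
  refine congrArg _ ((targetMap_lTensor_comul 1).trans ?_)
  rw [← Algebra.TensorProduct.one_def, mul_one]

theorem conj_rightUnitIso (V : URep H) :
    conj (rightUnitIso hpos V).hom = (rightUnitIso hpos V).inv := by
  refine conj_eq_of_inner _ _ fun x w => ?_
  have h2 : ∀ X : H ⊗[ℂ] H, ∀ v : V.V,
      ⟪act V (unitObj hpos) X (v ⊗ₜ unitOne hpos), w ⊗ₜ unitOne hpos⟫_ℂ =
        ⟪V.ρ (TensorProduct.rid ℂ H ((counit (R := ℂ) (A := H)).lTensor H X)) v, w⟫_ℂ := by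
    intro X v
    induction X with
    | zero => simp
    | add a b ha hb => simp only [map_add, LinearMap.add_apply, inner_add_left, ha, hb]
    | tmul a b =>
      have h3 : ε (targetMap ℂ b) = ε b := by simpa using counit_mul_targetMap (1 : H) b
      simp [act_tmul, TensorProduct.inner_tmul, inner_unitObj, unitIncl_ρ, unitIncl_unitOne,
        counit_star, h3, mul_comm]
  have h1 : ∀ v, ⟪proj V _ (v ⊗ₜ unitOne hpos), lin (rightUnitIso hpos V).inv w⟫_ℂ = ⟪v, w⟫_ℂ := by
    intro v
    rw [rightUnitIso_inv, inner_proj_right, incl_proj, h2]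
    change ⟪V.ρ (TensorProduct.rid ℂ H ((counit (R := ℂ) (A := H)).lTensor H (Δ 1))) v, w⟫_ℂ = _
    rw [rid_counit_comul, map_one, Module.End.one_apply]
  rw [← h1, ← rightUnitIso_inv, lin_inv_hom]

end Unitors

end URep

namespace URep

/-! ### Braiding and twist. -/

section Braiding

variable {H : Type u} [Ring H] [Algebra ℂ H] [Coalgebra ℂ H] [StarRing H] [StarModule ℂ H]
  [CStarQuantumGroupoid H] {R : H ⊗[ℂ] H} (hR : IsQuasitriangular R)

local notation "Δ₁" => comulOne ℂ H

variable (R) in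
/-- The map `x ↦ R⁽²⁾ x⁽²⁾ ⊗ R⁽¹⁾ x⁽¹⁾`. -/
def braidMap (V W : URep H) : (tensor V W).V →ₗ[ℂ] (tensor W V).V :=
  proj W V ∘ₗ (TensorProduct.comm ℂ V.V W.V).toLinearMap ∘ₗ act V W R ∘ₗ incl V W

theorem comm_comulOne_comulOp :
    TensorProduct.comm ℂ H H Δ₁ = comulOp ℂ H 1 := rfl

theorem comm_comulOp (h : H) : TensorProduct.comm ℂ H H (comulOp ℂ H h) = Δ h :=
  comm_comm _

theorem comm_comm_tensor (V W : URep H) (s : V.V ⊗[ℂ] W.V) :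
    TensorProduct.comm ℂ W.V V.V (TensorProduct.comm ℂ V.V W.V s) = s :=
  (TensorProduct.comm ℂ V.V W.V).symm_apply_apply s

theorem act_comm (V W : URep H) (X : H ⊗[ℂ] H) (s : V.V ⊗[ℂ] W.V) :
    act W V X (TensorProduct.comm ℂ V.V W.V s) =
      TensorProduct.comm ℂ V.V W.V (act V W (TensorProduct.comm ℂ H H X) s) := by
  rw [comm_act, comm_comm]

include hR in
-- Since `Δ^op(1) R = R`, the flipped vector already lies in the image of `Δ(1)`, and the projection
-- in the definition does nothing.
theorem incl_braidMap (V W : URep H) (x : (tensor V W).V) :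
    incl W V (braidMap R V W x) = TensorProduct.comm ℂ V.V W.V (act V W R (incl V W x)) := by
  change act W V Δ₁ (TensorProduct.comm ℂ V.V W.V (act V W R (incl V W x))) = _
  rw [act_comm, ← Module.End.mul_apply, ← map_mul, comm_comulOne_comulOp, hR.comulOp_one_mul]

include hR in
theorem braidMap_proj (V W : URep H) (s : V.V ⊗[ℂ] W.V) :
    braidMap R V W (proj V W s) = proj W V (TensorProduct.comm ℂ V.V W.V (act V W R s)) := by
  change proj W V (TensorProduct.comm ℂ V.V W.V (act V W R (act V W Δ₁ s))) = _
  rw [← Module.End.mul_apply, ← map_mul, hR.mul_comulOne]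

include hR in
theorem braidMap_ρ (V W : URep H) (h : H) (x : (tensor V W).V) :
    braidMap R V W ((tensor V W).ρ h x) = (tensor W V).ρ h (braidMap R V W x) := by
  refine incl_injective _ _ ?_
  rw [incl_braidMap hR, incl_ρ, incl_ρ, incl_braidMap hR, act_comm, ← Module.End.mul_apply,
    ← Module.End.mul_apply, ← map_mul, ← map_mul, ← hR.comulOp_mul]
  rfl

/-- The braiding. -/
def braidIso (V W : URep H) : tensor V W ≅ tensor W V :=
  mkIso (braidMap R V W)
    (proj V W ∘ₗ act V W ((S ℂ (H := H)).rTensor H R) ∘ₗ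
      (TensorProduct.comm ℂ W.V V.V).toLinearMap ∘ₗ incl W V)
    (braidMap_ρ hR V W)
    (fun x => by
      simp only [LinearMap.comp_apply, LinearEquiv.coe_coe]
      rw [incl_braidMap hR, comm_comm_tensor, ← Module.End.mul_apply, ← map_mul,
        hR.rTensor_antipode_mul, act_comulOne_incl, proj_incl])
    (fun x => incl_injective _ _ (by
      simp only [LinearMap.comp_apply, LinearEquiv.coe_coe]
      rw [braidMap_proj hR, ← Module.End.mul_apply, ← map_mul, hR.mul_rTensor_antipode,
        incl_proj, act_comm, comm_comulOne_comulOp, ← Module.End.mul_apply, ← map_mul,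
        ← comulOp_map_mul, one_mul, comm_act, comm_comulOp, comm_comm_tensor]
      exact act_comulOne_incl W V x))

theorem incl_braidIso (V W : URep H) (x : (tensor V W).V) :
    incl W V (lin (braidIso hR V W).hom x) =
      TensorProduct.comm ℂ V.V W.V (act V W R (incl V W x)) := incl_braidMap hR V W x

theorem braidIso_proj (V W : URep H) (s : V.V ⊗[ℂ] W.V) :
    lin (braidIso hR V W).hom (proj V W s) =
      proj W V (TensorProduct.comm ℂ V.V W.V (act V W R s)) := braidMap_proj hR V W s

theorem conj_braidIso (V W : URep H) : conj (braidIso hR V W).hom = (braidIso hR V W).inv := by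
  refine conj_iso _ fun x y => ?_
  rw [inner_tensor, incl_braidIso, incl_braidIso, TensorProduct.inner_comm_comm, inner_act,
    ← Module.End.mul_apply, ← map_mul, hR.star_eq, hR.rTensor_antipode_mul, act_comulOne_incl]
  rfl

theorem braidIso_naturality {V V' W W' : URep H} (f : V ⟶ V') (k : W ⟶ W') :
    tensorMap f k ≫ (braidIso hR V' W').hom = (braidIso hR V W).hom ≫ tensorMap k f := by
  refine hom_tensor_ext fun v w => ?_
  simp only [lin_comp_apply]
  rw [lin_tensorMap, braidIso_proj, braidIso_proj, lin_tensorMap, ← map_act]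
  generalize act V W R (v ⊗ₜ w) = s
  congr 1
  induction s with
  | zero => simp
  | add s s' hs hs' => simp only [map_add, hs, hs']
  | tmul v w => rfl

/-- Both sides apply an element of `H ⊗ H ⊗ H` to `u ⊗ v ⊗ w` and then permute; the elements are
`(id ⊗ Δ)R` and `R₁₃R₁₂`. -/
theorem braidIso_hexagon_forward (U V W : URep H) :
    (assocIso U V W).hom ≫ (braidIso hR U (tensor V W)).hom ≫ (assocIso V W U).hom =
      tensorMap (braidIso hR U V).hom (𝟙 W) ≫ (assocIso V U W).hom ≫
        tensorMap (𝟙 V) (braidIso hR U W).hom := by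
  refine hom_ext (tensor_ext_left fun u v w => ?_)
  let F : H ⊗[ℂ] (H ⊗[ℂ] H) →ₗ[ℂ] (tensor V (tensor W U)).V :=
    projRight V W U ∘ₗ (TensorProduct.assoc ℂ V.V W.V U.V).toLinearMap ∘ₗ
      (TensorProduct.comm ℂ U.V (V.V ⊗[ℂ] W.V)).toLinearMap ∘ₗ
        (act₃ U V W).toLinearMap.flip (u ⊗ₜ (v ⊗ₜ w))
  have h1 : ∀ X : H ⊗[ℂ] H, lin (assocIso V W U).hom (proj _ U (TensorProduct.comm ℂ U.V _
      (act U (tensor V W) X (u ⊗ₜ proj V W (v ⊗ₜ w))))) = F (idComul ℂ H X) := by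
    intro X
    induction X with
    | zero => simp
    | add a b ha hb => simp only [map_add, LinearMap.add_apply, ha, hb]
    | tmul a b =>
      rw [act_tmul, TensorProduct.comm_tmul, ρ_proj, idComul, LinearMap.lTensor_tmul]
      generalize Δ b = Y
      induction Y with
      | zero => simp
      | add x y hx hy =>
        simp only [map_add, LinearMap.add_apply, TensorProduct.add_tmul, TensorProduct.tmul_add,
          hx, hy]
      | tmul c d => exact assocIso_tmul _ _ _ _ _ _
  have h2 : ∀ X : H ⊗[ℂ] H, lin (tensorMap (𝟙 V) (braidIso hR U W).hom)
      (lin (assocIso V U W).hom (proj _ W (proj V U (TensorProduct.comm ℂ U.V V.V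
        (act U V X (u ⊗ₜ v))) ⊗ₜ w))) = F (leg13 R * leg12 X) := by
    intro X
    induction X with
    | zero => simp
    | add a b ha hb =>
      simp only [map_add, LinearMap.add_apply, TensorProduct.add_tmul, mul_add, ha, hb]
    | tmul a b =>
      rw [act_tmul, TensorProduct.comm_tmul, assocIso_tmul, lin_tensorMap_tmul, braidIso_proj]
      generalize R = Y
      induction Y with
      | zero => simp
      | add x y hx hy =>
        simp only [map_add, LinearMap.add_apply, TensorProduct.tmul_add, add_mul,
          hx, hy]
      | tmul c d =>
        simp [F, leg12, leg13, act₃_tmul, act_tmul, projRight_tmul, lin_id_apply]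
  simp only [lin_comp_apply]
  rw [assocIso_tmul, braidIso_proj, h1, hR.idComul, lin_tensorMap_tmul, braidIso_proj,
    lin_id_apply, h2]

theorem braidIso_hexagon_reverse (U V W : URep H) :
    (assocIso U V W).inv ≫ (braidIso hR (tensor U V) W).hom ≫ (assocIso W U V).inv =
      tensorMap (𝟙 U) (braidIso hR V W).hom ≫ (assocIso U W V).inv ≫
        tensorMap (braidIso hR U W).hom (𝟙 V) := by
  refine hom_ext (tensor_ext_right fun u v w => ?_)
  let F : H ⊗[ℂ] (H ⊗[ℂ] H) →ₗ[ℂ] (tensor (tensor W U) V).V :=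
    projLeft W U V ∘ₗ (TensorProduct.comm ℂ (U.V ⊗[ℂ] V.V) W.V).toLinearMap ∘ₗ
      (TensorProduct.assoc ℂ U.V V.V W.V).symm.toLinearMap ∘ₗ
        (act₃ U V W).toLinearMap.flip (u ⊗ₜ (v ⊗ₜ w))
  have h1 : ∀ X : H ⊗[ℂ] H, lin (assocIso W U V).inv (proj W _ (TensorProduct.comm ℂ _ W.V
      (act (tensor U V) W X (proj U V (u ⊗ₜ v) ⊗ₜ w)))) = F (comulId ℂ H X) := by
    intro X
    induction X with
    | zero => simp
    | add a b ha hb => simp only [map_add, LinearMap.add_apply, ha, hb]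
    | tmul a b =>
      have h3 : comulId ℂ H (a ⊗ₜ b) = TensorProduct.assoc ℂ H H H (Δ a ⊗ₜ b) := rfl
      rw [act_tmul, TensorProduct.comm_tmul, ρ_proj, h3]
      generalize Δ a = Y
      induction Y with
      | zero => simp
      | add x y hx hy =>
        simp only [map_add, LinearMap.add_apply, TensorProduct.add_tmul, TensorProduct.tmul_add,
          hx, hy]
      | tmul c d => exact assocIso_inv_tmul _ _ _ _ _ _
  have h2 : ∀ X : H ⊗[ℂ] H, lin (tensorMap (braidIso hR U W).hom (𝟙 V))
      (lin (assocIso U W V).inv (proj U _ (u ⊗ₜ proj W V (TensorProduct.comm ℂ V.V W.V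
        (act V W X (v ⊗ₜ w)))))) = F (leg13 R * leg23 X) := by
    intro X
    induction X with
    | zero => simp
    | add a b ha hb =>
      simp only [map_add, LinearMap.add_apply, TensorProduct.tmul_add, mul_add, ha, hb]
    | tmul a b =>
      rw [act_tmul, TensorProduct.comm_tmul, assocIso_inv_tmul, lin_tensorMap_tmul, braidIso_proj]
      generalize R = Y
      induction Y with
      | zero => simp
      | add x y hx hy =>
        simp only [map_add, LinearMap.add_apply, TensorProduct.add_tmul, add_mul,
          hx, hy]
      | tmul c d =>
        simp [F, leg23, leg13, act₃_tmul, act_tmul, projLeft_tmul, lin_id_apply]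
  simp only [lin_comp_apply]
  rw [assocIso_inv_tmul, braidIso_proj, h1, hR.comulId, lin_tensorMap_tmul, braidIso_proj,
    lin_id_apply, h2]

/-! #### The twist -/

variable {g : Hˣ} (hg : IsCanonicalGrouplike (g : H))

/-- The twist. -/
def twistIso (V : URep H) : V ≅ V :=
  mkIso (V.ρ (ribbonElement R g)) (V.ρ (Ring.inverse (ribbonElement R g)))
    (fun h v => by
      rw [← Module.End.mul_apply, ← Module.End.mul_apply, ← map_mul, ← map_mul,
        Subalgebra.mem_center_iff.1 (hR.ribbonElement_mem_center hg.isCanonical)])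
    (fun v => by
      rw [← Module.End.mul_apply, ← map_mul,
        Ring.inverse_mul_cancel _ (hR.isUnit_ribbonElement hg.isCanonical), map_one,
        Module.End.one_apply])
    (fun v => by
      rw [← Module.End.mul_apply, ← map_mul,
        Ring.mul_inverse_cancel _ (hR.isUnit_ribbonElement hg.isCanonical), map_one,
        Module.End.one_apply])

theorem twistIso_apply (V : URep H) (v : V.V) :
    lin (twistIso hR hg V).hom v = V.ρ (ribbonElement R g) v := rfl

theorem conj_twistIso (V : URep H) : conj (twistIso hR hg V).hom = (twistIso hR hg V).inv := by
  refine conj_iso _ fun x y => ?_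
  rw [twistIso_apply, twistIso_apply, V.unitary, ← Module.End.mul_apply, ← map_mul,
    hR.star_ribbonElement hg.isCanonical,
    Ring.inverse_mul_cancel _ (hR.isUnit_ribbonElement hg.isCanonical), map_one,
    Module.End.one_apply]

theorem twistIso_naturality {V W : URep H} (f : V ⟶ W) :
    f ≫ (twistIso hR hg W).hom = (twistIso hR hg V).hom ≫ f :=
  hom_ext_apply fun v => by
    rw [lin_comp_apply, lin_comp_apply, twistIso_apply, twistIso_apply, lin_comm]

/-- The double braiding acts as `R₂₁ R`, so this is the coproduct formula for `ν`. -/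
theorem twistIso_tensor (V W : URep H) : (twistIso hR hg (tensor V W)).hom =
    tensorMap (twistIso hR hg V).hom (twistIso hR hg W).hom ≫ (braidIso hR V W).hom ≫
      (braidIso hR W V).hom := by
  refine hom_tensor_ext fun v w => ?_
  have hc : ∀ X : H ⊗[ℂ] H, X * (ribbonElement R g ⊗ₜ ribbonElement R g) =
      (ribbonElement R g ⊗ₜ ribbonElement R g) * X := by
    have := Subalgebra.mem_center_iff.1 (hR.ribbonElement_mem_center hg.isCanonical)
    intro X
    induction X with
    | zero => simp
    | add a b ha hb => simp only [mul_add, add_mul, ha, hb]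
    | tmul a b => simp [this]
  simp only [lin_comp_apply]
  rw [lin_tensorMap_tmul, braidIso_proj, braidIso_proj, twistIso_apply, twistIso_apply,
    twistIso_apply, ρ_proj, act_comm, comm_comm_tensor, ← act_tmul, ← Module.End.mul_apply,
    ← Module.End.mul_apply, ← map_mul, ← map_mul, hR.comul_ribbonElement hg.isCanonical, hc]

/-- By centrality `ν` acts on `z = z · 1` through its action on the unit vector, which is `ε_t(ν) =
1`. -/
theorem twistIso_unit {hpos : ∀ z ∈ targetSpace H, z ≠ 0 → 0 < (counit (R := ℂ) (star z * z)).re} :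
    (twistIso hR hg (unitObj hpos)).hom = 𝟙 (unitObj hpos) := by
  refine hom_ext_apply fun z => ?_
  have h1 : (unitObj hpos).ρ (ribbonElement R g) (unitOne hpos) = unitOne hpos :=
    unitIncl_injective (by
      rw [unitIncl_ρ, unitIncl_unitOne, mul_one, hR.targetMap_ribbonElement hg.isCanonical])
  conv_lhs => rw [← ρ_unitIncl_unitOne z]
  rw [twistIso_apply, ← Module.End.mul_apply, ← map_mul,
    ← Subalgebra.mem_center_iff.1 (hR.ribbonElement_mem_center hg.isCanonical), map_mul,
    Module.End.mul_apply, h1, ρ_unitIncl_unitOne, lin_id_apply]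

end Braiding

end URep

namespace URep

/-! ### Coevaluation and evaluation. -/

section Duality

variable {H : Type u} [Ring H] [Algebra ℂ H] [Coalgebra ℂ H] [StarRing H] [StarModule ℂ H]
  [CStarQuantumGroupoid H] {g : H} {hg : IsCanonicalGrouplike g}
  {hpos : ∀ z ∈ targetSpace H, z ≠ 0 → 0 < (counit (R := ℂ) (star z * z)).re}
  {hS : ∀ h : H, S ℂ (star (S ℂ (star h))) = h}

local notation "Δ₁" => comulOne ℂ H
local notation "T" => antipodeInv (H := H)

/-- The functional underlying an element of `V*`. -/
def toDual (V : URep H) : (dualObj hg hS V).V ≃ₗ[ℂ] Module.Dual ℂ V.V := LinearEquiv.refl ℂ _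

theorem toDual_ρ (V : URep H) (h : H) (φ : (dualObj hg hS V).V) (v : V.V) :
    toDual V ((dualObj hg hS V).ρ h φ) v = toDual V φ (V.ρ (S ℂ h) v) := rfl

theorem inner_dualObj (V : URep H) (ψ φ : (dualObj hg hS V).V) :
    ⟪ψ, φ⟫_ℂ = ⟪V.ρ g (vec V (toDual V φ)), vec V (toDual V ψ)⟫_ℂ := rfl

variable (hg hS) in
/-- The operator `x ↦ φ(x) v` attached to `v ⊗ φ`. -/
def toEnd (V : URep H) : V.V ⊗[ℂ] (dualObj hg hS V).V →ₗ[ℂ] Module.End ℂ V.V :=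
  TensorProduct.lift (LinearMap.mk₂ ℂ (fun v φ => (toDual V φ).smulRight v)
    (fun v w φ => by ext; simp) (fun a v φ => by ext; exact smul_comm _ _ _)
    (fun v φ ψ => by ext; simp [add_smul]) (fun a v φ => by ext; simp [mul_smul]))

theorem toEnd_tmul (V : URep H) (v : V.V) (φ : (dualObj hg hS V).V) (x : V.V) :
    toEnd hg hS V (v ⊗ₜ φ) x = toDual V φ x • v := rfl

/-- Passing to operators on `V` turns the action of `a ⊗ b` into `E ↦ a E S(b)` and the coevaluation
into the identity, so identities in `V ⊗ V*` become identities in `H`. -/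
theorem toEnd_injective (V : URep H) : Function.Injective (toEnd hg hS V) := by
  let b := Module.finBasis ℂ V.V
  refine Function.LeftInverse.injective
    (g := fun E => ∑ i, E (b i) ⊗ₜ (toDual (hg := hg) (hS := hS) V).symm (b.coord i)) fun s => ?_
  induction s with
  | zero => simp
  | add s t hs ht =>
    simp only [map_add, LinearMap.add_apply, TensorProduct.add_tmul, Finset.sum_add_distrib, hs, ht]
  | tmul v φ =>
    simp only [toEnd_tmul, TensorProduct.smul_tmul, ← TensorProduct.tmul_sum, ← map_smul, ← map_sum]
    congr 1
    rw [LinearEquiv.symm_apply_eq]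
    refine b.ext fun j => ?_
    simp

theorem toEnd_act_tmul (V : URep H) (a b : H) (s : V.V ⊗[ℂ] (dualObj hg hS V).V) :
    toEnd hg hS V (act V (dualObj hg hS V) (a ⊗ₜ b) s) =
      V.ρ a * toEnd hg hS V s * V.ρ (S ℂ b) := by
  induction s with
  | zero => simp
  | add s t hs ht => simp only [map_add, mul_add, add_mul, hs, ht]
  | tmul v φ =>
    ext x
    rw [act_tmul, toEnd_tmul, toDual_ρ, Module.End.mul_apply, Module.End.mul_apply, toEnd_tmul,
      map_smul]

variable (hg hS) in
/-- The element `∑ f_i ⊗ ξ^i` of `V ⊗ V*`. -/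
def coevOne (V : URep H) : V.V ⊗[ℂ] (dualObj hg hS V).V := coevaluation ℂ V.V 1

theorem toEnd_coevOne (V : URep H) : toEnd hg hS V (coevOne hg hS V) = 1 := by
  let b := Module.Basis.ofVectorSpace ℂ V.V
  have h1 : coevOne hg hS V = ∑ i, b i ⊗ₜ (toDual (hg := hg) (hS := hS) V).symm (b.coord i) :=
    coevaluation_apply_one ℂ V.V
  ext x
  rw [h1, map_sum, LinearMap.sum_apply]
  exact b.sum_repr x

theorem toEnd_act_coevOne (V : URep H) (X : H ⊗[ℂ] H) :
    toEnd hg hS V (act V (dualObj hg hS V) X (coevOne hg hS V)) =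
      V.ρ (LinearMap.mul' ℂ H ((S ℂ (H := H)).lTensor H X)) := by
  induction X with
  | zero => simp
  | add a b ha hb => simp only [map_add, LinearMap.add_apply, ha, hb]
  | tmul a b => rw [toEnd_act_tmul, toEnd_coevOne, mul_one, ← map_mul]; rfl

theorem toEnd_act_comul_coevOne (V : URep H) (h : H) :
    toEnd hg hS V (act V (dualObj hg hS V) (Δ h) (coevOne hg hS V)) = V.ρ (targetMap ℂ h) := by
  rw [toEnd_act_coevOne, QuantumGroupoid.mul_antipode]

variable (hpos hg hS) in
/-- The coevaluation `b_V(z) = z · ∑ f_i ⊗ ξ^i`. -/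
def coevHom (V : URep H) : unitObj hpos ⟶ tensor V (dualObj hg hS V) :=
  mkHom (proj V (dualObj hg hS V) ∘ₗ (act V (dualObj hg hS V)).toLinearMap.flip (coevOne hg hS V) ∘ₗ
    Δ ∘ₗ unitIncl hpos) fun h z => incl_injective _ _ (toEnd_injective V (by
      change toEnd hg hS V (incl _ _ (proj _ _ (act _ _ (Δ _) _))) =
        toEnd hg hS V (incl _ _ ((tensor V (dualObj hg hS V)).ρ h (proj _ _ (act _ _ (Δ _) _))))
      rw [incl_ρ, incl_proj_act_comul, incl_proj_act_comul, toEnd_act_comul_coevOne,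
        ← Module.End.mul_apply, ← map_mul, ← comul_mul, toEnd_act_comul_coevOne,
        targetMap_of_mem (unitIncl_mem _), unitIncl_ρ]))

theorem incl_coevHom (V : URep H) (z : (unitObj hpos).V) :
    incl V (dualObj hg hS V) (lin (coevHom hg hpos hS V) z) =
      act V (dualObj hg hS V) (Δ (unitIncl hpos z)) (coevOne hg hS V) :=
  incl_proj_act_comul _ _ _ _

theorem toEnd_incl_coevHom (V : URep H) (z : (unitObj hpos).V) :
    toEnd hg hS V (incl V (dualObj hg hS V) (lin (coevHom hg hpos hS V) z)) =
      V.ρ (unitIncl hpos z) := by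
  rw [incl_coevHom, toEnd_act_comul_coevOne, targetMap_of_mem (unitIncl_mem _)]

theorem coevHom_unitOne (V : URep H) : lin (coevHom hg hpos hS V) (unitOne hpos) =
    proj V (dualObj hg hS V) (coevOne hg hS V) :=
  proj_act_comulOne V (dualObj hg hS V) (coevOne hg hS V)

/-- The map `a ⊗ b ↦ φ(a v) b`. -/
def evPair (V : URep H) (φ : (dualObj hg hS V).V) (v : V.V) : H ⊗[ℂ] H →ₗ[ℂ] H :=
  (TensorProduct.lid ℂ H).toLinearMap ∘ₗ (toDual V φ ∘ₗ V.ρ.toLinearMap.flip v).rTensor H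

theorem evPair_tmul (V : URep H) (φ : (dualObj hg hS V).V) (v : V.V) (a b : H) :
    evPair V φ v (a ⊗ₜ b) = toDual V φ (V.ρ a v) • b := rfl

variable (hg hS) in
/-- The map `φ ⊗ v ↦ φ(1₍₁₎ v) 1₍₂₎`. -/
def evAux (V : URep H) : (dualObj hg hS V).V ⊗[ℂ] V.V →ₗ[ℂ] H := evMap V

theorem evAux_tmul (V : URep H) (φ : (dualObj hg hS V).V) (v : V.V) :
    evAux hg hS V (φ ⊗ₜ v) = evPair V φ v Δ₁ := rfl

theorem evAux_act (V : URep H) (X : H ⊗[ℂ] H) (φ : (dualObj hg hS V).V) (v : V.V) :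
    evAux hg hS V (act (dualObj hg hS V) V X (φ ⊗ₜ v)) =
      evPair V φ v (TensorProduct.lift (LinearMap.mk₂ ℂ
        (fun a b : H => (S ℂ a ⊗ₜ 1) * Δ₁ * (b ⊗ₜ 1))
        (fun a a' b => by simp [TensorProduct.add_tmul, add_mul])
        (fun c a b => by
          rw [map_smul, ← TensorProduct.smul_tmul', smul_mul_assoc, smul_mul_assoc])
        (fun a b b' => by simp [TensorProduct.add_tmul, mul_add])
        (fun c a b => by rw [← TensorProduct.smul_tmul', mul_smul_comm])) X) := by
  induction X with
  | zero => simp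
  | add a b ha hb => simp only [map_add, LinearMap.add_apply, ha, hb]
  | tmul a b =>
    rw [act_tmul, evAux_tmul, TensorProduct.lift.tmul, LinearMap.mk₂_apply]
    generalize Δ₁ = Y
    induction Y with
    | zero => simp
    | add x y hx hy => simp only [map_add, mul_add, add_mul, hx, hy]
    | tmul c d => simp [evPair_tmul, toDual_ρ]

/-- The claim comes down to `Σ (S(h₍₁₎) ⊗ 1)Δ(1)(h₍₂₎ ⊗ 1) = (id ⊗ ε_t)((1 ⊗ h)Δ(1))`. Replace
`Δ(1)(h₍₂₎ ⊗ 1)` by `(id ⊗ ε_t)Δ(h₍₂₎)` and use the Sweedler identity for `Σ (S(h₍₁₎) ⊗ 1)Δ(h₍₂₎)`.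
-/
theorem evAux_act_comul (V : URep H) (h : H) (s : (dualObj hg hS V).V ⊗[ℂ] V.V) :
    evAux hg hS V (act (dualObj hg hS V) V (Δ h) s) = targetMap ℂ (h * evAux hg hS V s) := by
  induction s with
  | zero => simp
  | add s t hs ht => simp only [map_add, mul_add, hs, ht]
  | tmul φ v =>
    let r := ℛ ℂ h
    have h1 : ∀ (x : H) (X : H ⊗[ℂ] H), (x ⊗ₜ 1) * (targetMap ℂ).lTensor H X =
        (targetMap ℂ).lTensor H ((x ⊗ₜ 1) * X) := by
      intro x X
      induction X with
      | zero => simp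
      | add a b ha hb => simp only [map_add, mul_add, ha, hb]
      | tmul a b => simp
    rw [evAux_act, ← r.eq, map_sum]
    simp only [TensorProduct.lift.tmul, LinearMap.mk₂_apply, mul_assoc]
    simp only [← targetMap_lTensor_comul, h1]
    rw [← map_sum, sum_antipode_mul_comul, evAux_tmul]
    generalize Δ₁ = Y
    induction Y with
    | zero => simp
    | add x y hx hy => simp only [map_add, mul_add, hx, hy]
    | tmul c d => simp [evPair_tmul]

theorem evAux_mem (V : URep H) (s : (dualObj hg hS V).V ⊗[ℂ] V.V) :
    evAux hg hS V s ∈ targetSpace H := by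
  induction s with
  | zero => simp
  | add s t hs ht => rw [map_add]; exact Submodule.add_mem _ hs ht
  | tmul φ v =>
    obtain ⟨r, -, hr⟩ := exists_repr_one (H := H)
    rw [evAux_tmul, ← sum_comulOne r, map_sum]
    exact Submodule.sum_mem _ fun i _ => Submodule.smul_mem _ _ (hr i)

theorem evAux_act_comulOne (V : URep H) (s : (dualObj hg hS V).V ⊗[ℂ] V.V) :
    evAux hg hS V (act (dualObj hg hS V) V Δ₁ s) = evAux hg hS V s := by
  have := evAux_act_comul V 1 s
  rwa [one_mul, targetMap_of_mem (evAux_mem V s)] at this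

variable (hpos hg hS) in
/-- The evaluation. -/
def evHom (V : URep H) : tensor (dualObj hg hS V) V ⟶ unitObj hpos :=
  mkHom (LinearMap.codRestrict (targetSpace H) (evAux hg hS V ∘ₗ incl (dualObj hg hS V) V)
    fun _ => evAux_mem V _) fun h _ => unitIncl_injective (evAux_act_comul V h _)

theorem unitIncl_evHom (V : URep H) (x : (tensor (dualObj hg hS V) V).V) :
    unitIncl hpos (lin (evHom hg hpos hS V) x) = evAux hg hS V (incl _ _ x) := rfl

theorem unitIncl_evHom_proj (V : URep H) (s : (dualObj hg hS V).V ⊗[ℂ] V.V) :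
    unitIncl hpos (lin (evHom hg hpos hS V) (proj _ _ s)) = evAux hg hS V s := by
  rw [unitIncl_evHom, incl_proj, evAux_act_comulOne]

/-- In terms of operators, associativity, evaluation and `r_V` send `E ⊗ v` to `S⁻¹(1₍₂₎) E 1₍₁₎ v`.
For `E = z ∈ H_t` the factor `S⁻¹(1₍₂₎) ∈ H_s` commutes with `z`, and `S⁻¹(1₍₂₎) 1₍₁₎ = 1`. -/
theorem coevHom_evHom (V : URep H) :
    tensorMap (coevHom hg hpos hS V) (𝟙 V) ≫ (assocIso V (dualObj hg hS V) V).hom ≫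
      tensorMap (𝟙 V) (evHom hg hpos hS V) =
        (leftUnitIso hpos V).hom ≫ (rightUnitIso hpos V).inv := by
  refine hom_tensor_ext fun z v => ?_
  let Q : Module.End ℂ V.V →ₗ[ℂ] H ⊗[ℂ] H →ₗ[ℂ] V.V :=
    LinearMap.mk₂ ℂ (fun E X => TensorProduct.lift (LinearMap.mk₂ ℂ
        (fun a b => V.ρ (T b) (E (V.ρ a v)))
        (fun a a' b => by simp) (fun c a b => by simp) (fun a b b' => by simp)
        (fun c a b => by simp)) X)
      (fun E E' X => by
        induction X with
        | zero => simp
        | add a b ha hb => rw [map_add, map_add, map_add, ha, hb]; abel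
        | tmul a b => simp)
      (fun c E X => by
        induction X with
        | zero => simp
        | add a b ha hb => rw [map_add, map_add, ha, hb, smul_add]
        | tmul a b => simp)
      (fun E X Y => map_add _ _ _) (fun c E X => map_smul _ _ _)
  have hQ : ∀ E a b, Q E (a ⊗ₜ b) = V.ρ (T b) (E (V.ρ a v)) := fun _ _ _ => rfl
  have h1 : ∀ s : V.V ⊗[ℂ] (dualObj hg hS V).V, lin (rightUnitIso hpos V).hom
      (lin (tensorMap (𝟙 V) (evHom hg hpos hS V)) (lin (assocIso V (dualObj hg hS V) V).hom
        (proj _ V (proj V _ s ⊗ₜ v)))) = Q (toEnd hg hS V s) Δ₁ := by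
    intro s
    induction s with
    | zero => simp
    | add s t hs ht =>
      simp only [map_add, LinearMap.add_apply, TensorProduct.add_tmul, hs, ht]
    | tmul w φ =>
      rw [assocIso_tmul, lin_tensorMap_tmul, rightUnitIso_tmul, unitIncl_evHom_proj, evAux_tmul,
        lin_id_apply]
      generalize Δ₁ = Y
      induction Y with
      | zero => simp
      | add x y hx hy => simp only [map_add, LinearMap.add_apply, hx, hy]
      | tmul c d =>
        rw [evPair_tmul, hQ, toEnd_tmul, map_smul, map_smul, map_smul, LinearMap.smul_apply]
  have h2 : Q (V.ρ (unitIncl hpos z)) Δ₁ = V.ρ (unitIncl hpos z) v := by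
    obtain ⟨r, -, hr⟩ := exists_repr_one (H := H)
    rw [← sum_comulOne r, map_sum]
    have h3 : ∀ i, V.ρ (T (r.right i)) (V.ρ (unitIncl hpos z) (V.ρ (r.left i) v)) =
        V.ρ (unitIncl hpos z * (T (r.right i) * r.left i)) v := fun i => by
      rw [← mul_assoc, ← commute_source_target (antipodeInv_mem_source (hr i)) (unitIncl_mem z),
        map_mul, map_mul]
      rfl
    simp only [hQ, h3]
    rw [← LinearMap.sum_apply, ← map_sum, ← Finset.mul_sum, sum_one_antipodeInv_mul, mul_one]
  have h3 := h1 (incl _ _ (lin (coevHom hg hpos hS V) z))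
  rw [proj_incl, toEnd_incl_coevHom, h2] at h3
  simp only [lin_comp_apply]
  rw [lin_tensorMap_tmul, lin_id_apply, leftUnitIso_tmul, ← h3, lin_inv_hom]

/-- After moving `z` into `φ`, the composite takes at `x` the value `φ(1₍₁₎ E S(1₍₂₎) x)` with `E`
the identity operator, and `1₍₁₎ S(1₍₂₎) = 1`. -/
theorem evHom_coevHom (V : URep H) :
    tensorMap (𝟙 (dualObj hg hS V)) (coevHom hg hpos hS V) ≫
      (assocIso (dualObj hg hS V) V (dualObj hg hS V)).inv ≫
        tensorMap (evHom hg hpos hS V) (𝟙 (dualObj hg hS V)) =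
          (rightUnitIso hpos (dualObj hg hS V)).hom ≫ (leftUnitIso hpos (dualObj hg hS V)).inv := by
  refine hom_tensor_ext fun φ z => ?_
  rw [proj_tmul_unit]
  generalize (dualObj hg hS V).ρ (T (unitIncl hpos z)) φ = φ
  have h1 : ∀ (s : V.V ⊗[ℂ] (dualObj hg hS V).V) (x : V.V),
      toDual V (lin (leftUnitIso hpos _).hom
        (lin (tensorMap (evHom hg hpos hS V) (𝟙 (dualObj hg hS V)))
          (lin (assocIso (dualObj hg hS V) V (dualObj hg hS V)).inv
            (proj (dualObj hg hS V) _ (φ ⊗ₜ proj V (dualObj hg hS V) s))))) x =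
        toDual V φ (TensorProduct.lift (LinearMap.mk₂ ℂ
        (fun a b => V.ρ a (toEnd hg hS V s (V.ρ (S ℂ b) x)))
        (fun a a' b => by simp) (fun c a b => by simp) (fun a b b' => by simp)
        (fun c a b => by simp)) Δ₁) := by
    intro s x
    induction s with
    | zero =>
      simp only [map_zero, TensorProduct.tmul_zero, LinearMap.zero_apply]
      generalize Δ₁ = Y
      induction Y with
      | zero => simp
      | add x y hx hy => rw [map_add, map_add, ← hx, ← hy, add_zero]
      | tmul c d => simp
    | add s t hs ht =>
      simp only [map_add, LinearMap.add_apply, TensorProduct.tmul_add, hs, ht]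
      rw [← map_add]
      congr 1
      generalize Δ₁ = Y
      induction Y with
      | zero => simp
      | add x y hx hy => simp only [map_add, ← hx, ← hy]; abel
      | tmul c d => simp
    | tmul w ψ =>
      rw [assocIso_inv_tmul, lin_tensorMap_tmul, leftUnitIso_tmul, unitIncl_evHom_proj, evAux_tmul,
        lin_id_apply, toDual_ρ]
      generalize Δ₁ = Y
      induction Y with
      | zero => simp
      | add x y hx hy => simp only [map_add, LinearMap.add_apply, hx, hy]
      | tmul c d =>
        simp [evPair_tmul, toEnd_tmul, mul_comm]
  have h2 : lin (leftUnitIso hpos _).hom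
        (lin (tensorMap (evHom hg hpos hS V) (𝟙 (dualObj hg hS V)))
          (lin (assocIso (dualObj hg hS V) V (dualObj hg hS V)).inv
            (proj (dualObj hg hS V) _ (φ ⊗ₜ proj V (dualObj hg hS V) (coevOne hg hS V))))) = φ := by
    refine (toDual V).injective (LinearMap.ext fun x => ?_)
    rw [h1, toEnd_coevOne]
    let r := ℛ ℂ (1 : H)
    rw [← sum_comulOne r]
    simp only [map_sum, TensorProduct.lift.tmul, LinearMap.mk₂_apply, Module.End.one_apply]
    simp only [← Module.End.mul_apply, ← map_mul]
    rw [← map_sum, ← LinearMap.sum_apply, ← map_sum, sum_left_mul_antipode, targetMap_one, map_one,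
      Module.End.one_apply]
  simp only [lin_comp_apply]
  rw [lin_tensorMap_tmul, lin_id_apply, rightUnitIso_tmul, coevHom_unitOne, unitIncl_unitOne,
    antipodeInv_one, map_one, Module.End.one_apply]
  conv_rhs => rw [← h2, lin_inv_hom]

end Duality

end URep

namespace URep

/-! ### Twist and duality; adjoints of coevaluation and evaluation. -/

section Ribbon

variable {H : Type u} [Ring H] [Algebra ℂ H] [Coalgebra ℂ H] [StarRing H] [StarModule ℂ H]
  [CStarQuantumGroupoid H] {R : H ⊗[ℂ] H} (hR : IsQuasitriangular R)
  {g : Hˣ} {hg : IsCanonicalGrouplike (g : H)}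
  {hpos : ∀ z ∈ targetSpace H, z ≠ 0 → 0 < (counit (R := ℂ) (star z * z)).re}
  {hS : ∀ h : H, S ℂ (star (S ℂ (star h))) = h}

local notation "Δ₁" => comulOne ℂ H
local notation "T" => antipodeInv (H := H)

/-- As operators on `V` the two sides are `νz` and `z S(ν)`. -/
theorem coevHom_twist (V : URep H) :
    coevHom hg hpos hS V ≫ tensorMap (twistIso hR hg V).hom (𝟙 (dualObj hg hS V)) =
      coevHom hg hpos hS V ≫ tensorMap (𝟙 V) (twistIso hR hg (dualObj hg hS V)).hom := by
  refine hom_ext_apply fun z => incl_injective _ _ (toEnd_injective V ?_)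
  set ν := ribbonElement R g with hν
  have h1 : ∀ s : V.V ⊗[ℂ] (dualObj hg hS V).V,
      TensorProduct.map (lin (twistIso hR hg V).hom) (lin (𝟙 (dualObj hg hS V))) s =
        act V (dualObj hg hS V) (ν ⊗ₜ 1) s := by
    intro s
    induction s with
    | zero => simp
    | add s t hs ht => simp only [map_add, hs, ht]
    | tmul v φ =>
      rw [act_tmul, map_one]
      rfl
  have h2 : ∀ s : V.V ⊗[ℂ] (dualObj hg hS V).V,
      TensorProduct.map (lin (𝟙 V)) (lin (twistIso hR hg (dualObj hg hS V)).hom) s =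
        act V (dualObj hg hS V) (1 ⊗ₜ ν) s := by
    intro s
    induction s with
    | zero => simp
    | add s t hs ht => simp only [map_add, hs, ht]
    | tmul v φ =>
      rw [act_tmul, map_one]
      rfl
  rw [lin_comp_apply, lin_comp_apply, incl_lin_tensorMap, incl_lin_tensorMap, h1, h2,
    toEnd_act_tmul, toEnd_act_tmul, toEnd_incl_coevHom, hν, hR.antipode_ribbonElement hg.isCanonical,
    S, antipode_one, map_one, one_mul, mul_one, ← map_mul, ← map_mul,
    Subalgebra.mem_center_iff.1 (hR.ribbonElement_mem_center hg.isCanonical)]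

theorem evHom_twist (V : URep H) :
    tensorMap (twistIso hR hg (dualObj hg hS V)).hom (𝟙 V) ≫ evHom hg hpos hS V =
      tensorMap (𝟙 (dualObj hg hS V)) (twistIso hR hg V).hom ≫ evHom hg hpos hS V := by
  refine hom_tensor_ext fun φ v => unitIncl_injective ?_
  simp only [lin_comp_apply]
  rw [lin_tensorMap_tmul, lin_tensorMap_tmul, unitIncl_evHom_proj, unitIncl_evHom_proj,
    twistIso_apply, twistIso_apply, lin_id_apply, lin_id_apply, evAux_tmul, evAux_tmul]
  generalize Δ₁ = Y
  induction Y with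
  | zero => simp
  | add x y hx hy => simp only [map_add, hx, hy]
  | tmul c d =>
    rw [evPair_tmul, evPair_tmul, toDual_ρ, hR.antipode_ribbonElement hg.isCanonical,
      ← Module.End.mul_apply, ← Module.End.mul_apply, ← map_mul, ← map_mul,
      Subalgebra.mem_center_iff.1 (hR.ribbonElement_mem_center hg.isCanonical)]

theorem star_coe_grouplike (hg : IsCanonicalGrouplike (g : H)) : star (g : H) = g := by
  obtain ⟨a, ha⟩ := hg.positive
  rw [ha, star_mul, star_star]

/-- For an orthonormal basis `(b_i)` of `V` the dual basis consists of the `b̄_i`, so the `g` on the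
right comes from the scalar product of `V*`. -/
theorem inner_coevOne (V : URep H) (v : V.V) (φ : (dualObj hg hS V).V) :
    ⟪coevOne hg hS V, v ⊗ₜ[ℂ] φ⟫_ℂ = toDual V φ (V.ρ (g : H) v) := by
  let b := stdOrthonormalBasis ℂ V.V
  let ψ : ∀ i, (dualObj hg hS V).V := fun i => (toDual V).symm (innerₛₗ ℂ (b i))
  have h1 : coevOne hg hS V = ∑ i, b i ⊗ₜ ψ i := by
    refine toEnd_injective V ?_
    rw [toEnd_coevOne]
    ext x
    rw [map_sum, LinearMap.sum_apply]
    exact (b.sum_repr' x).symm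
  have h2 : ∀ i, vec V (toDual V (ψ i)) = b i := fun i =>
    ext_inner_right ℂ fun x => inner_vec V _ x
  rw [h1, sum_inner]
  simp only [TensorProduct.inner_tmul, inner_dualObj, h2]
  have h3 := b.sum_inner_mul_inner (V.ρ (g : H) (vec V (toDual V φ))) v
  rw [V.unitary, star_coe_grouplike hg, inner_vec] at h3
  rw [← h3]
  exact Finset.sum_congr rfl fun i _ => mul_comm _ _

theorem inner_coevHom (V : URep H) (z : (unitObj hpos).V) (v : V.V) (φ : (dualObj hg hS V).V) :
    ⟪lin (coevHom hg hpos hS V) z, proj V (dualObj hg hS V) (v ⊗ₜ φ)⟫_ℂ =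
      toDual V φ (V.ρ (g * star (unitIncl hpos z)) v) := by
  have h1 : incl V (dualObj hg hS V) (lin (coevHom hg hpos hS V) z) =
      act V (dualObj hg hS V) (unitIncl hpos z ⊗ₜ 1) (coevOne hg hS V) := by
    refine toEnd_injective V ?_
    rw [toEnd_incl_coevHom, toEnd_act_tmul, toEnd_coevOne, S, antipode_one, map_one, mul_one,
      mul_one]
  rw [inner_proj_right, h1, inner_act, TensorProduct.star_tmul, star_one, act_tmul, map_one,
    Module.End.one_apply, inner_coevOne, map_mul, Module.End.mul_apply]

include hR in
-- The element acting on `v` is `S(R⁽²⁾) 1₍₁₎ R⁽¹⁾ ν`. As `1₍₁₎ ∈ H_s`, it equals `S(1₍₁₎) u ν =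
-- S(1₍₁₎) g`: the twist cancels `u` and leaves `g`.
theorem evAux_comm_act (V : URep H) (v : V.V) (φ : (dualObj hg hS V).V) :
    evAux hg hS V (TensorProduct.comm ℂ V.V _
      (act V (dualObj hg hS V) R (V.ρ (ribbonElement R g) v ⊗ₜ φ))) =
        evPair V φ v (((S ℂ (H := H)).rTensor H Δ₁) * ((g : H) ⊗ₜ[ℂ] (1 : H))) := by
  obtain ⟨r, hr, -⟩ := exists_repr_one (H := H)
  have h1 : ∀ (w : V.V) (X : H ⊗[ℂ] H), evAux hg hS V (TensorProduct.comm ℂ V.V _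
      (act V (dualObj hg hS V) X (w ⊗ₜ φ))) =
        ∑ i ∈ r.index, toDual V φ (V.ρ (antipodeMul ((r.left i ⊗ₜ 1) * X)) w) • r.right i := by
    intro w X
    induction X with
    | zero => simp
    | add a b ha hb =>
      simp only [map_add, LinearMap.add_apply, mul_add, add_smul, Finset.sum_add_distrib, ha, hb]
    | tmul a b =>
      rw [act_tmul, TensorProduct.comm_tmul, evAux_tmul, ← sum_comulOne r, map_sum]
      refine Finset.sum_congr rfl fun i _ => ?_
      rw [evPair_tmul, toDual_ρ, Algebra.TensorProduct.tmul_mul_tmul, one_mul, antipodeMul_tmul,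
        map_mul, map_mul]
      rfl
  have h2 : drinfeldElement R * ribbonElement R g = g := by
    rw [ribbonElement, ← mul_assoc, Ring.mul_inverse_cancel _ hR.isUnit_drinfeldElement, one_mul]
  rw [h1, ← sum_comulOne r, map_sum, Finset.sum_mul, map_sum]
  refine Finset.sum_congr rfl fun i _ => ?_
  rw [hR.antipodeMul_source_mul (hr i), ← Module.End.mul_apply, ← map_mul, mul_assoc, h2,
    LinearMap.rTensor_tmul, Algebra.TensorProduct.tmul_mul_tmul, mul_one, evPair_tmul]

/-- Pairing with `z` applies `ε` to the second leg and leaves `S(ε_s(z*)) g = S²(z*) g = g z*`, the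
same operator as in the scalar product with `b_V(z)`. -/
theorem conj_coevHom (V : URep H) : conj (coevHom hg hpos hS V) =
    tensorMap (twistIso hR hg V).hom (𝟙 (dualObj hg hS V)) ≫
      (braidIso hR V (dualObj hg hS V)).hom ≫ evHom hg hpos hS V := by
  refine conj_eq_of_inner _ _ fun z w => ?_
  refine LinearMap.congr_fun (f := innerₛₗ ℂ z ∘ₗ lin (_ ≫ _ ≫ evHom hg hpos hS V))
    (g := innerₛₗ ℂ (lin (coevHom hg hpos hS V) z)) (tensor_ext fun v φ => ?_) w
  change ⟪z, lin (_ ≫ _ ≫ evHom hg hpos hS V) (proj _ _ (v ⊗ₜ φ))⟫_ℂ = ⟪_, proj _ _ (v ⊗ₜ φ)⟫_ℂ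
  simp only [lin_comp_apply]
  rw [lin_tensorMap_tmul, inner_coevHom, braidIso_proj, inner_unitObj, unitIncl_evHom_proj,
    twistIso_apply, lin_id_apply, evAux_comm_act hR]
  have hz := star_mem_target (unitIncl_mem z)
  set y := star (unitIncl hpos z) with hy
  have h1 : ∀ X : H ⊗[ℂ] H, ε (y * evPair V φ v (((S ℂ (H := H)).rTensor H X) * ((g : H) ⊗ₜ[ℂ] (1 : H)))) =
      toDual V φ (V.ρ (S ℂ (TensorProduct.rid ℂ H
        ((counit (R := ℂ) (A := H)).lTensor H ((1 ⊗ₜ y) * X))) * g) v) := by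
    intro X
    induction X with
    | zero => simp
    | add a b ha hb => simp only [map_add, LinearMap.add_apply, mul_add, add_mul, ha, hb]
    | tmul a b => simp [evPair_tmul, mul_comm]
  rw [h1]
  change toDual V φ (V.ρ (S ℂ (sourceMap ℂ y) * g) v) = _
  rw [sourceMap_of_mem_target hz, hg.isCanonical.antipode_sq_mul]

/-- This follows from the adjoint of `b_V`. Naturality of the twist for `d_V`, whose target has
trivial twist, shows `d_V = b̄_V c (id ⊗ θ_V)`; taking adjoints gives the formula. -/
theorem conj_evHom (V : URep H) : conj (evHom hg hpos hS V) =
    coevHom hg hpos hS V ≫ (braidIso hR (dualObj hg hS V) V).inv ≫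
      tensorMap (𝟙 (dualObj hg hS V)) (twistIso hR hg V).inv := by
  set D := dualObj hg hS V with hD
  set d := evHom hg hpos hS V with hd
  have h1 : tensorMap (twistIso hR hg D).hom (twistIso hR hg V).hom ≫ (braidIso hR D V).hom ≫
      (braidIso hR V D).hom ≫ d = d := by
    have := twistIso_naturality hR hg d
    rw [twistIso_unit, Category.comp_id, twistIso_tensor] at this
    simpa only [Category.assoc] using this.symm
  have h2 : tensorMap (𝟙 D) (twistIso hR hg V).hom ≫ (braidIso hR D V).hom ≫
      tensorMap (twistIso hR hg V).hom (𝟙 D) ≫ (braidIso hR V D).hom ≫ d = d := by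
    rw [← Category.assoc (braidIso hR D V).hom, ← braidIso_naturality, Category.assoc,
      ← Category.assoc, tensorMap_comp]
    have h3 : tensorMap (𝟙 D ≫ 𝟙 D) ((twistIso hR hg V).hom ≫ (twistIso hR hg V).hom) =
        tensorMap (twistIso hR hg D).inv (twistIso hR hg V).hom ≫
          tensorMap (twistIso hR hg D).hom (twistIso hR hg V).hom := by
      rw [tensorMap_comp, Iso.inv_hom_id, Category.comp_id]
    have h4 : tensorMap (twistIso hR hg D).inv (twistIso hR hg V).hom =
        tensorMap (twistIso hR hg D).inv (𝟙 V) ≫ tensorMap (𝟙 D) (twistIso hR hg V).hom := by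
      rw [tensorMap_comp, Category.comp_id, Category.id_comp]
    rw [h3, Category.assoc, h1, h4, Category.assoc, hd, ← evHom_twist, ← Category.assoc,
      tensorMap_comp, Iso.inv_hom_id, Category.comp_id, tensorMap_id, Category.id_comp]
  have h5 : tensorMap (𝟙 D) (twistIso hR hg V).hom ≫ (braidIso hR D V).hom ≫
      conj (coevHom hg hpos hS V) = d := by
    rw [conj_coevHom hR]
    exact h2
  conv_lhs => rw [← h5]
  rw [conj_comp, conj_comp, conj_conj, conj_tensorMap, conj_id, conj_twistIso, conj_braidIso,
    Category.assoc]

end Ribbon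

end URep

namespace URep

/-! ### Roots of positive endomorphisms. -/

section PositiveRoot

variable {H : Type u} [Ring H] [Algebra ℂ H] [StarRing H]

/-- A positive endomorphism in `URep H` is of the form `s ∘ s̄`. -/
theorem exists_conj_comp_self {V : URep H} (f : V ⟶ V) (hf : (lin f).IsPositive) :
    ∃ s : V ⟶ V, f = conj s ≫ s := by
  obtain ⟨p, hp⟩ := exists_polynomial_root hf
  -- A polynomial in the endomorphism commutes with the action of `H`, so the root is again a
  -- morphism.
  set q : Module.End ℂ V.V := Polynomial.aeval (lin f) (p.map (algebraMap ℝ ℂ)) with hq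
  have hcomm : ∀ h : H, Commute q (V.ρ h) := fun h =>
    (Algebra.commute_of_mem_adjoin_singleton_of_commute (Polynomial.aeval_mem_adjoin_singleton _ _)
      (LinearMap.ext fun v => (lin_comm f h v).symm)).symm
  have hadj : LinearMap.adjoint q = q := by
    have hf' : LinearMap.adjoint (lin f) = lin f := (LinearMap.isSymmetric_iff_isSelfAdjoint _).1 hf.isSymmetric
    rw [hq]
    clear hp hcomm hq q
    induction p using Polynomial.induction_on' with
    | add p q hp hq => simp only [Polynomial.map_add, map_add, hp, hq]
    | monomial n a =>
      rw [← LinearMap.star_eq_adjoint] at hf' ⊢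
      simp [hf', Algebra.algebraMap_eq_smul_one]
  refine ⟨mkHom (q * q) fun h v => ?_, hom_ext ?_⟩
  · exact LinearMap.congr_fun ((hcomm h).mul_left (hcomm h)).eq v
  · rw [lin_comp, lin_conj, lin_mkHom, ← LinearMap.star_eq_adjoint, star_mul,
      LinearMap.star_eq_adjoint, hadj]
    exact hp.symm.trans (by simp only [pow_succ, pow_zero, one_mul, mul_assoc]; rfl)

end PositiveRoot

/-! ### The unitary ribbon structure. -/

section Main

variable {H : Type u} [Ring H] [Algebra ℂ H] [Coalgebra ℂ H] [StarRing H] [StarModule ℂ H]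
  [CStarQuantumGroupoid H] {R : H ⊗[ℂ] H} (hR : IsQuasitriangular R)
  {g : Hˣ} (hg : IsCanonicalGrouplike (g : H))
  (hpos : ∀ z ∈ targetSpace H, z ≠ 0 → 0 < (counit (R := ℂ) (star z * z)).re)
  (hS : ∀ h : H, S ℂ (star (S ℂ (star h))) = h)

/-- The structure morphisms of `URep H`. -/
def standardMorphisms : StandardMorphisms R hg hpos hS where
  assoc := assocIso
  assoc_apply := inclRight_assocIso
  leftUnitor := leftUnitIso hpos
  leftUnitor_apply := leftUnitIso_tmul
  rightUnitor := rightUnitIso hpos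
  rightUnitor_inv_apply := rightUnitIso_inv_eq
  braiding := braidIso hR
  braiding_apply := incl_braidIso hR
  twist := twistIso hR hg
  twist_apply := twistIso_apply hR hg
  coev := coevHom hg hpos hS
  coev_apply := incl_coevHom
  ev := evHom hg hpos hS
  ev_apply := unitIncl_evHom

/-- `URep H` is a monoidal category. -/
abbrev monoidalCategory : MonoidalCategory (URep H) where
  toMonoidalCategoryStruct := (standardMorphisms hR hg hpos hS).monoidalStruct
  tensorHom_def f k := by
    refine .trans ?_ (tensorMap_comp f (𝟙 _) (𝟙 _) k).symm
    rw [Category.comp_id, Category.id_comp]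
    rfl
  id_tensorHom_id := tensorMap_id
  tensorHom_comp_tensorHom f f' k k' := tensorMap_comp f k f' k'
  whiskerLeft_id := tensorMap_id
  id_whiskerRight := tensorMap_id
  associator_naturality {X₁ X₂ X₃ Y₁ Y₂ Y₃} f₁ f₂ f₃ := by
    change tensorMap (tensorMap f₁ f₂) f₃ ≫ (assocIso Y₁ Y₂ Y₃).hom =
      (assocIso X₁ X₂ X₃).hom ≫ tensorMap f₁ (tensorMap f₂ f₃)
    refine hom_ext (tensor_ext_left fun u v w => ?_)
    simp only [lin_comp_apply, lin_tensorMap_tmul, assocIso_tmul]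
  leftUnitor_naturality {X Y} f := by
    change tensorMap (𝟙 (unitObj hpos)) f ≫ (leftUnitIso hpos Y).hom =
      (leftUnitIso hpos X).hom ≫ f
    refine hom_tensor_ext fun z v => ?_
    simp only [lin_comp_apply, lin_tensorMap_tmul, leftUnitIso_tmul, lin_comm, lin_id_apply]
  rightUnitor_naturality {X Y} f := by
    change tensorMap f (𝟙 (unitObj hpos)) ≫ (rightUnitIso hpos Y).hom =
      (rightUnitIso hpos X).hom ≫ f
    refine hom_tensor_ext fun z v => ?_
    simp only [lin_comp_apply, lin_tensorMap_tmul, rightUnitIso_tmul, lin_comm, lin_id_apply]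
  pentagon W X Y Z := by
    change tensorMap (assocIso W X Y).hom (𝟙 Z) ≫ (assocIso W (tensor X Y) Z).hom ≫
        tensorMap (𝟙 W) (assocIso X Y Z).hom =
      (assocIso (tensor W X) Y Z).hom ≫ (assocIso W X (tensor Y Z)).hom
    refine hom_ext (tensor_ext_left fun x y z => ?_)
    refine LinearMap.congr_fun
      (f := lin (tensorMap (assocIso W X Y).hom (𝟙 Z) ≫ (assocIso W (tensor X Y) Z).hom ≫
        tensorMap (𝟙 W) (assocIso X Y Z).hom) ∘ₗ proj _ Z ∘ₗ
          (TensorProduct.mk ℂ _ _).flip z ∘ₗ proj _ Y ∘ₗ (TensorProduct.mk ℂ _ _).flip y)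
      (g := lin ((assocIso (tensor W X) Y Z).hom ≫ (assocIso W X (tensor Y Z)).hom) ∘ₗ proj _ Z ∘ₗ
          (TensorProduct.mk ℂ _ _).flip z ∘ₗ proj _ Y ∘ₗ (TensorProduct.mk ℂ _ _).flip y)
      (tensor_ext fun w x => ?_) x
    simp only [LinearMap.comp_apply, LinearMap.flip_apply, TensorProduct.mk_apply, lin_comp_apply,
      lin_tensorMap_tmul, assocIso_tmul, lin_id_apply]
  triangle X Y := by
    change (assocIso X (unitObj hpos) Y).hom ≫ tensorMap (𝟙 X) (leftUnitIso hpos Y).hom =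
      tensorMap (rightUnitIso hpos X).hom (𝟙 Y)
    refine hom_ext (tensor_ext_left fun x z y => ?_)
    simp only [lin_comp_apply, lin_tensorMap_tmul, assocIso_tmul, lin_id_apply, leftUnitIso_tmul,
      rightUnitIso_tmul]
    -- The triangle is the balancing over `H_t`: `z` acts on `Y` directly, and on `X` through `S⁻¹`.
    exact proj_tmul_target X Y (unitIncl_mem z) x y

/-- Twist, braiding and evaluation compose to the adjoint of the coevaluation, so the trace is `k̄
k` with `k = (f̄ ⊗ id) b_W`. -/
theorem qtrace_eq {V W : URep H} (f : V ⟶ W) :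
    letI := (standardMorphisms hR hg hpos hS).monoidalStruct
    (standardMorphisms hR hg hpos hS).ribbonData.qtrace (conj f ≫ f) =
      (coevHom hg hpos hS W ≫ tensorMap (conj f) (𝟙 _)) ≫
        conj (coevHom hg hpos hS W ≫ tensorMap (conj f) (𝟙 _)) := by
  change coevHom hg hpos hS W ≫ tensorMap ((conj f ≫ f) ≫ (twistIso hR hg W).hom) (𝟙 _) ≫
    (braidIso hR W (dualObj hg hS W)).hom ≫ evHom hg hpos hS W = _
  rw [conj_comp, conj_coevHom hR, conj_tensorMap, conj_conj, conj_id]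
  have h1 : tensorMap ((conj f ≫ f) ≫ (twistIso hR hg W).hom) (𝟙 (dualObj hg hS W)) =
      tensorMap (conj f) (𝟙 _) ≫ tensorMap f (𝟙 _) ≫ tensorMap (twistIso hR hg W).hom (𝟙 _) := by
    rw [tensorMap_comp, tensorMap_comp, Category.comp_id, Category.comp_id, Category.assoc]
  rw [h1]
  simp only [Category.assoc]

theorem qtrace_isPositive {V W : URep H} (f : V ⟶ W) :
    letI := (standardMorphisms hR hg hpos hS).monoidalStruct
    (lin ((standardMorphisms hR hg hpos hS).ribbonData.qtrace (conj f ≫ f))).IsPositive := by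
  have h := LinearMap.isPositive_adjoint_comp_self (𝕜 := ℂ)
    (lin (coevHom hg hpos hS W ≫ tensorMap (conj f) (𝟙 (dualObj hg hS W))))
  rw [← lin_conj, ← lin_comp, ← qtrace_eq hR] at h
  exact h

theorem isRibbonAb :
    letI := (standardMorphisms hR hg hpos hS).monoidalStruct
    (standardMorphisms hR hg hpos hS).ribbonData.IsRibbonAb ℂ :=
  letI := (standardMorphisms hR hg hpos hS).monoidalStruct
  { monoidal := ⟨monoidalCategory hR hg hpos hS, rfl⟩
    add_tensor := add_tensorMap
    tensor_add := tensorMap_add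
    smul_tensor := smul_tensorMap
    tensor_smul := tensorMap_smul
    braiding_naturality := braidIso_naturality hR
    hexagon_forward := braidIso_hexagon_forward hR
    hexagon_reverse := braidIso_hexagon_reverse hR
    twist_naturality := twistIso_naturality hR hg
    twist_tensor := twistIso_tensor hR hg
    coev_ev := coevHom_evHom
    ev_coev := evHom_coevHom
    twist_dual := coevHom_twist hR }

theorem isUnitaryRibbonAb :
    letI := (standardMorphisms hR hg hpos hS).monoidalStruct
    (standardMorphisms hR hg hpos hS).ribbonData.IsUnitaryRibbonAb conj :=
  letI := (standardMorphisms hR hg hpos hS).monoidalStruct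
  { toIsRibbonAb := isRibbonAb hR hg hpos hS
    conj_conj := conj_conj
    conj_add := fun _ _ => hom_ext (map_add LinearMap.adjoint _ _)
    conj_smul := fun _ _ => hom_ext (map_smulₛₗ LinearMap.adjoint _ _)
    conj_tensor := conj_tensorMap
    conj_comp := conj_comp
    conj_associator := conj_assocIso
    conj_leftUnitor := conj_leftUnitIso
    conj_rightUnitor := conj_rightUnitIso
    conj_braiding := conj_braidIso hR
    conj_twist := conj_twistIso hR hg
    conj_coev := conj_coevHom hR
    conj_ev := conj_evHom hR
    qtrace_nonneg := fun f => exists_conj_comp_self _ (qtrace_isPositive hR hg hpos hS f) }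

end Main

end URep

end QGroupoid

end

theorem mainTheorem8 {H : Type u} [Ring H] [Algebra ℂ H] [Coalgebra ℂ H] [StarRing H]
    [StarModule ℂ H] [CStarQuantumGroupoid H] (R : H ⊗[ℂ] H) (hR : IsQuasitriangular R) :
    (∃! g : H, IsCanonicalGrouplike g) ∧ IsUnit (drinfeldElement R) ∧
      ∀ (g : H) (hg : IsCanonicalGrouplike g),
        ∃ (hpos : ∀ z ∈ targetSpace H, z ≠ 0 → 0 < (counit (R := ℂ) (star z * z)).re)
          (hS : ∀ h : H, S ℂ (star (S ℂ (star h))) = h)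
          (D : URep.StandardMorphisms R hg hpos hS),
          letI : MonoidalCategoryStruct (URep H) := D.monoidalStruct
          D.ribbonData.IsUnitaryRibbonAb URep.conj ∧
            ∀ {V W : URep H} (f : V ⟶ W),
              (URep.lin (D.ribbonData.qtrace (URep.conj f ≫ f))).IsPositive := by
  refine ⟨hR.existsUnique_isCanonicalGrouplike, hR.isUnit_drinfeldElement, fun g hg => ?_⟩
  obtain ⟨g, rfl⟩ := hg.isUnit
  exact ⟨counit_star_mul_self_pos, antipode_star_antipode_star,
    URep.standardMorphisms hR hg _ _, URep.isUnitaryRibbonAb hR hg _ _,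
    URep.qtrace_isPositive hR hg _ _⟩
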